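/- **Setting.** Let $\mathfrak g$ be a finite-dimensional complex semisimple Lie algebra with Cartan subalgebra $\mathfrak h$, Chevalley–Serre generators $E_i,\check\alpha_i,F_i$ ($i\in I$), simple roots $\alpha_i$, Cartan matrix $a_{ij}=\langle\alpha_j,\check\alpha_i\rangle$, and $\mathfrak n$ the subalgebra generated by the $E_i$. Put $p_{-1}=\sum_i F_i$, let $\check\rho\in\mathfrak h$ satisfy $\langle\alpha_i,\check\rho\rangle=1$ for all $i$, let $s_i\check\mu=\check\mu-\langle\alpha_i,\check\mu\rangle\check\alpha_i$ on $\mathfrak h$, and $w\cdot\check\mu=w(\check\mu+\check\rho)-\check\rho$. Let $\nu$ be a permutation of $I$ with $a_{\nu(i)\nu(j)}=a_{ij}$, let $T\ge 1$ be a multiple of the order of $\nu$, $\omega$ a primitive $T$-th root of unity, and $\varsigma\in\mathrm{Aut}\,\mathfrak g$ the automorphism with $\varsigma(E_i)=\omega^{-1}E_{\nu(i)}$, $\varsigma(\check\alpha_i)=\check\alpha_{\nu(i)}$, $\varsigma(F_i)=\omega F_{\nu(i)}$. Let $\mathcal M=\mathbb C(t)$ be the field of meromorphic functions on $\mathbb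 P^1$, and let $\hat\varsigma$ act on $\mathfrak g(\mathcal M)=\mathfrak g\otimes\mathcal M$ by $\hat\varsigma(X\otimes f)=\varsigma(X)\otimes f(\omega^{-1}t)$. Let $N(\mathcal M)=\exp(\mathrm{ad}\,\mathfrak n(\mathcal M))$, on which $\hat\varsigma$ acts by conjugation, and let $N^{\hat\varsigma}(\mathcal M)$ be the subgroup of $\hat\varsigma$-invariant elements; it acts on connections by gauge transformations $g(d+A\,dt)g^{-1}=d-dg\,g^{-1}+\mathrm{Ad}_g A\,dt$. A *cyclotomic Miura $\mathfrak g$-oper* is a connection $\nabla=d+(p_{-1}+u)\,dt$ with $u\in\mathfrak h(\mathcal M)$ and $\omega^{-1}\hat\varsigma(u)=u$; write $\overline\nabla=d+u\,dt$, and $\mathrm{res}_x\overline\nabla$ for the residue of $u\,dt$ at $x$ when $u\,dt$ has at most a simple pole there. It is *monodromy-free* if $dY\,Y^{-1}=-(p_{-1}+u)\,dt$ has a meromorphic solution $Y$ on $\mathbb P^1$ with values in the adjoint group. Let $\check\lambda_0\in\mathfrak h$ be a $\nu$-invariant integral dominant coweight and let $\nabla=d+(p_{-1}+u)dt$ be a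 cyclotomic Miura $\mathfrak g$-oper such that $u\,dt$ has at most a simple pole at $0$, with $\mathrm{res}_0\overline\nabla=-\check\lambda_0$. Let $\mathcal I\subset I$ be a $\nu$-orbit of type $A_2^{\times|\mathcal I|/2}$, i.e. $3-\sum_{i\in\mathcal I}a_{ij}=2$ for $j\in\mathcal I$. Put $\bar\imath=\nu^{|\mathcal I|/2}(i)$, fix $k\in\mathcal I$, let $\mathcal I/2=\{k,\nu(k),\dots,\nu^{|\mathcal I|/2-1}(k)\}$, $s^\nu_{\mathcal I}=\prod_{i\in\mathcal I/2}s_is_{\bar\imath}s_i$ and $\eta=\langle\alpha_k,\check\lambda_0\rangle$. With $q=\langle\alpha_k,u\rangle$ and $\bar q=\langle\alpha_{\bar k},u\rangle$, consider solutions $f=(f_1,f_2,f_3)\in\mathcal M^3$, not all zero, of $$\begin{aligned}2f_1'+f_1^2+3f_2^2+(q+\bar q)f_1+(q-\bar q)f_2&=0,\\ 2f_2'+4f_1f_2-2f_3+(q+\bar q)f_2+(q-\bar q)f_1&=0,\\ 2f_3'+2f_1f_3+f_2(f_1^2-f_2^2)+2(q+\bar q)f_3&=0.\end{aligned}\tag{R}$$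 Put $f_{k,c}=f_c$, define $f_{i,c}$ for $i\in(\mathcal I/2)\setminus\{k\}$ recursively by $f_{i,c}(t)=\omega^{-1}f_{\nu^{-1}(i),c}(\omega^{-1}t)$ for $c=1,2$ and $f_{i,3}(t)=\omega^{-2}f_{\nu^{-1}(i),3}(\omega^{-1}t)$, and let $$g=\prod_{i\in\mathcal I/2}e^{f_{i,1}(E_i+E_{\bar\imath})+f_{i,2}(E_i-E_{\bar\imath})+f_{i,3}[E_i,E_{\bar\imath}]}\in N(\mathcal M).$$ **Theorem.** 1. (Regular solutions.) If there is a solution $f\neq0$ of (R) with $f_1,f_2,f_3$ all regular at $0$ and $g\in N^{\hat\varsigma}(\mathcal M)$, then $$\langle\alpha_k+\alpha_{\bar k},\check\lambda_0+\check\rho\rangle\equiv0\ \bmod\ \tfrac{T}{|\mathcal I|}.$$ Conversely, if this congruence holds and $\nabla$ is monodromy-free, then such a solution exists. For every such solution, $g\nabla g^{-1}$ is a cyclotomic Miura $\mathfrak g$-oper and $\mathrm{res}_0\overline{g\nabla g^{-1}}=\mathrm{res}_0\overline\nabla$. 2. (Singular solutions.) Let $f$ be a solution of (R) with at least one of $f_1,f_2,f_3$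 singular at $0$. Then $g\in N^{\hat\varsigma}(\mathcal M)$ if and only if $$f_1=\frac at+k_1,\qquad f_2=\frac bt+k_2,\qquad f_3=\frac c{t^2}+\frac dt+k_3$$ with $(a,b,c)=(2(\eta+1),0,0)$, some $d\in\mathbb C$ and $k_1,k_2,k_3\in\mathcal M$ regular at $0$; there is no condition on $\check\lambda_0$. In that case $g\nabla g^{-1}$ is a cyclotomic Miura $\mathfrak g$-oper and $-\mathrm{res}_0\overline{g\nabla g^{-1}}=s^\nu_{\mathcal I}\cdot(-\mathrm{res}_0\overline\nabla)$. 3. (Infinity.) Let $f\neq0$ be any solution of (R), regular or singular at $0$, with $g\in N^{\hat\varsigma}(\mathcal M)$. If $u\,dt$ has at most a simple pole at $\infty$ and $\langle\alpha_k,\mathrm{res}_\infty\overline\nabla+\check\rho\rangle$ is real and non-negative, then $\mathrm{res}_\infty\overline{g\nabla g^{-1}}=s^\nu_{\mathcal I}\cdot(\mathrm{res}_\infty\overline\nabla)$. -/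

import Mathlib

open scoped TensorProduct

noncomputable section

namespace CyclotomicMiura

/-! ### Meromorphic functions on the Riemann sphere -/

/-- The field of meromorphic functions on the Riemann sphere, i.e. rational functions of the
coordinate `t = RatFunc.X`. -/
abbrev Mer : Type := RatFunc ℂ

/-- The quotient rule `(p / q)' = (p' q - p q') / q ^ 2`, written with the reduced fraction. -/
def ratDerivFun (f : Mer) : Mer :=
  (algebraMap (Polynomial ℂ) Mer (Polynomial.derivative f.num) *
      algebraMap (Polynomial ℂ) Mer f.denom -
    algebraMap (Polynomial ℂ) Mer f.num *
      algebraMap (Polynomial ℂ) Mer (Polynomial.derivative f.denom)) /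
    algebraMap (Polynomial ℂ) Mer f.denom ^ 2

theorem ratDerivFun_div (p q : Polynomial ℂ) (hq : q ≠ 0) :
    ratDerivFun (algebraMap (Polynomial ℂ) Mer p / algebraMap (Polynomial ℂ) Mer q) =
      (algebraMap (Polynomial ℂ) Mer (Polynomial.derivative p) * algebraMap (Polynomial ℂ) Mer q -
        algebraMap (Polynomial ℂ) Mer p *
          algebraMap (Polynomial ℂ) Mer (Polynomial.derivative q)) /
        algebraMap (Polynomial ℂ) Mer q ^ 2 := by
  set f : Mer := algebraMap (Polynomial ℂ) Mer p / algebraMap (Polynomial ℂ) Mer q with hf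
  have hq' : algebraMap (Polynomial ℂ) Mer q ≠ 0 := RatFunc.algebraMap_ne_zero hq
  have hd' : algebraMap (Polynomial ℂ) Mer f.denom ≠ 0 :=
    RatFunc.algebraMap_ne_zero f.denom_ne_zero
  have hcross : f.num * q = p * f.denom := by
    apply RatFunc.algebraMap_injective ℂ
    rw [map_mul, map_mul]
    have h := f.num_div_denom
    rw [hf, ← hf, div_eq_div_iff hd' hq'] at h
    exact h
  have hcross' := congrArg Polynomial.derivative hcross
  rw [Polynomial.derivative_mul, Polynomial.derivative_mul] at hcross'
  have h1 := congrArg (algebraMap (Polynomial ℂ) Mer) hcross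
  have h2 := congrArg (algebraMap (Polynomial ℂ) Mer) hcross'
  simp only [map_add, map_mul] at h1 h2
  unfold ratDerivFun
  rw [div_eq_div_iff (pow_ne_zero 2 hd') (pow_ne_zero 2 hq')]
  linear_combination (algebraMap (Polynomial ℂ) Mer q * algebraMap (Polynomial ℂ) Mer f.denom) * h2
    - (algebraMap (Polynomial ℂ) Mer f.denom *
        algebraMap (Polynomial ℂ) Mer (Polynomial.derivative q)
      + algebraMap (Polynomial ℂ) Mer q *
        algebraMap (Polynomial ℂ) Mer (Polynomial.derivative f.denom)) * h1

/-- The derivative `d/dt` on meromorphic functions. -/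
def ratDeriv : Mer →ₗ[ℂ] Mer where
  toFun := ratDerivFun
  map_add' f g := by
    induction f using RatFunc.induction_on with | _ p q hq
    induction g using RatFunc.induction_on with | _ r s hs
    have hq' : algebraMap (Polynomial ℂ) Mer q ≠ 0 := RatFunc.algebraMap_ne_zero hq
    have hs' : algebraMap (Polynomial ℂ) Mer s ≠ 0 := RatFunc.algebraMap_ne_zero hs
    have h : algebraMap (Polynomial ℂ) Mer p / algebraMap (Polynomial ℂ) Mer q +
        algebraMap (Polynomial ℂ) Mer r / algebraMap (Polynomial ℂ) Mer s =
        algebraMap (Polynomial ℂ) Mer (p * s + q * r) / algebraMap (Polynomial ℂ) Mer (q * s) := by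
      rw [div_add_div _ _ hq' hs']; simp
    rw [h, ratDerivFun_div _ _ (mul_ne_zero hq hs), ratDerivFun_div _ _ hq, ratDerivFun_div _ _ hs]
    simp only [Polynomial.derivative_mul, map_add, map_mul]
    field_simp
    ring
  map_smul' c f := by
    induction f using RatFunc.induction_on with | _ p q hq
    have h : c • (algebraMap (Polynomial ℂ) Mer p / algebraMap (Polynomial ℂ) Mer q) =
        algebraMap (Polynomial ℂ) Mer (c • p) / algebraMap (Polynomial ℂ) Mer q := by
      rw [← RatFunc.mk_eq_div, ← RatFunc.mk_smul, RatFunc.mk_eq_div]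
    have h' (r : Polynomial ℂ) : algebraMap (Polynomial ℂ) Mer (c • r) =
        c • algebraMap (Polynomial ℂ) Mer r := by
      exact (IsScalarTower.toAlgHom ℂ (Polynomial ℂ) Mer).toLinearMap.map_smul c r
    rw [h, ratDerivFun_div _ _ hq, ratDerivFun_div _ _ hq]
    simp only [Polynomial.derivative_smul, h', smul_mul_assoc, ← smul_sub, RingHom.id_apply,
      smul_div_assoc]

/-- The substitution `X ↦ c X` on polynomials, for `c ≠ 0`. -/
def polyDil (c : ℂˣ) : Polynomial ℂ →ₐ[ℂ] Polynomial ℂ :=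
  Polynomial.aeval (Polynomial.C (c : ℂ) * Polynomial.X)

theorem polyDil_polyDil_inv (c : ℂˣ) (p : Polynomial ℂ) : polyDil c⁻¹ (polyDil c p) = p := by
  have h : (polyDil c⁻¹).comp (polyDil c) = AlgHom.id ℂ (Polynomial ℂ) := by
    apply Polynomial.algHom_ext
    simp only [polyDil, AlgHom.comp_apply, Polynomial.aeval_X, map_mul, AlgHom.id_apply,
      Polynomial.aeval_C, Polynomial.algebraMap_eq]
    rw [← mul_assoc, ← Polynomial.C_mul]
    simp
  exact DFunLike.congr_fun h p

theorem polyDil_injective (c : ℂˣ) : Function.Injective (polyDil c) :=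
  Function.LeftInverse.injective (polyDil_polyDil_inv c)

/-- The pullback `f(t) ↦ f(c t)` on meromorphic functions, for `c ≠ 0`. -/
def dil (c : ℂˣ) : Mer →ₐ[ℂ] Mer :=
  RatFunc.mapAlgHom (polyDil c)
    (nonZeroDivisors_le_comap_nonZeroDivisors_of_injective _ (polyDil_injective c))

/-- `f` has no pole at the origin. -/
def RegularAtZero (f : Mer) : Prop := f.denom.eval 0 ≠ 0

/-- `f` is `O(t⁻²)` at infinity. -/
def VanishesToOrderTwoAtInfty (f : Mer) : Prop := f = 0 ∨ RatFunc.intDegree f ≤ -2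

/-! ### Meromorphic functions with values in a vector space or a Lie algebra -/

section VectorValued

variable {V : Type*} [AddCommGroup V] [Module ℂ V]

/-- The derivative `d/dt` of vector-valued meromorphic functions. -/
def vecDeriv (V : Type*) [AddCommGroup V] [Module ℂ V] : Mer ⊗[ℂ] V →ₗ[ℂ] Mer ⊗[ℂ] V :=
  TensorProduct.map ratDeriv LinearMap.id

/-- The action `f ⊗ x ↦ f(ω⁻¹ t) ⊗ σ x` on vector-valued meromorphic functions. -/
def hatAction (ω : ℂˣ) (σ : V →ₗ[ℂ] V) : Mer ⊗[ℂ] V →ₗ[ℂ] Mer ⊗[ℂ] V :=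
  TensorProduct.map (dil ω⁻¹).toLinearMap σ

/-- The pairing of a covector with a vector-valued meromorphic function. -/
def pair (φ : Module.Dual ℂ V) : Mer ⊗[ℂ] V →ₗ[ℂ] Mer :=
  (TensorProduct.rid ℂ Mer).toLinearMap ∘ₗ TensorProduct.map LinearMap.id φ

/-- `v - μ / t` is regular at the origin, i.e. the differential `v dt` has at most a
simple pole at the origin and its residue there is `μ`. -/
def HasResZero (v : Mer ⊗[ℂ] V) (μ : V) : Prop :=
  ∀ φ : Module.Dual ℂ V, RegularAtZero (pair φ (v - (RatFunc.X : Mer)⁻¹ ⊗ₜ[ℂ] μ))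

/-- The differential `v dt` has at most a simple pole at infinity and its residue there is `μ`.
Since `dt / t` has residue `-1` at infinity, this says that `v = -μ / t + O(t⁻²)`. -/
def HasResInfty (v : Mer ⊗[ℂ] V) (μ : V) : Prop :=
  ∀ φ : Module.Dual ℂ V,
    VanishesToOrderTwoAtInfty (pair φ (v + (RatFunc.X : Mer)⁻¹ ⊗ₜ[ℂ] μ))

end VectorValued

/-! ### Connections, gauge transformations and monodromy -/

section Connections

variable {𝔤 : Type*} [LieRing 𝔤] [LieAlgebra ℂ 𝔤]

/-- `g (d + A dt) g⁻¹ = d + B dt`, where the element `g` of the adjoint group over `Mer` and both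
connections are seen as operators on the adjoint representation `𝔤 ⊗ Mer`
(on which `d + A dt` acts as `X ↦ X' + [A, X]`). When `𝔤` has trivial centre, `B` is determined
by `g` and `A`. -/
def IsGaugeTransform (g : Module.End Mer (Mer ⊗[ℂ] 𝔤)) (A B : Mer ⊗[ℂ] 𝔤) : Prop :=
  ∀ X : Mer ⊗[ℂ] 𝔤, g (vecDeriv 𝔤 X + ⁅A, X⁆) = vecDeriv 𝔤 (g X) + ⁅B, g X⁆

/-- The connection `d + A dt` has trivial monodromy: there is a meromorphic fundamental solution
`Y` of `dY Y⁻¹ = -A dt`. In the adjoint representation, this says that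
`Y (1 ⊗ X)` is a flat section for each `X`. -/
def MonodromyFree (A : Mer ⊗[ℂ] 𝔤) : Prop :=
  ∃ Y : (Mer ⊗[ℂ] 𝔤) ≃ₗ⁅Mer⁆ (Mer ⊗[ℂ] 𝔤), ∀ X : 𝔤,
    vecDeriv 𝔤 (Y (1 ⊗ₜ[ℂ] X)) + ⁅A, Y (1 ⊗ₜ[ℂ] X)⁆ = 0

end Connections

/-! ### Lie-theoretic data attached to Chevalley-Serre generators -/

section Chevalley

variable {ι : Type*} [Fintype ι] [DecidableEq ι] {𝔤 : Type*} [LieRing 𝔤] [LieAlgebra ℂ 𝔤]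
  {H : LieSubalgebra ℂ 𝔤} (b : LieAlgebra.Basis ι H)

/-- `p₋₁ = ∑ Fᵢ`, as a constant `𝔤`-valued function. -/
def pMinusOne : Mer ⊗[ℂ] 𝔤 := 1 ⊗ₜ[ℂ] ∑ i, b.f i

/-- The inclusion of `𝔥`-valued functions into `𝔤`-valued functions. -/
def cartanIncl (H : LieSubalgebra ℂ 𝔤) : Mer ⊗[ℂ] H →ₗ[ℂ] Mer ⊗[ℂ] 𝔤 :=
  TensorProduct.map LinearMap.id H.toSubmodule.subtype

/-- `𝔫`, the subalgebra generated by the `Eᵢ`. -/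
def nilp : LieSubalgebra ℂ 𝔤 := LieSubalgebra.lieSpan ℂ 𝔤 (Set.range b.e)

/-- `ρ ∈ 𝔥`, the sum of the fundamental coweights, written in the basis of simple coroots:
the coefficients `x` solve `A x = 1`, so `ρ` pairs to one with every simple root. -/
def rho : H := ∑ j, ((b.A.map (Int.cast : ℤ → ℂ))⁻¹.mulVec 1) j • b.h' j

/-- The action of the simple reflection `sᵢ` on the Cartan subalgebra. -/
def simpleReflection (i : ι) : Module.End ℂ H :=
  LinearMap.id - (b.baseSupp i).smulRight (b.h' i)

/-- The shifted action `w · x = w (x + ρ) - ρ`. -/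
def dot (w : Module.End ℂ H) (x : H) : H := w (x + rho b) - rho b

/-- The automorphism `ς` of `𝔤` with `ς(Eᵢ) = ω⁻¹ E_{ν i}`, `ς(α̌ᵢ) = α̌_{ν i}` and
`ς(Fᵢ) = ω F_{ν i}`. -/
def IsTwistedDiagramAut (ν : Equiv.Perm ι) (ω : ℂˣ) (ς : 𝔤 ≃ₗ⁅ℂ⁆ 𝔤) : Prop :=
  ∀ i, ς (b.e i) = (ω : ℂ)⁻¹ • b.e (ν i) ∧ ς (b.h i) = b.h (ν i) ∧
    ς (b.f i) = (ω : ℂ) • b.f (ν i)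

/-- `g ∈ N^ς̂(Mer)`: `g` lies in the unipotent group of all `exp(ad X)`, `X ∈ 𝔫 ⊗ Mer`, and it is
invariant under the automorphism of that group induced by `f ⊗ X ↦ f(ω⁻¹ t) ⊗ ς X`. -/
def MemUnipotentInvariants (ω : ℂˣ) (ς : 𝔤 ≃ₗ⁅ℂ⁆ 𝔤) (g : Module.End Mer (Mer ⊗[ℂ] 𝔤)) : Prop :=
  (∃ X ∈ (nilp b).toSubmodule.baseChange Mer,
      g = IsNilpotent.exp (LieAlgebra.ad Mer (Mer ⊗[ℂ] 𝔤) X)) ∧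
    ∀ Z : Mer ⊗[ℂ] 𝔤, g (hatAction ω (ς : 𝔤 →ₗ[ℂ] 𝔤) Z) = hatAction ω (ς : 𝔤 →ₗ[ℂ] 𝔤) (g Z)

/-- `v dt` is a cyclotomic `𝔥`-valued differential: `ω⁻¹ ς(v(ω⁻¹ t)) = v(t)`. -/
def IsCyclotomic (ω : ℂˣ) (ς : 𝔤 ≃ₗ⁅ℂ⁆ 𝔤) (v : Mer ⊗[ℂ] H) : Prop :=
  (ω : ℂ)⁻¹ • hatAction ω (ς : 𝔤 →ₗ[ℂ] 𝔤) (cartanIncl H v) = cartanIncl H v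

/-! ### The orbit of a simple root -/

/-- The orbit of `k` under `ν`. -/
def orbit (ν : Equiv.Perm ι) (k : ι) : Finset ι := by
  classical exact Finset.univ.filter fun i => ν.SameCycle k i

/-- The partner `ī = ν^{|I|/2}(i)` of `i`, where `I` is the orbit of `i`. -/
def bar (ν : Equiv.Perm ι) (i : ι) : ι := (ν ^ ((orbit ν i).card / 2)) i

/-- The number `ℓ_I = 3 - ∑_{i ∈ I} aᵢₖ` attached to the orbit `I` of `k`;
it is `2` exactly for the orbits of type `A₂^{×|I|/2}`. -/
def ell (ν : Equiv.Perm ι) (k : ι) : ℤ := 3 - ∑ i ∈ orbit ν k, b.A k i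

/-- `s^ν_I = ∏ sᵢ s_ī sᵢ`, the product over `i = ν^m(k)` with `0 ≤ m < |I|/2`. -/
def sOrbit (ν : Equiv.Perm ι) (k : ι) : Module.End ℂ H :=
  ((List.range ((orbit ν k).card / 2)).map fun m =>
    simpleReflection b ((ν ^ m) k) * simpleReflection b (bar ν ((ν ^ m) k)) *
      simpleReflection b ((ν ^ m) k)).prod

/-- The Riccati-type system, for `q = ⟨αᵢ, u⟩` and `q' = ⟨α_ī, u⟩`. -/
def RiccatiSystem (q q' : Mer) (f : Fin 3 → Mer) : Prop :=
  2 * ratDeriv (f 0) + f 0 ^ 2 + 3 * f 1 ^ 2 + (q + q') * f 0 + (q - q') * f 1 = 0 ∧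
  2 * ratDeriv (f 1) + 4 * f 0 * f 1 - 2 * f 2 + (q + q') * f 1 + (q - q') * f 0 = 0 ∧
  2 * ratDeriv (f 2) + 2 * f 0 * f 2 + f 1 * (f 0 ^ 2 - f 1 ^ 2) + 2 * (q + q') * f 2 = 0

/-- `f_{k,1}, f_{k,2}, f_{k,3}` solve the Riccati-type system at `k`. -/
def SolvesRiccati (ν : Equiv.Perm ι) (k : ι) (u : Mer ⊗[ℂ] H) (f : Fin 3 → Mer) : Prop :=
  RiccatiSystem (pair (b.baseSupp k) u) (pair (b.baseSupp (bar ν k)) u) f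

/-- The functions at `ν^m(k)`, propagated from the functions `f` at `k` by
`f_{ν(i),c}(t) = ω⁻¹ f_{i,c}(ω⁻¹ t)` for `c = 1, 2` and `f_{ν(i),3}(t) = ω⁻² f_{i,3}(ω⁻¹ t)`. -/
def propagate (ω : ℂˣ) (f : Fin 3 → Mer) : ℕ → Fin 3 → Mer
  | 0 => f
  | m + 1 =>
    ![(ω : ℂ)⁻¹ • dil ω⁻¹ (propagate ω f m 0),
      (ω : ℂ)⁻¹ • dil ω⁻¹ (propagate ω f m 1),
      ((ω : ℂ) ^ 2)⁻¹ • dil ω⁻¹ (propagate ω f m 2)]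

/-- The exponent `f₁ (Eᵢ + E_ī) + f₂ (Eᵢ - E_ī) + f₃ [Eᵢ, E_ī]`. -/
def gaugeExponent (ν : Equiv.Perm ι) (i : ι) (f : Fin 3 → Mer) : Mer ⊗[ℂ] 𝔤 :=
  f 0 ⊗ₜ[ℂ] (b.e i + b.e (bar ν i)) + f 1 ⊗ₜ[ℂ] (b.e i - b.e (bar ν i)) +
    f 2 ⊗ₜ[ℂ] ⁅b.e i, b.e (bar ν i)⁆

/-- The gauge parameter `g`: the product over `i = ν^m(k)`, `0 ≤ m < |I|/2`, of the exponentials of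
the exponents above, acting on the adjoint representation. -/
def gaugeParam (ν : Equiv.Perm ι) (ω : ℂˣ) (k : ι) (f : Fin 3 → Mer) :
    Module.End Mer (Mer ⊗[ℂ] 𝔤) :=
  ((List.range ((orbit ν k).card / 2)).map fun m =>
    IsNilpotent.exp (LieAlgebra.ad Mer (Mer ⊗[ℂ] 𝔤)
      (gaugeExponent b ν ((ν ^ m) k) (propagate ω f m)))).prod

/-- The singular behaviour at the origin
`f₁ = a / t + k₁`, `f₂ = b / t + k₂`, `f₃ = c / t² + d / t + k₃` with `k₁, k₂, k₃` regular at the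
origin and `d` any complex number. -/
def HasPolePattern (f : Fin 3 → Mer) (pa pb pc : ℂ) : Prop :=
  ∃ (d : ℂ) (k : Fin 3 → Mer), (∀ c, RegularAtZero (k c)) ∧
    f 0 = RatFunc.C pa / RatFunc.X + k 0 ∧
    f 1 = RatFunc.C pb / RatFunc.X + k 1 ∧
    f 2 = RatFunc.C pc / RatFunc.X ^ 2 + RatFunc.C d / RatFunc.X + k 2

end Chevalley

end CyclotomicMiura

end

open CyclotomicMiura

/-! Write x = f₁ + f₂ and y = f₁ - f₂ for the coefficients of E_k and E_k̄, and set A = f₃ + xy/2, B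
= -f₃ + xy/2, so that A + B = xy. With Q = q + q̄ the system (R) splits (`riccatiSystem_iff`) into
x' = A - x² - qx, A' = -(x + Q)A and the same pair for (y, B) with q and q̄ exchanged. Each pair is
linearised by r = x/A, P = 1/A, since r' = 1 + q̄r and P' = r + QP.

Let L = |𝓘|/2 and ζ = ω^{-L}. The orbit consists of L mutually orthogonal copies of A₂
(`exists_isA2Orbit`), and the generator of the cyclic action moves one copy to the next. After L
steps it returns to the first copy with k and k̄ exchanged. Hence g is invariant exactly when x(t) =
ζ y(ζt), y(t) = ζ x(ζt), B(t) = ζ² A(ζt) and A(t) = ζ² B(ζt)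
(`IsA2Orbit.memUnipotentInvariants_iff`, stated through `IsSymmetric`).

For a non-zero symmetric solution, A and B are non-zero of the same order a at the origin. The
equations for A' and B' give x and y the same residue ξ = 2η - a, and the t⁻² coefficient of A + B =
xy then gives ξ(ξ - 2(η + 1)) = 0 (`local_exponents`). If ξ = 0 the solution is regular, a = 2η, and
rotating the leading coefficient of A twice forces ζ^{4(η+1)} = 1, which is the congruence. If ξ =
2(η + 1) the solution has the stated pole (`symmetric_dichotomy`).

Conversely, a solution with that pole is unique: r and P vanish at the origin, where the homogeneous
equations have exponents -η and -2η, hence no non-zero vanishing solution. Its rotated image has the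
same pole, so it is symmetric (`isSymmetric_of_hasPolePattern`). Regular solutions are built from
rational solutions of the linear equations, with integration constants adjusted to the symmetry
(`exists_regular_symmetric_solution`). Trivial monodromy supplies these rational solutions, as
Killing pairings of flat sections with values in the lower Borel subalgebra
(`MonodromyFree.exists_solutions`).

Gauge transformation by g adds xα̌ + yα̌' for each copy to u, and (R) says that nothing else
survives (`isGaugeTransform_upper`). Residues therefore move by a multiple of the sum of the coroots
in the orbit, as under the dot action. At infinity, t ↦ 1/t preserves the shape of the equations,
with the negative number -(κ + 1) in place of η; the bound a ≥ -1 then excludes ξ = 0, so the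
reflection always occurs (`exponents_at_infinity`). -/

set_option linter.unusedSectionVars false

namespace CyclotomicMiura

/-! ### Calculus of rational functions -/

section RationalFunctions

open Polynomial in
theorem ratDeriv_div (p q : ℂ[X]) (hq : q ≠ 0) :
    ratDeriv (algebraMap ℂ[X] Mer p / algebraMap ℂ[X] Mer q) =
      (algebraMap ℂ[X] Mer (derivative p) * algebraMap ℂ[X] Mer q -
        algebraMap ℂ[X] Mer p * algebraMap ℂ[X] Mer (derivative q)) / algebraMap ℂ[X] Mer q ^ 2 :=
  ratDerivFun_div p q hq

theorem ratDeriv_mul (f g : Mer) : ratDeriv (f * g) = f * ratDeriv g + g * ratDeriv f := by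
  induction f using RatFunc.induction_on with | _ p q hq
  induction g using RatFunc.induction_on with | _ r s hs
  have hq' := RatFunc.algebraMap_ne_zero (K := ℂ) hq
  have hs' := RatFunc.algebraMap_ne_zero (K := ℂ) hs
  rw [div_mul_div_comm, ← map_mul, ← map_mul, ratDeriv_div _ _ (mul_ne_zero hq hs),
    ratDeriv_div _ _ hq, ratDeriv_div _ _ hs]
  simp only [Polynomial.derivative_mul, map_add, map_mul]
  field_simp
  ring

/-- `d/dt` as a derivation. -/
noncomputable def ratDerivation : Derivation ℂ Mer Mer :=
  Derivation.mk' ratDeriv fun f g => by simpa using ratDeriv_mul f g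

theorem ratDerivation_apply (f : Mer) : ratDerivation f = ratDeriv f := rfl

theorem ratDeriv_algebraMap (p : Polynomial ℂ) :
    ratDeriv (algebraMap (Polynomial ℂ) Mer p) =
      algebraMap (Polynomial ℂ) Mer (Polynomial.derivative p) := by
  simpa using ratDeriv_div p 1 one_ne_zero

@[simp] theorem ratDeriv_X : ratDeriv (RatFunc.X : Mer) = 1 := by
  rw [← RatFunc.algebraMap_X, ratDeriv_algebraMap]; simp

@[simp] theorem ratDeriv_C (c : ℂ) : ratDeriv (RatFunc.C c) = 0 := by
  rw [← RatFunc.algebraMap_C, ratDeriv_algebraMap]; simp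

@[simp] theorem ratDeriv_one : ratDeriv 1 = 0 := by simpa using ratDeriv_C 1

theorem ratDeriv_C_mul (c : ℂ) (f : Mer) : ratDeriv (RatFunc.C c * f) = RatFunc.C c * ratDeriv f := by
  rw [ratDeriv_mul]; simp

theorem ratDeriv_inv (f : Mer) : ratDeriv f⁻¹ = -ratDeriv f / f ^ 2 := by
  have := ratDerivation.leibniz_inv f
  simp only [ratDerivation_apply, smul_eq_mul] at this
  rw [this]; field_simp

theorem ratDeriv_div' (f g : Mer) (hg : g ≠ 0) :
    ratDeriv (f / g) = (ratDeriv f * g - f * ratDeriv g) / g ^ 2 := by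
  rw [div_eq_mul_inv, ratDeriv_mul, ratDeriv_inv]
  field_simp
  ring

theorem ratDeriv_zpow_X (n : ℤ) :
    ratDeriv ((RatFunc.X : Mer) ^ n) = RatFunc.C (n : ℂ) * RatFunc.X ^ (n - 1) := by
  have := ratDerivation.leibniz_zpow RatFunc.X n
  simp only [ratDerivation_apply, smul_eq_mul, ratDeriv_X, mul_one] at this
  rw [this, zsmul_eq_mul]; simp

/-- The chain rule, shared by the rotations t ↦ ct and by the inversion t ↦ 1/t. -/
theorem ratDeriv_algHom (τ : Mer →ₐ[ℂ] Mer) (f : Mer) :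
    ratDeriv (τ f) = τ (ratDeriv f) * ratDeriv (τ RatFunc.X) := by
  have hp (p : Polynomial ℂ) : ratDeriv (τ (algebraMap (Polynomial ℂ) Mer p)) =
      τ (algebraMap (Polynomial ℂ) Mer (Polynomial.derivative p)) * ratDeriv (τ RatFunc.X) := by
    have h (p : Polynomial ℂ) : τ (algebraMap (Polynomial ℂ) Mer p) =
        Polynomial.aeval (τ RatFunc.X) p := by
      rw [← RatFunc.aeval_X_left_eq_algebraMap, Polynomial.aeval_algHom_apply]
    rw [h, h]
    exact ratDerivation.map_aeval p _
  induction f using RatFunc.induction_on with | _ p q hq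
  have hq' : algebraMap (Polynomial ℂ) Mer q ≠ 0 := RatFunc.algebraMap_ne_zero (K := ℂ) hq
  have hq'' : τ (algebraMap (Polynomial ℂ) Mer q) ≠ 0 := by
    rwa [Ne, map_eq_zero_iff τ (RingHom.injective (τ : Mer →+* Mer))]
  rw [ratDeriv_div _ _ hq, map_div₀, ratDeriv_div' _ _ hq'', hp, hp]
  simp only [map_div₀, map_sub, map_mul, map_pow]
  ring

/-- A rational function with zero derivative is constant. -/
theorem exists_eq_C_of_ratDeriv_eq_zero {f : Mer} (hf : ratDeriv f = 0) : ∃ c, f = RatFunc.C c := by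
  have hd' : algebraMap (Polynomial ℂ) Mer f.denom ≠ 0 :=
    RatFunc.algebraMap_ne_zero f.denom_ne_zero
  have h : ratDerivFun f = 0 := hf
  rw [ratDerivFun, div_eq_zero_iff, or_iff_left (pow_ne_zero 2 hd'), sub_eq_zero, ← map_mul,
    ← map_mul] at h
  replace h := RatFunc.algebraMap_injective ℂ h
  have hcop := f.isCoprime_num_denom
  -- By coprimality the denominator divides its own derivative, which has smaller degree, so the
  -- denominator is constant.
  have h1 : f.denom ∣ Polynomial.derivative f.denom :=
    hcop.symm.dvd_of_dvd_mul_left (Dvd.intro_left _ h)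
  have h2 : f.denom.natDegree = 0 := by
    by_contra h0
    have h3 : Polynomial.derivative f.denom ≠ 0 := by
      intro h3
      exact h0 (Polynomial.derivative_eq_zero.1 h3)
    have := Polynomial.natDegree_le_of_dvd h1 h3
    have := Polynomial.natDegree_derivative_lt h0
    omega
  have h3 : Polynomial.derivative f.denom = 0 := by
    rw [Polynomial.eq_C_of_natDegree_eq_zero h2]; simp
  rw [h3, mul_zero, mul_eq_zero, or_iff_left f.denom_ne_zero] at h
  exact (RatFunc.eq_C_iff f).2 ⟨Polynomial.derivative_eq_zero.1 h, h2⟩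

end RationalFunctions

/-! ### Rational functions at the origin -/

section Local

/-- The value at the origin of a rational function. -/
noncomputable def ev (f : Mer) : ℂ := RatFunc.eval (RingHom.id ℂ) 0 f

theorem regularAtZero_div {p q : Polynomial ℂ} (hq : q.eval 0 ≠ 0) :
    RegularAtZero (algebraMap (Polynomial ℂ) Mer p / algebraMap (Polynomial ℂ) Mer q) := by
  intro h
  obtain ⟨r, hr⟩ := RatFunc.denom_div_dvd p q
  apply hq
  rw [hr, Polynomial.eval_mul, h, zero_mul]

theorem regularAtZero_iff {f : Mer} : RegularAtZero f ↔ ∃ p q : Polynomial ℂ, q.eval 0 ≠ 0 ∧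
    f = algebraMap (Polynomial ℂ) Mer p / algebraMap (Polynomial ℂ) Mer q :=
  ⟨fun h => ⟨f.num, f.denom, h, f.num_div_denom.symm⟩, by
    rintro ⟨p, q, hq, rfl⟩; exact regularAtZero_div hq⟩

variable {f g : Mer}

theorem RegularAtZero.denom_eval₂_ne_zero (hf : RegularAtZero f) :
    Polynomial.eval₂ (RingHom.id ℂ) 0 f.denom ≠ 0 := by
  exact hf

theorem RegularAtZero.of_polynomial (p : Polynomial ℂ) :
    RegularAtZero (algebraMap (Polynomial ℂ) Mer p) := by
  simp [RegularAtZero]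

theorem RegularAtZero.C (c : ℂ) : RegularAtZero (RatFunc.C c) := by simp [RegularAtZero]

theorem RegularAtZero.X : RegularAtZero RatFunc.X := by simp [RegularAtZero]

theorem RegularAtZero.zero : RegularAtZero 0 := by simp [RegularAtZero]

theorem RegularAtZero.one : RegularAtZero 1 := by simp [RegularAtZero]

theorem RegularAtZero.add (hf : RegularAtZero f) (hg : RegularAtZero g) : RegularAtZero (f + g) := by
  intro h
  obtain ⟨r, hr⟩ := RatFunc.denom_add_dvd f g
  have := congrArg (Polynomial.eval 0) hr
  rw [Polynomial.eval_mul, Polynomial.eval_mul, h, zero_mul] at this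
  exact mul_ne_zero hf hg this

theorem RegularAtZero.mul (hf : RegularAtZero f) (hg : RegularAtZero g) : RegularAtZero (f * g) := by
  intro h
  obtain ⟨r, hr⟩ := RatFunc.denom_mul_dvd f g
  have := congrArg (Polynomial.eval 0) hr
  rw [Polynomial.eval_mul, Polynomial.eval_mul, h, zero_mul] at this
  exact mul_ne_zero hf hg this

theorem RegularAtZero.neg (hf : RegularAtZero f) : RegularAtZero (-f) := by
  have := (RegularAtZero.C (-1)).mul hf
  simpa using this

theorem RegularAtZero.sub (hf : RegularAtZero f) (hg : RegularAtZero g) :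
    RegularAtZero (f - g) := by
  rw [sub_eq_add_neg]; exact hf.add hg.neg

theorem RegularAtZero.pow (hf : RegularAtZero f) (n : ℕ) : RegularAtZero (f ^ n) := by
  induction n with
  | zero => simpa using RegularAtZero.one
  | succ n ih => rw [pow_succ]; exact ih.mul hf

theorem RegularAtZero.ratDeriv (hf : RegularAtZero f) : RegularAtZero (ratDeriv f) := by
  obtain ⟨p, q, hq, rfl⟩ := regularAtZero_iff.1 hf
  have hq0 : q ≠ 0 := by rintro rfl; simp at hq
  rw [ratDeriv_div _ _ hq0, ← map_mul, ← map_mul, ← map_sub, ← map_pow]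
  apply regularAtZero_div
  simpa using hq

theorem ev_add (hf : RegularAtZero f) (hg : RegularAtZero g) : ev (f + g) = ev f + ev g :=
  RatFunc.eval_add _ _ hf.denom_eval₂_ne_zero hg.denom_eval₂_ne_zero

theorem ev_mul (hf : RegularAtZero f) (hg : RegularAtZero g) : ev (f * g) = ev f * ev g :=
  RatFunc.eval_mul _ _ hf.denom_eval₂_ne_zero hg.denom_eval₂_ne_zero

@[simp] theorem ev_C (c : ℂ) : ev (RatFunc.C c) = c := by simp [ev]

@[simp] theorem ev_X : ev RatFunc.X = 0 := by simp [ev]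

@[simp] theorem ev_zero : ev 0 = 0 := by simp [ev]

@[simp] theorem ev_one : ev 1 = 1 := by simp [ev]

theorem ev_algebraMap (p : Polynomial ℂ) : ev (algebraMap (Polynomial ℂ) Mer p) = p.eval 0 := by
  simp [ev, Polynomial.coeff_zero_eq_eval_zero]

theorem ev_neg (hf : RegularAtZero f) : ev (-f) = -ev f := by
  have := ev_mul (RegularAtZero.C (-1)) hf
  rw [ev_C] at this
  simpa using this

theorem ev_sub (hf : RegularAtZero f) (hg : RegularAtZero g) : ev (f - g) = ev f - ev g := by
  rw [sub_eq_add_neg, ev_add hf hg.neg, ev_neg hg, sub_eq_add_neg]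

theorem ev_pow (hf : RegularAtZero f) (n : ℕ) : ev (f ^ n) = ev f ^ n := by
  induction n with
  | zero => simp
  | succ n ih => rw [pow_succ, ev_mul (hf.pow n) hf, ih, pow_succ]

theorem ne_zero_of_ev_ne_zero (h : ev f ≠ 0) : f ≠ 0 := by
  rintro rfl; simp at h

theorem RegularAtZero.inv (hf : RegularAtZero f) (h : ev f ≠ 0) : RegularAtZero f⁻¹ := by
  obtain ⟨p, q, hq, rfl⟩ := regularAtZero_iff.1 hf
  rw [inv_div]
  apply regularAtZero_div
  intro hp
  apply h
  have hq0 : q ≠ 0 := by rintro rfl; simp at hq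
  have hq' : algebraMap (Polynomial ℂ) Mer q ≠ 0 := RatFunc.algebraMap_ne_zero (K := ℂ) hq0
  have := ev_mul hf (RegularAtZero.of_polynomial q)
  rw [div_mul_cancel₀ _ hq', ev_algebraMap, ev_algebraMap, hp] at this
  simpa [hq] using this.symm

theorem exists_eq_X_mul (hf : RegularAtZero f) (h : ev f = 0) :
    ∃ g, RegularAtZero g ∧ f = RatFunc.X * g := by
  obtain ⟨p, q, hq, rfl⟩ := regularAtZero_iff.1 hf
  have hq0 : q ≠ 0 := by rintro rfl; simp at hq
  have hq' : algebraMap (Polynomial ℂ) Mer q ≠ 0 := RatFunc.algebraMap_ne_zero (K := ℂ) hq0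
  have := ev_mul hf (RegularAtZero.of_polynomial q)
  rw [div_mul_cancel₀ _ hq', h, zero_mul, ev_algebraMap] at this
  obtain ⟨r, rfl⟩ : Polynomial.X ∣ p := by
    rwa [Polynomial.X_dvd_iff, Polynomial.coeff_zero_eq_eval_zero]
  exact ⟨_, regularAtZero_div (p := r) hq, by rw [map_mul, RatFunc.algebraMap_X, mul_div_assoc]⟩

/-- The regular part of a regular function. -/
theorem exists_eq_C_add (hf : RegularAtZero f) :
    ∃ g, RegularAtZero g ∧ f = RatFunc.C (ev f) + RatFunc.X * g := by
  obtain ⟨g, hg, h⟩ := exists_eq_X_mul (hf.sub (RegularAtZero.C (ev f)))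
    (by rw [ev_sub hf (RegularAtZero.C _)]; simp)
  exact ⟨g, hg, by rw [← h]; ring⟩

open Polynomial in
theorem exists_eq_zpow_mul (hf : f ≠ 0) :
    ∃ (n : ℤ) (g : Mer), RegularAtZero g ∧ ev g ≠ 0 ∧ f = RatFunc.X ^ n * g := by
  have key (p : ℂ[X]) (hp : p ≠ 0) : ∃ (n : ℕ) (r : ℂ[X]), r.eval 0 ≠ 0 ∧ p = X ^ n * r := by
    obtain ⟨r, hr, hr'⟩ := exists_eq_pow_rootMultiplicity_mul_and_not_dvd p hp 0
    simp only [map_zero, sub_zero] at hr hr'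
    exact ⟨_, r, by rwa [X_dvd_iff, coeff_zero_eq_eval_zero] at hr', hr⟩
  obtain ⟨m, r, hr, hnum⟩ := key f.num (RatFunc.num_ne_zero hf)
  obtain ⟨n, s, hs, hden⟩ := key f.denom f.denom_ne_zero
  have hs0 : algebraMap (Polynomial ℂ) Mer s ≠ 0 :=
    RatFunc.algebraMap_ne_zero (K := ℂ) (by rintro rfl; simp at hs)
  refine ⟨m - n, algebraMap _ _ r / algebraMap _ _ s, regularAtZero_div hs, fun h => ?_, ?_⟩
  · have := ev_mul (regularAtZero_div (p := r) hs) (RegularAtZero.of_polynomial s)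
    rw [div_mul_cancel₀ _ hs0, h, ev_algebraMap, zero_mul] at this
    exact hr this
  · conv_lhs => rw [← f.num_div_denom]
    rw [hnum, hden, zpow_sub₀ RatFunc.X_ne_zero]
    simp only [map_mul, map_pow, RatFunc.algebraMap_X, zpow_natCast]
    rw [mul_div_mul_comm]

theorem regularAtZero_zpow {n : ℤ} (hn : 0 ≤ n) : RegularAtZero (RatFunc.X ^ n) := by
  lift n to ℕ using hn
  rw [zpow_natCast]; exact RegularAtZero.X.pow n

theorem ev_zpow {n : ℤ} (hn : 0 < n) : ev (RatFunc.X ^ n) = 0 := by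
  lift n to ℕ using hn.le
  rw [zpow_natCast, ev_pow RegularAtZero.X, ev_X, zero_pow (by omega)]

/-- `t ^ n` times a unit is regular at the origin only if `n` is non-negative. -/
theorem nonneg_of_regular_zpow_mul {n : ℤ} (h : ev g ≠ 0)
    (hr : RegularAtZero (RatFunc.X ^ n * g)) : 0 ≤ n := by
  by_contra! hn
  have h1 := ev_mul (regularAtZero_zpow (n := -n) (by omega)) hr
  rw [ev_zpow (by omega), zero_mul, ← mul_assoc, ← zpow_add₀ RatFunc.X_ne_zero] at h1
  simp [h] at h1

theorem ratDeriv_zpow_mul (n : ℤ) (g : Mer) : ratDeriv (RatFunc.X ^ n * g) =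
    RatFunc.X ^ (n - 1) * (RatFunc.C (n : ℂ) * g + RatFunc.X * ratDeriv g) := by
  rw [ratDeriv_mul, ratDeriv_zpow_X, zpow_sub_one₀ RatFunc.X_ne_zero]
  field_simp [RatFunc.X_ne_zero]
  ring

/-- The logarithmic derivative. -/
theorem ratDeriv_zpow_mul_eq {n : ℤ} (hg : RegularAtZero g) (h : ev g ≠ 0) :
    ∃ w, RegularAtZero w ∧ ratDeriv (RatFunc.X ^ n * g) =
      (RatFunc.C (n : ℂ) / RatFunc.X + w) * (RatFunc.X ^ n * g) := by
  refine ⟨ratDeriv g * g⁻¹, hg.ratDeriv.mul (hg.inv h), ?_⟩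
  have := ne_zero_of_ev_ne_zero h
  rw [ratDeriv_zpow_mul, zpow_sub_one₀ RatFunc.X_ne_zero]
  field_simp [RatFunc.X_ne_zero]

theorem eq_zero_of_C_div_X_eq {c : ℂ} (hg : RegularAtZero g) (h : RatFunc.C c / RatFunc.X = g) :
    c = 0 := by
  rw [div_eq_iff RatFunc.X_ne_zero] at h
  have := congrArg ev h
  rwa [ev_mul hg RegularAtZero.X, ev_X, mul_zero, ev_C] at this

/-- Integration of regular functions. -/
theorem exists_eq_of_ratDeriv {n : ℕ} (hg : RegularAtZero g)
    (h : ratDeriv f = RatFunc.X ^ n * g) :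
    ∃ (c : ℂ) (w : Mer), RegularAtZero w ∧ f = RatFunc.C c + RatFunc.X ^ (n + 1) * w := by
  have key {f : Mer} (hf0 : f ≠ 0) (h : ratDeriv f = RatFunc.X ^ n * g) :
      ∃ (m : ℤ) (w : Mer), RegularAtZero w ∧ ev w ≠ 0 ∧ f = RatFunc.X ^ m * w ∧
        (m = 0 ∨ n + 1 ≤ m) := by
    obtain ⟨m, w, hw, hw0, rfl⟩ := exists_eq_zpow_mul hf0
    refine ⟨m, w, hw, hw0, rfl, ?_⟩
    -- For m ≠ 0 the derivative of t^m w has order exactly m - 1, because m w(0) ≠ 0. This must be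
    -- at least n.
    by_contra! hm
    rw [ratDeriv_zpow_mul] at h
    have h2 : RatFunc.C (m : ℂ) * w + RatFunc.X * ratDeriv w =
        RatFunc.X ^ (n - (m - 1)) * g := by
      rw [zpow_sub₀ RatFunc.X_ne_zero, div_mul_eq_mul_div, zpow_natCast, ← h]
      field_simp [RatFunc.X_ne_zero]
    have h3 := congrArg ev h2
    rw [ev_mul (regularAtZero_zpow (by omega)) hg, ev_zpow (by omega),
      ev_add ((RegularAtZero.C _).mul hw) (RegularAtZero.X.mul hw.ratDeriv),
      ev_mul (RegularAtZero.C _) hw, ev_mul RegularAtZero.X hw.ratDeriv] at h3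
    rw [ev_C, ev_X, zero_mul, zero_mul, add_zero, mul_eq_zero, or_iff_left hw0] at h3
    exact hm.1 (by exact_mod_cast h3)
  have key2 {f : Mer} (h : ratDeriv f = RatFunc.X ^ n * g) : RegularAtZero f := by
    by_cases hf0 : f = 0
    · rw [hf0]; exact RegularAtZero.zero
    · obtain ⟨m, w, hw, -, rfl, hm⟩ := key hf0 h
      exact (regularAtZero_zpow (by omega)).mul hw
  have hf := key2 h
  -- Subtracting the value at the origin excludes order zero and leaves order at least n + 1.
  have h' : ratDeriv (f - RatFunc.C (ev f)) = RatFunc.X ^ n * g := by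
    rw [map_sub, ratDeriv_C, sub_zero, h]
  have hev : ev (f - RatFunc.C (ev f)) = 0 := by rw [ev_sub hf (RegularAtZero.C _), ev_C, sub_self]
  refine ⟨ev f, (f - RatFunc.C (ev f)) / RatFunc.X ^ (n + 1), ?_, by
    field_simp [RatFunc.X_ne_zero]; ring⟩
  by_cases hf0 : f - RatFunc.C (ev f) = 0
  · rw [hf0, zero_div]; exact RegularAtZero.zero
  · obtain ⟨m, w, hw, hw0, hm, h0 | h0⟩ := key hf0 h'
    · rw [hm, h0, zpow_zero, one_mul] at hev
      exact absurd hev hw0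
    · have : (f - RatFunc.C (ev f)) / RatFunc.X ^ (n + 1) = RatFunc.X ^ (m - (n + 1)) * w := by
        rw [hm, zpow_sub₀ RatFunc.X_ne_zero]
        norm_cast
        ring
      rw [this]
      exact (regularAtZero_zpow (by omega)).mul hw

end Local

/-! ### Dilations and the inversion `t ↦ 1 / t` -/

section Substitutions

theorem dil_algebraMap (c : ℂˣ) (p : Polynomial ℂ) : dil c (algebraMap (Polynomial ℂ) Mer p) =
    algebraMap (Polynomial ℂ) Mer (polyDil c p) := by
  have := RatFunc.map_apply_div (polyDil c) (nonZeroDivisors_le_comap_nonZeroDivisors_of_injective _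
    (polyDil_injective c)) p 1
  simpa [dil, RatFunc.coe_mapAlgHom_eq_coe_map] using this

@[simp] theorem dil_X (c : ℂˣ) : dil c RatFunc.X = RatFunc.C (c : ℂ) * RatFunc.X := by
  rw [← RatFunc.algebraMap_X, dil_algebraMap]
  simp [polyDil]

@[simp] theorem dil_C (c : ℂˣ) (a : ℂ) : dil c (RatFunc.C a) = RatFunc.C a := by
  rw [← RatFunc.algebraMap_eq_C]; exact (dil c).commutes a

/-- Reduces identities between compositions of substitutions to a check on the coordinate. -/
theorem algHom_ext_mer {τ τ' : Mer →ₐ[ℂ] Mer} (h : τ RatFunc.X = τ' RatFunc.X) : τ = τ' := by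
  have hp (p : Polynomial ℂ) :
      τ (algebraMap (Polynomial ℂ) Mer p) = τ' (algebraMap (Polynomial ℂ) Mer p) := by
    rw [← RatFunc.aeval_X_left_eq_algebraMap, ← Polynomial.aeval_algHom_apply,
      ← Polynomial.aeval_algHom_apply, h]
  ext f
  induction f using RatFunc.induction_on with | _ p q hq
  rw [map_div₀, map_div₀, hp, hp]

theorem dil_dil (c d : ℂˣ) (f : Mer) : dil c (dil d f) = dil (c * d) f := by
  have : (dil c).comp (dil d) = dil (c * d) := algHom_ext_mer (by simp; ring)
  exact DFunLike.congr_fun this f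

theorem dil_one (f : Mer) : dil 1 f = f := by
  have : dil 1 = AlgHom.id ℂ Mer := algHom_ext_mer (by simp)
  exact DFunLike.congr_fun this f

theorem ratDeriv_dil (c : ℂˣ) (f : Mer) :
    ratDeriv (dil c f) = RatFunc.C (c : ℂ) * dil c (ratDeriv f) := by
  rw [ratDeriv_algHom, dil_X, ratDeriv_C_mul, ratDeriv_X]; ring

theorem dil_ne_zero (c : ℂˣ) {f : Mer} (hf : f ≠ 0) : dil c f ≠ 0 := by
  rwa [Ne, map_eq_zero_iff (dil c) (RingHom.injective (dil c : Mer →+* Mer))]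

theorem eval_polyDil (c : ℂˣ) (p : Polynomial ℂ) : (polyDil c p).eval 0 = p.eval 0 := by
  simp [polyDil, ← Polynomial.comp_eq_aeval, Polynomial.eval_comp]

theorem RegularAtZero.dil {f : Mer} (hf : RegularAtZero f) (c : ℂˣ) : RegularAtZero (dil c f) := by
  obtain ⟨p, q, hq, rfl⟩ := regularAtZero_iff.1 hf
  rw [map_div₀, dil_algebraMap, dil_algebraMap]
  apply regularAtZero_div
  rwa [eval_polyDil]

theorem ev_dil {f : Mer} (hf : RegularAtZero f) (c : ℂˣ) : ev (dil c f) = ev f := by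
  obtain ⟨g, hg, h⟩ := exists_eq_C_add hf
  rw [h, map_add, map_mul, dil_C, dil_X, mul_assoc,
    ev_add (RegularAtZero.C _) ((RegularAtZero.C _).mul (RegularAtZero.X.mul (hg.dil c))),
    ev_add (RegularAtZero.C _) (RegularAtZero.X.mul hg), ev_mul RegularAtZero.X hg,
    ev_mul (RegularAtZero.C _) (RegularAtZero.X.mul (hg.dil c)),
    ev_mul RegularAtZero.X (hg.dil c)]
  simp

open Polynomial in
theorem aeval_inv_X (p : ℂ[X]) : aeval (RatFunc.X : Mer)⁻¹ p =
    algebraMap ℂ[X] Mer p.reverse * RatFunc.X⁻¹ ^ p.natDegree := by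
  let : Invertible ((RatFunc.X : Mer)⁻¹) := invertibleOfNonzero (inv_ne_zero RatFunc.X_ne_zero)
  have := eval₂_reverse_mul_pow (algebraMap ℂ Mer) (RatFunc.X⁻¹ : Mer) p
  rw [invOf_eq_inv, inv_inv] at this
  rw [aeval_def, ← this, ← aeval_def, RatFunc.aeval_X_left_eq_algebraMap]

theorem aeval_inv_X_injective :
    Function.Injective (Polynomial.aeval (R := ℂ) (RatFunc.X : Mer)⁻¹) := by
  rw [injective_iff_map_eq_zero]
  intro p hp
  rw [aeval_inv_X, mul_eq_zero, or_iff_left (pow_ne_zero _ (inv_ne_zero RatFunc.X_ne_zero)),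
    map_eq_zero_iff _ (RatFunc.algebraMap_injective ℂ)] at hp
  exact Polynomial.reverse_eq_zero.1 hp

/-- The substitution `t ↦ 1 / t`. -/
noncomputable def inversion : Mer →ₐ[ℂ] Mer :=
  RatFunc.liftAlgHom (Polynomial.aeval (RatFunc.X : Mer)⁻¹)
    (nonZeroDivisors_le_comap_nonZeroDivisors_of_injective _ aeval_inv_X_injective)

theorem inversion_div (p q : Polynomial ℂ) :
    inversion (algebraMap (Polynomial ℂ) Mer p / algebraMap (Polynomial ℂ) Mer q) =
      Polynomial.aeval (RatFunc.X : Mer)⁻¹ p / Polynomial.aeval (RatFunc.X : Mer)⁻¹ q :=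
  RatFunc.liftAlgHom_apply_div _ _ _ _

@[simp] theorem inversion_X : inversion RatFunc.X = RatFunc.X⁻¹ := by
  simpa using inversion_div Polynomial.X 1

@[simp] theorem inversion_C (c : ℂ) : inversion (RatFunc.C c) = RatFunc.C c := by
  rw [← RatFunc.algebraMap_eq_C]; exact inversion.commutes c

theorem ratDeriv_inversion (f : Mer) :
    ratDeriv (inversion f) = -inversion (ratDeriv f) / RatFunc.X ^ 2 := by
  rw [ratDeriv_algHom, inversion_X, ratDeriv_inv, ratDeriv_X]; ring

theorem inversion_inversion (f : Mer) : inversion (inversion f) = f := by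
  have : inversion.comp inversion = AlgHom.id ℂ Mer := algHom_ext_mer (by simp)
  exact DFunLike.congr_fun this f

theorem inversion_dil (c : ℂˣ) (f : Mer) : inversion (dil c f) = dil c⁻¹ (inversion f) := by
  have : inversion.comp (dil c) = (dil c⁻¹).comp inversion :=
    algHom_ext_mer (by simp [map_inv₀, mul_comm])
  exact DFunLike.congr_fun this f

/-- The degree of a fraction becomes minus its order at the origin, because reversed polynomials
have non-zero constant term. -/
theorem inversion_eq_zpow_mul {f : Mer} (hf : f ≠ 0) : ∃ g, RegularAtZero g ∧ ev g ≠ 0 ∧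
    inversion f = RatFunc.X ^ (-f.intDegree) * g := by
  have hn : f.num.reverse.eval 0 ≠ 0 := by
    simpa [← Polynomial.coeff_zero_eq_eval_zero] using hf
  have hd : f.denom.reverse.eval 0 ≠ 0 := by
    simpa [← Polynomial.coeff_zero_eq_eval_zero] using f.denom_ne_zero
  have hd0 : algebraMap (Polynomial ℂ) Mer f.denom.reverse ≠ 0 :=
    RatFunc.algebraMap_ne_zero (K := ℂ) (by intro h; simp [h] at hd)
  refine ⟨algebraMap _ _ f.num.reverse / algebraMap _ _ f.denom.reverse, regularAtZero_div hd,
    fun h => ?_, ?_⟩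
  · have := ev_mul (regularAtZero_div (p := f.num.reverse) hd) (RegularAtZero.of_polynomial f.denom.reverse)
    rw [div_mul_cancel₀ _ hd0, h, ev_algebraMap, zero_mul] at this
    exact hn this
  · conv_lhs => rw [← f.num_div_denom]
    rw [inversion_div, aeval_inv_X, aeval_inv_X, RatFunc.intDegree, neg_sub,
      zpow_sub₀ RatFunc.X_ne_zero, zpow_natCast, zpow_natCast, inv_pow, inv_pow]
    field_simp [RatFunc.X_ne_zero]

/-- Carries questions at infinity to the origin, where the calculus of regular functions applies. -/
theorem vanishesToOrderTwoAtInfty_iff {f : Mer} : VanishesToOrderTwoAtInfty f ↔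
    RegularAtZero (inversion f / RatFunc.X ^ 2) := by
  by_cases hf : f = 0
  · simp [hf, VanishesToOrderTwoAtInfty, RegularAtZero.zero]
  obtain ⟨g, hg, hg0, h⟩ := inversion_eq_zpow_mul hf
  have h2 : inversion f / RatFunc.X ^ 2 = RatFunc.X ^ (-f.intDegree - 2) * g := by
    rw [h, zpow_sub₀ RatFunc.X_ne_zero, div_mul_eq_mul_div]; norm_cast
  rw [h2, VanishesToOrderTwoAtInfty, or_iff_right hf]
  constructor
  · intro h3
    exact (regularAtZero_zpow (by omega)).mul hg
  · intro h3
    have := nonneg_of_regular_zpow_mul hg0 h3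
    omega

end Substitutions

/-! ### The Riccati system in triangular form -/

section Riccati

/-- The system `x' = A - x² - q x`, `A' = -(x + Q) A`; it is linearised by
`r = x / A`, `P = 1 / A`. -/
def TriangularSystem (q Q x A : Mer) : Prop :=
  ratDeriv x = A - x ^ 2 - q * x ∧ ratDeriv A = -(x + Q) * A

theorem ratDeriv_div_two (f : Mer) : ratDeriv (f / 2) = ratDeriv f / 2 := by
  have : f / 2 = RatFunc.C (1 / 2) * f := by rw [map_div₀, map_one, map_ofNat]; ring
  rw [this, ratDeriv_C_mul, map_div₀, map_one, map_ofNat]; ring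

/-- In the 3 × 3 model of A₂ the unipotent matrix exp(xE₁₂ + yE₂₃ + f₃E₁₃) has corner entry f₃ +
xy/2, and its inverse has corner entry -f₃ + xy/2. In these variables the system decouples, up to
the relation that the two corner entries add up to xy. -/
theorem riccatiSystem_iff (q q' : Mer) (f : Fin 3 → Mer) : RiccatiSystem q q' f ↔
    TriangularSystem q (q + q') (f 0 + f 1) (f 2 + (f 0 + f 1) * (f 0 - f 1) / 2) ∧
      TriangularSystem q' (q + q') (f 0 - f 1) (-f 2 + (f 0 + f 1) * (f 0 - f 1) / 2) := by
  have h2 : (2 : Mer) ≠ 0 := two_ne_zero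
  simp only [RiccatiSystem, TriangularSystem, map_add, map_sub, map_neg, ratDeriv_div_two,
    ratDeriv_mul]
  generalize ratDeriv (f 0) = a
  generalize ratDeriv (f 1) = b
  generalize ratDeriv (f 2) = c
  generalize f 0 = u
  generalize f 1 = v
  generalize f 2 = w
  constructor
  · rintro ⟨h0, h1, h2⟩
    refine ⟨⟨?_, ?_⟩, ?_, ?_⟩
    · linear_combination (1 / 2 : Mer) * h0 + (1 / 2 : Mer) * h1
    · linear_combination (1 / 2 : Mer) * h2 + (1 / 2 : Mer) * u * h0 - (1 / 2 : Mer) * v * h1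
    · linear_combination (1 / 2 : Mer) * h0 - (1 / 2 : Mer) * h1
    · linear_combination -(1 / 2 : Mer) * h2 + (1 / 2 : Mer) * u * h0 - (1 / 2 : Mer) * v * h1
  · rintro ⟨⟨h0, h1⟩, h2, h3⟩
    refine ⟨?_, ?_, ?_⟩
    · linear_combination h0 + h2
    · linear_combination h0 - h2
    · linear_combination h1 - h3

/-- The symmetry of the coefficient functions that expresses the invariance of the gauge
parameter. -/
def IsSymmetric (ζ : ℂˣ) (f : Fin 3 → Mer) : Prop :=
  f 0 = RatFunc.C (ζ : ℂ) * dil ζ (f 0) ∧ f 1 = -(RatFunc.C (ζ : ℂ) * dil ζ (f 1)) ∧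
    f 2 = -(RatFunc.C (ζ : ℂ) ^ 2 * dil ζ (f 2))

/-- The image of the coefficient functions under the symmetry. -/
noncomputable def symm (ζ : ℂˣ) (f : Fin 3 → Mer) : Fin 3 → Mer :=
  ![RatFunc.C (ζ : ℂ) * dil ζ (f 0), -(RatFunc.C (ζ : ℂ) * dil ζ (f 1)),
    -(RatFunc.C (ζ : ℂ) ^ 2 * dil ζ (f 2))]

theorem isSymmetric_iff {ζ : ℂˣ} {f : Fin 3 → Mer} : IsSymmetric ζ f ↔ symm ζ f = f := by
  rw [funext_iff, Fin.forall_fin_succ, Fin.forall_fin_two, IsSymmetric]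
  simp only [symm]
  exact and_congr eq_comm (and_congr eq_comm eq_comm)

/-- Rotation by ζ exchanges q and q', and the signs on the last two components exchange the two
triangular systems, so the two effects cancel. -/
theorem riccatiSystem_symm {ζ : ℂˣ} {q q' : Mer} (hq : q = RatFunc.C (ζ : ℂ) * dil ζ q')
    (hq' : q' = RatFunc.C (ζ : ℂ) * dil ζ q) {f : Fin 3 → Mer} (h : RiccatiSystem q q' f) :
    RiccatiSystem q q' (symm ζ f) := by
  have hC (i : ℕ) (g : Mer) : ratDeriv (RatFunc.C (ζ : ℂ) ^ i * g) =
      RatFunc.C (ζ : ℂ) ^ i * ratDeriv g := by rw [← map_pow, ratDeriv_C_mul]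
  obtain ⟨h0, h1, h2⟩ := h
  have k0 := congrArg (dil ζ) h0
  have k1 := congrArg (dil ζ) h1
  have k2 := congrArg (dil ζ) h2
  simp only [map_add, map_sub, map_mul, map_pow, map_zero, map_ofNat] at k0 k1 k2
  have e0 : symm ζ f 0 = RatFunc.C (ζ : ℂ) * dil ζ (f 0) := rfl
  have e1 : symm ζ f 1 = -(RatFunc.C (ζ : ℂ) * dil ζ (f 1)) := rfl
  have e2 : symm ζ f 2 = -(RatFunc.C (ζ : ℂ) ^ 2 * dil ζ (f 2)) := rfl
  have s0 : q + q' = RatFunc.C (ζ : ℂ) * (dil ζ q + dil ζ q') := by rw [mul_add, ← hq, ← hq']; ring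
  have s1 : q - q' = -(RatFunc.C (ζ : ℂ) * (dil ζ q - dil ζ q')) := by
    rw [mul_sub, ← hq, ← hq']; ring
  refine ⟨?_, ?_, ?_⟩ <;>
    simp only [s0, s1, e0, e1, e2, map_neg, ratDeriv_C_mul, hC, ratDeriv_dil]
  · linear_combination RatFunc.C (ζ : ℂ) ^ 2 * k0
  · linear_combination -RatFunc.C (ζ : ℂ) ^ 2 * k1
  · linear_combination -RatFunc.C (ζ : ℂ) ^ 3 * k2

end Riccati

/-! ### Local exponents -/

section Exponents

variable {q q' x y A B : Mer}

/-- Solve the first equation as A = x' + x² + qx and expand: the simple poles of x and q produce the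
coefficient ξ² - ξ - ηξ of t⁻². -/
theorem TriangularSystem.leading {ξ η : ℂ} {x₁ q₁ : Mer} (h : ratDeriv x = A - x ^ 2 - q * x)
    (hx : x = RatFunc.C ξ / RatFunc.X + x₁) (hq : q = RatFunc.C (-η) / RatFunc.X + q₁) :
    RatFunc.X ^ 2 * A = RatFunc.C (ξ ^ 2 - ξ - η * ξ) + RatFunc.X * (2 * RatFunc.C ξ * x₁ +
      RatFunc.C ξ * q₁ - RatFunc.C η * x₁ +
      RatFunc.X * (ratDeriv x₁ + x₁ ^ 2 + q₁ * x₁)) := by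
  have hA : A = ratDeriv x + x ^ 2 + q * x := by rw [h]; ring
  have hd : ratDeriv x = -RatFunc.C ξ / RatFunc.X ^ 2 + ratDeriv x₁ := by
    rw [hx, map_add, div_eq_mul_inv, ratDeriv_C_mul, ratDeriv_inv, ratDeriv_X]; ring
  rw [hA, hd, hx, hq]
  simp only [map_sub, map_mul, map_pow, map_neg]
  field_simp [RatFunc.X_ne_zero]
  ring

theorem regularAtZero_leading {ξ η : ℂ} {x₁ q₁ : Mer} (hx₁ : RegularAtZero x₁)
    (hq₁ : RegularAtZero q₁) : RegularAtZero (2 * RatFunc.C ξ * x₁ +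
      RatFunc.C ξ * q₁ - RatFunc.C η * x₁ +
      RatFunc.X * (ratDeriv x₁ + x₁ ^ 2 + q₁ * x₁)) := by
  have h2 : RegularAtZero (2 : Mer) := by
    have := RegularAtZero.C 2
    rwa [map_ofNat] at this
  exact ((((h2.mul (.C _)).mul hx₁).add ((RegularAtZero.C _).mul hq₁)).sub
    ((RegularAtZero.C _).mul hx₁)).add
    (RegularAtZero.X.mul ((hx₁.ratDeriv.add (hx₁.pow 2)).add (hq₁.mul hx₁)))

/-- The second equation reads x = -A'/A - (q + q'), so the order a of A determines the residue 2η -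
a of x. -/
theorem log_exponent {a η : ℂ} {w q₁ q₁' : Mer} (hA : A ≠ 0)
    (h : ratDeriv A = -(x + (q + q')) * A)
    (hA' : ratDeriv A = (RatFunc.C a / RatFunc.X + w) * A)
    (hq : q = RatFunc.C (-η) / RatFunc.X + q₁) (hq' : q' = RatFunc.C (-η) / RatFunc.X + q₁') :
    x = RatFunc.C (2 * η - a) / RatFunc.X + (-w - q₁ - q₁') := by
  rw [h] at hA'
  have := mul_right_cancel₀ hA hA'
  rw [hq, hq'] at this
  simp only [map_sub, map_mul, map_neg, map_ofNat] at this ⊢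
  linear_combination -this

/-- The local exponents of a pair of solutions of the triangular systems. -/
theorem local_exponents {η : ℂ} {a : ℤ} {g h q₁ q₁' : Mer}
    (hx : TriangularSystem q (q + q') x A) (hy : TriangularSystem q' (q + q') y B)
    (hAB : A + B = x * y) (hA : A = RatFunc.X ^ a * g) (hB : B = RatFunc.X ^ a * h)
    (hg : RegularAtZero g) (hg0 : ev g ≠ 0) (hh : RegularAtZero h) (hh0 : ev h ≠ 0)
    (hq : q = RatFunc.C (-η) / RatFunc.X + q₁) (hq' : q' = RatFunc.C (-η) / RatFunc.X + q₁')
    (hq₁ : RegularAtZero q₁) (hq₁' : RegularAtZero q₁') :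
    ∃ x₁ y₁, RegularAtZero x₁ ∧ RegularAtZero y₁ ∧
      ((x = x₁ ∧ y = y₁ ∧ (a : ℂ) = 2 * η ∧ -1 ≤ a) ∨
        (x = RatFunc.C (2 * (η + 1)) / RatFunc.X + x₁ ∧
          y = RatFunc.C (2 * (η + 1)) / RatFunc.X + y₁)) := by
  obtain ⟨w, hw, hwA⟩ := ratDeriv_zpow_mul_eq (n := a) hg hg0
  obtain ⟨v, hv, hvB⟩ := ratDeriv_zpow_mul_eq (n := a) hh hh0
  have hX (g : Mer) (hg : ev g ≠ 0) : RatFunc.X ^ a * g ≠ 0 :=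
    mul_ne_zero (zpow_ne_zero _ RatFunc.X_ne_zero) (ne_zero_of_ev_ne_zero hg)
  rw [← hA] at hwA
  rw [← hB] at hvB
  have ex := log_exponent (hA ▸ hX g hg0) hx.2 hwA hq hq'
  have ey := log_exponent (hB ▸ hX h hh0) (add_comm q q' ▸ hy.2) hvB hq' hq
  set ξ := 2 * η - (a : ℂ) with hξ
  set x₁ := -w - q₁ - q₁'
  set y₁ := -v - q₁' - q₁
  have hx₁ : RegularAtZero x₁ := (hw.neg.sub hq₁).sub hq₁'
  have hy₁ : RegularAtZero y₁ := (hv.neg.sub hq₁').sub hq₁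
  refine ⟨x₁, y₁, hx₁, hy₁, ?_⟩
  have lx := TriangularSystem.leading hx.1 ex hq
  have ly := TriangularSystem.leading hy.1 ey hq'
  have rx := regularAtZero_leading (ξ := ξ) (η := η) hx₁ hq₁
  have ry := regularAtZero_leading (ξ := ξ) (η := η) hy₁ hq₁'
  set X₁ := 2 * RatFunc.C ξ * x₁ + RatFunc.C ξ * q₁ - RatFunc.C η * x₁ +
      RatFunc.X * (ratDeriv x₁ + x₁ ^ 2 + q₁ * x₁)
  set Y₁ := 2 * RatFunc.C ξ * y₁ + RatFunc.C ξ * q₁' - RatFunc.C η * y₁ +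
      RatFunc.X * (ratDeriv y₁ + y₁ ^ 2 + q₁' * y₁)
  -- A and B have the same order, so x and y share the residue ξ. The t⁻² coefficient of A + B = xy
  -- is the indicial equation 2(ξ² - ξ - ηξ) = ξ².
  have key : RatFunc.C (2 * (ξ ^ 2 - ξ - η * ξ) - ξ ^ 2) / RatFunc.X =
      RatFunc.C ξ * x₁ + RatFunc.C ξ * y₁ + RatFunc.X * (x₁ * y₁) - X₁ - Y₁ := by
    have h1 : RatFunc.X ^ 2 * A + RatFunc.X ^ 2 * B = (RatFunc.X * x) * (RatFunc.X * y) := by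
      linear_combination RatFunc.X ^ 2 * hAB
    have h2 : RatFunc.X * x = RatFunc.C ξ + RatFunc.X * x₁ := by
      rw [ex]; field_simp [RatFunc.X_ne_zero]
    have h3 : RatFunc.X * y = RatFunc.C ξ + RatFunc.X * y₁ := by
      rw [ey]; field_simp [RatFunc.X_ne_zero]
    rw [h2, h3, lx, ly] at h1
    rw [div_eq_iff RatFunc.X_ne_zero]
    simp only [map_sub, map_mul, map_pow, map_ofNat] at h1 ⊢
    linear_combination h1
  have := eq_zero_of_C_div_X_eq (((((RegularAtZero.C _).mul hx₁).add
    ((RegularAtZero.C _).mul hy₁)).add (RegularAtZero.X.mul (hx₁.mul hy₁))).sub rx |>.sub ry) key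
  have h0 : ξ * (ξ - 2 * (η + 1)) = 0 := by linear_combination this
  rcases mul_eq_zero.1 h0 with h0 | h0
  · left
    rw [h0, map_zero, zero_div, zero_add] at ex ey
    refine ⟨ex, ey, by linear_combination -h0 + hξ, ?_⟩
    -- For ξ = 0 the t⁻² term of A vanishes, so A has at most a simple pole. This bound on a is what
    -- excludes the case at infinity.
    have h1 : RatFunc.X ^ (a + 1) * g = X₁ := by
      rw [h0] at lx
      simp only [map_sub, map_mul, map_pow, map_zero] at lx
      have h2 : RatFunc.X ^ 2 * A = RatFunc.X * (RatFunc.X ^ (a + 1) * g) := by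
        rw [hA, zpow_add_one₀ RatFunc.X_ne_zero]; ring
      rw [h2] at lx
      apply mul_left_cancel₀ (RatFunc.X_ne_zero (K := ℂ))
      linear_combination lx
    have := nonneg_of_regular_zpow_mul hg0 (h1 ▸ rx)
    omega
  · right
    rw [sub_eq_zero] at h0
    rw [← h0]
    exact ⟨ex, ey⟩

/-- A solution of a linear equation with non-positive exponent that vanishes at the origin is
zero. -/
theorem eq_zero_of_vanishing {n : ℕ} {δ p p₁ g : Mer} (h : ratDeriv δ = p * δ)
    (hp : p = RatFunc.C (-(n : ℂ)) / RatFunc.X + p₁) (hp₁ : RegularAtZero p₁)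
    (hδ : δ = RatFunc.X * g) (hg : RegularAtZero g) : δ = 0 := by
  by_contra h0
  obtain ⟨m, w, hw, hw0, hm⟩ := exists_eq_zpow_mul h0
  obtain ⟨v, hv, hv'⟩ := ratDeriv_zpow_mul_eq (n := m) hw hw0
  rw [← hm, h] at hv'
  have h1 := mul_right_cancel₀ h0 hv'
  have h2 : RatFunc.C (m + n : ℂ) / RatFunc.X = p₁ - v := by
    rw [hp] at h1
    simp only [map_add, map_neg] at h1 ⊢
    linear_combination -h1
  have h3 := eq_zero_of_C_div_X_eq (hp₁.sub hv) h2
  -- The order of a non-zero solution is the residue of p, here -n ≤ 0, whereas vanishing requires a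
  -- positive order.
  have h4 : m + n = 0 := by exact_mod_cast h3
  have h5 : RatFunc.X ^ (m - 1) * w = g := by
    apply mul_left_cancel₀ (RatFunc.X_ne_zero (K := ℂ))
    rw [← hδ, hm, zpow_sub_one₀ RatFunc.X_ne_zero]
    field_simp [RatFunc.X_ne_zero]
  have := nonneg_of_regular_zpow_mul hw0 (h5 ▸ hg)
  omega

/-- The linearisation: the equation for x/A involves no other unknown, and its solution is the
source term of the equation for 1/A. -/
theorem TriangularSystem.linear (h : TriangularSystem q (q + q') x A) (hA : A ≠ 0) :
    ratDeriv (x / A) = 1 + q' * (x / A) ∧ ratDeriv (1 / A) = x / A + (q + q') * (1 / A) := by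
  rw [ratDeriv_div' _ _ hA, ratDeriv_div' _ _ hA, h.1, h.2, ratDeriv_one]
  constructor
  · field_simp; ring
  · field_simp; ring

/-- Uniqueness of the singular solutions. -/
theorem TriangularSystem.unique {n : ℕ} {ξ c : ℂ} {q₁ q₁' x₁ a₁ x' A' x₁' a₁' : Mer}
    (hx : TriangularSystem q (q + q') x A) (hx' : TriangularSystem q (q + q') x' A')
    (hq : q = RatFunc.C (-(n : ℂ)) / RatFunc.X + q₁)
    (hq' : q' = RatFunc.C (-(n : ℂ)) / RatFunc.X + q₁')
    (hq₁ : RegularAtZero q₁) (hq₁' : RegularAtZero q₁') (hc : c ≠ 0)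
    (ex : x = RatFunc.C ξ / RatFunc.X + x₁) (hx₁ : RegularAtZero x₁)
    (eA : RatFunc.X ^ 2 * A = RatFunc.C c + RatFunc.X * a₁) (ha₁ : RegularAtZero a₁)
    (ex' : x' = RatFunc.C ξ / RatFunc.X + x₁') (hx₁' : RegularAtZero x₁')
    (eA' : RatFunc.X ^ 2 * A' = RatFunc.C c + RatFunc.X * a₁') (ha₁' : RegularAtZero a₁') :
    x = x' ∧ A = A' := by
  -- As c ≠ 0, A has a pole of order exactly two while x has at most a simple one, so x/A and 1/A
  -- both vanish at the origin.
  have key {x A x₁ a₁ : Mer} (ex : x = RatFunc.C ξ / RatFunc.X + x₁) (hx₁ : RegularAtZero x₁)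
      (eA : RatFunc.X ^ 2 * A = RatFunc.C c + RatFunc.X * a₁) (ha₁ : RegularAtZero a₁) :
      A ≠ 0 ∧ (∃ g, RegularAtZero g ∧ x / A = RatFunc.X * g) ∧
        ∃ g, RegularAtZero g ∧ 1 / A = RatFunc.X * g := by
    have hu : RegularAtZero (RatFunc.C c + RatFunc.X * a₁) :=
      (RegularAtZero.C _).add (RegularAtZero.X.mul ha₁)
    have hu0 : ev (RatFunc.C c + RatFunc.X * a₁) ≠ 0 := by
      rw [ev_add (RegularAtZero.C _) (RegularAtZero.X.mul ha₁), ev_mul RegularAtZero.X ha₁]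
      simpa using hc
    have hne := ne_zero_of_ev_ne_zero hu0
    have hA : A ≠ 0 := by
      rintro rfl
      rw [mul_zero] at eA
      exact hne eA.symm
    refine ⟨hA, ⟨(RatFunc.C ξ + RatFunc.X * x₁) * (RatFunc.C c + RatFunc.X * a₁)⁻¹, ?_, ?_⟩,
      RatFunc.X * (RatFunc.C c + RatFunc.X * a₁)⁻¹, RegularAtZero.X.mul (hu.inv hu0), ?_⟩
    · exact ((RegularAtZero.C _).add (RegularAtZero.X.mul hx₁)).mul (hu.inv hu0)
    · rw [← eA, ex]; field_simp [RatFunc.X_ne_zero]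
    · rw [← eA]; field_simp [RatFunc.X_ne_zero]
  obtain ⟨hA, ⟨g, hg, eg⟩, k, hk, ek⟩ := key ex hx₁ eA ha₁
  obtain ⟨hA', ⟨g', hg', eg'⟩, k', hk', ek'⟩ := key ex' hx₁' eA' ha₁'
  obtain ⟨l1, l2⟩ := hx.linear hA
  obtain ⟨l1', l2'⟩ := hx'.linear hA'
  have r0 : x / A - x' / A' = 0 :=
    eq_zero_of_vanishing (p := q') (g := g - g') (by rw [map_sub, l1, l1']; ring) hq' hq₁'
      (by rw [eg, eg']; ring) (hg.sub hg')
  have P0 : 1 / A - 1 / A' = 0 :=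
    eq_zero_of_vanishing (n := 2 * n) (p := q + q') (p₁ := q₁ + q₁') (g := k - k')
      (by rw [map_sub, l2, l2']; linear_combination r0)
      (by rw [hq, hq']; push_cast; simp only [map_mul, map_neg, map_ofNat]; ring)
      (hq₁.add hq₁') (by rw [ek, ek']; ring) (hk.sub hk')
  have hAA : A = A' := by simpa using sub_eq_zero.1 P0
  refine ⟨?_, hAA⟩
  rw [← hAA, sub_eq_zero] at r0
  exact (div_left_inj' hA).1 r0

end Exponents

/-! ### The behaviour at infinity -/

section Infinity

/-- The extra terms 2/t and 4/t come from differentiating the factors t⁻² and t⁻⁴. Since 4 = 2 + 2,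
the relation Q = q + q' is preserved. -/
theorem TriangularSystem.inversion {q Q x A : Mer} (h : TriangularSystem q Q x A) :
    TriangularSystem (-inversion q / RatFunc.X ^ 2 + 2 / RatFunc.X)
      (-inversion Q / RatFunc.X ^ 2 + 4 / RatFunc.X)
      (-inversion x / RatFunc.X ^ 2) (inversion A / RatFunc.X ^ 4) := by
  have hX (n : ℕ) : ratDeriv ((RatFunc.X : Mer) ^ n) = (n : Mer) * RatFunc.X ^ ((n : ℤ) - 1) := by
    have := ratDeriv_zpow_X n
    simpa using this
  have hX0 : (RatFunc.X : Mer) ≠ 0 := RatFunc.X_ne_zero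
  have h1 := congrArg CyclotomicMiura.inversion h.1
  have h2 := congrArg CyclotomicMiura.inversion h.2
  simp only [map_add, map_sub, map_mul, map_pow, map_neg] at h1 h2
  have d2 : ratDeriv ((RatFunc.X : Mer) ^ 2) = 2 * RatFunc.X := by rw [hX]; norm_num
  have d4 : ratDeriv ((RatFunc.X : Mer) ^ 4) = 4 * RatFunc.X ^ 3 := by
    rw [hX]; norm_num
  constructor
  · rw [ratDeriv_div' _ _ (pow_ne_zero 2 hX0), d2, map_neg, ratDeriv_inversion, h1]
    field_simp
    ring
  · rw [ratDeriv_div' _ _ (pow_ne_zero 4 hX0), d4, ratDeriv_inversion, h2]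
    field_simp
    ring

/-- The exponent at infinity of a pair of solutions of the triangular systems. -/
theorem exponents_at_infinity {q q' x y A B : Mer} {κ : ℝ} (hκ : 0 ≤ κ) {ζ : ℂˣ} (hA0 : A ≠ 0)
    (hx : TriangularSystem q (q + q') x A) (hy : TriangularSystem q' (q + q') y B)
    (hAB : A + B = x * y) (hBA : B = RatFunc.C (ζ : ℂ) ^ 2 * dil ζ A)
    (hq : VanishesToOrderTwoAtInfty (q + RatFunc.C (κ - 1 : ℂ) / RatFunc.X))
    (hq' : VanishesToOrderTwoAtInfty (q' + RatFunc.C (κ - 1 : ℂ) / RatFunc.X)) :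
    VanishesToOrderTwoAtInfty (x - RatFunc.C (2 * κ : ℂ) / RatFunc.X) ∧
      VanishesToOrderTwoAtInfty (y - RatFunc.C (2 * κ : ℂ) / RatFunc.X) := by
  have hX0 : (RatFunc.X : Mer) ≠ 0 := RatFunc.X_ne_zero
  rw [vanishesToOrderTwoAtInfty_iff] at hq hq' ⊢
  rw [vanishesToOrderTwoAtInfty_iff]
  simp only [map_add, map_sub, map_div₀, inversion_C, inversion_X] at hq hq' ⊢
  -- In the inverted coordinate q has residue (1 - κ - 2)(-1) = κ + 1, so -(κ + 1) plays the role of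
  -- η.
  have hex {q : Mer} (q₁ : Mer)
      (hq : (inversion q + (RatFunc.C (κ : ℂ) - RatFunc.C 1) / RatFunc.X⁻¹) / RatFunc.X ^ 2 = q₁) :
      -inversion q / RatFunc.X ^ 2 + 2 / RatFunc.X =
        RatFunc.C (-(-(κ + 1 : ℂ))) / RatFunc.X + -q₁ := by
    rw [← hq]
    simp only [map_add, map_neg, map_one]
    field_simp
    ring
  have hBi : inversion B = RatFunc.C (ζ : ℂ) ^ 2 * dil ζ⁻¹ (inversion A) := by
    rw [hBA, map_mul, map_pow, inversion_C, inversion_dil]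
  have hAi : inversion A / RatFunc.X ^ 4 ≠ 0 := by
    refine div_ne_zero ?_ (pow_ne_zero 4 hX0)
    intro h
    apply hA0
    rw [← inversion_inversion A, h, map_zero]
  obtain ⟨a, g, hg, hg0, ha⟩ := exists_eq_zpow_mul hAi
  have hζ : RatFunc.C (ζ : ℂ) ≠ 0 := by simp
  -- A rotation preserves the order of a function, so the transforms of A and B have the same order.
  have hb : inversion B / RatFunc.X ^ 4 =
      RatFunc.X ^ a * (RatFunc.C ((ζ : ℂ)⁻¹ ^ (a + 2)) * dil ζ⁻¹ g) := by
    have : inversion A = RatFunc.X ^ 4 * RatFunc.X ^ a * g := by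
      rw [mul_assoc, ← ha]; field_simp
    rw [hBi, this, map_mul, map_mul, map_pow, map_zpow₀, dil_X, mul_zpow, Units.val_inv_eq_inv_val,
      zpow_add₀ (inv_ne_zero ζ.ne_zero), map_mul, map_zpow₀, map_zpow₀, map_inv₀]
    field_simp
  have hev : ev (RatFunc.C ((ζ : ℂ)⁻¹ ^ (a + 2)) * dil ζ⁻¹ g) ≠ 0 := by
    rw [ev_mul (RegularAtZero.C _) (hg.dil _), ev_C, ev_dil hg]
    exact mul_ne_zero (zpow_ne_zero _ (inv_ne_zero ζ.ne_zero)) hg0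
  have e : -inversion (q + q') / RatFunc.X ^ 2 + 4 / RatFunc.X =
      (-inversion q / RatFunc.X ^ 2 + 2 / RatFunc.X) +
        (-inversion q' / RatFunc.X ^ 2 + 2 / RatFunc.X) := by
    rw [map_add]; ring
  have ix := hx.inversion
  have iy := hy.inversion
  rw [e] at ix iy
  have iAB : inversion A / RatFunc.X ^ 4 + inversion B / RatFunc.X ^ 4 =
      (-inversion x / RatFunc.X ^ 2) * (-inversion y / RatFunc.X ^ 2) := by
    have := congrArg inversion hAB
    rw [map_add, map_mul] at this
    rw [← add_div, this]; field_simp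
  obtain ⟨x₁, y₁, hx₁, hy₁, ⟨-, -, h1, h2⟩ | ⟨h1, h2⟩⟩ :=
    local_exponents ix iy iAB ha hb hg hg0 ((RegularAtZero.C _).mul (hg.dil _)) hev
      (hex _ rfl) (hex _ rfl) hq.neg hq'.neg
  · exfalso
    have h3 : (a : ℝ) = 2 * -(κ + 1) := by exact_mod_cast h1
    have h4 : (-1 : ℝ) ≤ a := by exact_mod_cast h2
    linarith
  · have fin {x x₁ : Mer} (h1 : -inversion x / RatFunc.X ^ 2 =
        RatFunc.C (2 * (-(κ + 1 : ℂ) + 1)) / RatFunc.X + x₁) :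
        (inversion x - RatFunc.C (2 * κ : ℂ) / RatFunc.X⁻¹) / RatFunc.X ^ 2 = -x₁ := by
      simp only [map_add, map_neg, map_mul, map_one, map_ofNat] at h1 ⊢
      field_simp at h1 ⊢
      linear_combination -h1
    exact ⟨fin h1 ▸ hx₁.neg, fin h2 ▸ hy₁.neg⟩

end Infinity

/-! ### Symmetric solutions of the Riccati system -/

section SymmetricSolutions

variable {q q' q₁ q₁' : Mer} {ζ : ℂˣ} {f : Fin 3 → Mer} {n : ℕ}

theorem RegularAtZero.half {f : Mer} (hf : RegularAtZero f) : RegularAtZero (f / 2) := by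
  have := (RegularAtZero.C (1 / 2)).mul hf
  rw [map_div₀, map_one, map_ofNat] at this
  rwa [div_eq_mul_one_div, mul_comm]

theorem IsSymmetric.sum (h : IsSymmetric ζ f) :
    f 0 + f 1 = RatFunc.C (ζ : ℂ) * dil ζ (f 0 - f 1) := by
  rw [map_sub, mul_sub]; linear_combination h.1 + h.2.1

theorem IsSymmetric.diff (h : IsSymmetric ζ f) :
    f 0 - f 1 = RatFunc.C (ζ : ℂ) * dil ζ (f 0 + f 1) := by
  rw [map_add, mul_add]; linear_combination h.1 - h.2.1

theorem IsSymmetric.right_eq (h : IsSymmetric ζ f) :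
    -f 2 + (f 0 + f 1) * (f 0 - f 1) / 2 =
      RatFunc.C (ζ : ℂ) ^ 2 * dil ζ (f 2 + (f 0 + f 1) * (f 0 - f 1) / 2) := by
  have h1 : (f 0 + f 1) * (f 0 - f 1) = RatFunc.C (ζ : ℂ) * dil ζ (f 0 - f 1) *
      (RatFunc.C (ζ : ℂ) * dil ζ (f 0 + f 1)) := by rw [← h.sum, ← h.diff]
  rw [map_add, map_div₀, map_mul, map_ofNat]
  linear_combination -h.2.2 + h1 / 2

theorem IsSymmetric.left_eq (h : IsSymmetric ζ f) :
    f 2 + (f 0 + f 1) * (f 0 - f 1) / 2 =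
      RatFunc.C (ζ : ℂ) ^ 2 * dil ζ (-f 2 + (f 0 + f 1) * (f 0 - f 1) / 2) := by
  have h1 : (f 0 + f 1) * (f 0 - f 1) = RatFunc.C (ζ : ℂ) * dil ζ (f 0 - f 1) *
      (RatFunc.C (ζ : ℂ) * dil ζ (f 0 + f 1)) := by rw [← h.sum, ← h.diff]
  rw [map_add, map_neg, map_div₀, map_mul, map_ofNat]
  linear_combination h.2.2 + h1 / 2

/-- If A = 0 then its rotated image B vanishes too, so xy = 0. As x and y are rotated images of each
other, both vanish, and then so does f₃. -/
theorem IsSymmetric.left_ne_zero (h : IsSymmetric ζ f) (hf : f ≠ 0) :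
    f 2 + (f 0 + f 1) * (f 0 - f 1) / 2 ≠ 0 := by
  intro hA
  have hB := h.right_eq
  rw [hA, map_zero, mul_zero] at hB
  have hxy : (f 0 + f 1) * (f 0 - f 1) = 0 := by linear_combination hA + hB
  have h01 : f 0 + f 1 = 0 ∧ f 0 - f 1 = 0 := by
    rcases mul_eq_zero.1 hxy with h0 | h0
    · exact ⟨h0, by rw [h.diff, h0, map_zero, mul_zero]⟩
    · exact ⟨by rw [h.sum, h0, map_zero, mul_zero], h0⟩
  apply hf
  funext i
  have h2 : (2 : Mer) ≠ 0 := two_ne_zero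
  fin_cases i
  · apply mul_left_cancel₀ h2
    simp only [Fin.zero_eta, Pi.zero_apply]
    linear_combination h01.1 + h01.2
  · apply mul_left_cancel₀ h2
    simp only [Fin.mk_one, Pi.zero_apply]
    linear_combination h01.1 - h01.2
  · apply mul_left_cancel₀ h2
    simp only [Fin.reduceFinMk, Pi.zero_apply]
    linear_combination hA - hB

/-- A non-zero symmetric solution is either regular or has the generic pole. -/
theorem symmetric_dichotomy (hs : IsSymmetric ζ f) (hf : f ≠ 0) (hr : RiccatiSystem q q' f)
    (hq : q = RatFunc.C (-(n : ℂ)) / RatFunc.X + q₁)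
    (hq' : q' = RatFunc.C (-(n : ℂ)) / RatFunc.X + q₁')
    (hq₁ : RegularAtZero q₁) (hq₁' : RegularAtZero q₁') :
    ∃ x₁ y₁, RegularAtZero x₁ ∧ RegularAtZero y₁ ∧
      ((f 0 + f 1 = x₁ ∧ f 0 - f 1 = y₁ ∧ (∀ c, RegularAtZero (f c)) ∧
          (ζ : ℂ) ^ (4 * (n + 1)) = 1) ∨
        (f 0 + f 1 = RatFunc.C (2 * (n + 1) : ℂ) / RatFunc.X + x₁ ∧
          f 0 - f 1 = RatFunc.C (2 * (n + 1) : ℂ) / RatFunc.X + y₁ ∧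
          (¬ ∀ c, RegularAtZero (f c)) ∧ HasPolePattern f (2 * (n + 1)) 0 0)) := by
  obtain ⟨hx, hy⟩ := (riccatiSystem_iff q q' f).1 hr
  have hA0 := hs.left_ne_zero hf
  have hBA := hs.right_eq
  have hAB' := hs.left_eq
  have e0 : f 0 = ((f 0 + f 1) + (f 0 - f 1)) / 2 := by ring
  have e1 : f 1 = ((f 0 + f 1) - (f 0 - f 1)) / 2 := by ring
  have e2 : f 2 = ((f 2 + (f 0 + f 1) * (f 0 - f 1) / 2) -
      (-f 2 + (f 0 + f 1) * (f 0 - f 1) / 2)) / 2 := by ring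
  have hAB : (f 2 + (f 0 + f 1) * (f 0 - f 1) / 2) + (-f 2 + (f 0 + f 1) * (f 0 - f 1) / 2) =
      (f 0 + f 1) * (f 0 - f 1) := by ring
  generalize hA : f 2 + (f 0 + f 1) * (f 0 - f 1) / 2 = A at *
  generalize hB : -f 2 + (f 0 + f 1) * (f 0 - f 1) / 2 = B at *
  generalize f 0 + f 1 = x at *
  generalize f 0 - f 1 = y at *
  have hζ : RatFunc.C (ζ : ℂ) ≠ 0 := by simp
  obtain ⟨a, g, hg, hg0, ha⟩ := exists_eq_zpow_mul hA0
  have hd (g : Mer) : RatFunc.C (ζ : ℂ) ^ 2 * dil ζ (RatFunc.X ^ a * g) =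
      RatFunc.X ^ a * (RatFunc.C ((ζ : ℂ) ^ (a + 2)) * dil ζ g) := by
    rw [map_mul, map_zpow₀, dil_X, mul_zpow, zpow_add₀ ζ.ne_zero, map_mul, map_zpow₀]
    simp only [zpow_ofNat, map_pow]
    ring
  have hb : B = RatFunc.X ^ a * (RatFunc.C ((ζ : ℂ) ^ (a + 2)) * dil ζ g) := by rw [hBA, ha, hd]
  have hevb : ev (RatFunc.C ((ζ : ℂ) ^ (a + 2)) * dil ζ g) = (ζ : ℂ) ^ (a + 2) * ev g := by
    rw [ev_mul (RegularAtZero.C _) (hg.dil _), ev_C, ev_dil hg]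
  have hbr : RegularAtZero (RatFunc.C ((ζ : ℂ) ^ (a + 2)) * dil ζ g) :=
    (RegularAtZero.C _).mul (hg.dil _)
  obtain ⟨x₁, y₁, hx₁, hy₁, ⟨ex, ey, h1, -⟩ | ⟨ex, ey⟩⟩ := local_exponents hx hy hAB ha hb hg hg0
    hbr (hevb ▸ mul_ne_zero (zpow_ne_zero _ ζ.ne_zero) hg0) hq hq' hq₁ hq₁'
  · refine ⟨x₁, y₁, hx₁, hy₁, Or.inl ⟨ex, ey, ?_, ?_⟩⟩
    -- The order a = 2n of A and B is non-negative, so f₃ = (A - B)/2 is regular along with x and y.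
    · have han : 0 ≤ a := by
        have : a = 2 * n := by exact_mod_cast h1
        omega
      have hAr : RegularAtZero A := ha ▸ (regularAtZero_zpow han).mul hg
      have hBr : RegularAtZero B := hb ▸ (regularAtZero_zpow han).mul hbr
      rw [ex, ey] at e0 e1
      intro c
      fin_cases c
      · exact e0 ▸ (hx₁.add hy₁).half
      · exact e1 ▸ (hx₁.sub hy₁).half
      · exact e2 ▸ (hAr.sub hBr).half
    -- Rotating twice returns A to itself but multiplies its leading coefficient by ζ^{2(a+2)}, and
    -- a = 2n.
    · have h2 : RatFunc.X ^ a * g = RatFunc.X ^ a * (RatFunc.C ((ζ : ℂ) ^ (a + 2)) *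
          dil ζ (RatFunc.C ((ζ : ℂ) ^ (a + 2)) * dil ζ g)) := by rw [← hd, ← hb, ← hAB', ha]
      have h3 := congrArg ev (mul_left_cancel₀ (zpow_ne_zero a RatFunc.X_ne_zero) h2)
      rw [ev_mul (RegularAtZero.C _) (hbr.dil _), ev_dil hbr, hevb, ev_C] at h3
      have h4 : a = 2 * n := by exact_mod_cast h1
      have h5 : (ζ : ℂ) ^ (a + 2) * (ζ : ℂ) ^ (a + 2) = 1 := by
        apply mul_right_cancel₀ hg0
        rw [one_mul, mul_assoc, ← h3]
      rw [← zpow_add₀ ζ.ne_zero, h4] at h5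
      rw [← h5, ← zpow_natCast]
      congr 1
      push_cast
      ring
  · refine ⟨x₁, y₁, hx₁, hy₁, Or.inr ⟨ex, ey, ?_, ?_⟩⟩
    · intro hreg
      have h1 : RatFunc.C (2 * (n + 1) : ℂ) / RatFunc.X = f 0 - (x₁ + y₁) / 2 := by
        rw [ex, ey] at e0
        rw [e0]; ring
      have := eq_zero_of_C_div_X_eq ((hreg 0).sub (hx₁.add hy₁).half) h1
      have h2 : (2 * (n + 1) : ℕ) = 0 := by exact_mod_cast this
      omega
    -- A and B have the same t⁻² coefficient, so it cancels in f₃ = (A - B)/2. The simple pole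
    -- remains, with arbitrary coefficient d.
    · have lx := TriangularSystem.leading hx.1 ex hq
      have ly := TriangularSystem.leading hy.1 ey hq'
      have rx := regularAtZero_leading (ξ := (2 * (n + 1) : ℂ)) (η := n) hx₁ hq₁
      have ry := regularAtZero_leading (ξ := (2 * (n + 1) : ℂ)) (η := n) hy₁ hq₁'
      generalize (2 * RatFunc.C _ * x₁ + _ - _ + _) = a₁ at lx rx
      generalize (2 * RatFunc.C _ * y₁ + _ - _ + _) = b₁ at ly ry
      obtain ⟨d, k, hk, hk'⟩ : ∃ d k, RegularAtZero k ∧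
          (a₁ - b₁) / 2 = RatFunc.C d + RatFunc.X * k := ⟨_, exists_eq_C_add (rx.sub ry).half⟩
      have h3 : f 2 = (a₁ - b₁) / 2 / RatFunc.X := by
        rw [e2]
        field_simp [RatFunc.X_ne_zero]
        apply mul_left_cancel₀ (RatFunc.X_ne_zero (K := ℂ))
        linear_combination lx - ly
      refine ⟨d, ![(x₁ + y₁) / 2, (x₁ - y₁) / 2, k], ?_, ?_, ?_, ?_⟩
      · intro c
        fin_cases c
        exacts [(hx₁.add hy₁).half, (hx₁.sub hy₁).half, hk]
      · rw [e0, ex, ey]; simp; ring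
      · rw [e1, ex, ey]; simp
      · rw [h3, hk']
        simp only [map_zero, zero_div, zero_add, Matrix.cons_val]
        field_simp [RatFunc.X_ne_zero]

/-- Solutions with the generic pole are symmetric. -/
theorem isSymmetric_of_hasPolePattern (hr : RiccatiSystem q q' f)
    (hp : HasPolePattern f (2 * (n + 1)) 0 0)
    (hqs : q = RatFunc.C (ζ : ℂ) * dil ζ q') (hqs' : q' = RatFunc.C (ζ : ℂ) * dil ζ q)
    (hq : q = RatFunc.C (-(n : ℂ)) / RatFunc.X + q₁)
    (hq' : q' = RatFunc.C (-(n : ℂ)) / RatFunc.X + q₁')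
    (hq₁ : RegularAtZero q₁) (hq₁' : RegularAtZero q₁') : IsSymmetric ζ f := by
  have hX0 : (RatFunc.X : Mer) ≠ 0 := RatFunc.X_ne_zero
  have hζ : RatFunc.C (ζ : ℂ) ≠ 0 := by simp
  -- The pattern fixes the t⁻² coefficient of A and of B as half the product of the residues of x
  -- and y, that is 2(n + 1)².
  have key {f : Fin 3 → Mer} (hp : HasPolePattern f (2 * (n + 1)) 0 0) :
      ∃ x₁ y₁ a₁ b₁, RegularAtZero x₁ ∧ RegularAtZero y₁ ∧ RegularAtZero a₁ ∧ RegularAtZero b₁ ∧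
        f 0 + f 1 = RatFunc.C (2 * (n + 1) : ℂ) / RatFunc.X + x₁ ∧
        f 0 - f 1 = RatFunc.C (2 * (n + 1) : ℂ) / RatFunc.X + y₁ ∧
        RatFunc.X ^ 2 * (f 2 + (f 0 + f 1) * (f 0 - f 1) / 2) =
          RatFunc.C (2 * (n + 1) ^ 2 : ℂ) + RatFunc.X * a₁ ∧
        RatFunc.X ^ 2 * (-f 2 + (f 0 + f 1) * (f 0 - f 1) / 2) =
          RatFunc.C (2 * (n + 1) ^ 2 : ℂ) + RatFunc.X * b₁ := by
    obtain ⟨d, k, hk, e0, e1, e2⟩ := hp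
    have ex : f 0 + f 1 = RatFunc.C (2 * (n + 1) : ℂ) / RatFunc.X + (k 0 + k 1) := by
      rw [e0, e1]; simp; ring
    have ey : f 0 - f 1 = RatFunc.C (2 * (n + 1) : ℂ) / RatFunc.X + (k 0 - k 1) := by
      rw [e0, e1]; simp; ring
    have hx₁ := (hk 0).add (hk 1)
    have hy₁ := (hk 0).sub (hk 1)
    have hm : RegularAtZero ((RatFunc.C (2 * (n + 1) : ℂ) * (k 0 + k 1) +
        RatFunc.C (2 * (n + 1) : ℂ) * (k 0 - k 1) + RatFunc.X * ((k 0 + k 1) * (k 0 - k 1))) / 2) :=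
      ((((RegularAtZero.C _).mul hx₁).add ((RegularAtZero.C _).mul hy₁)).add
        (RegularAtZero.X.mul (hx₁.mul hy₁))).half
    have hd : RegularAtZero (RatFunc.C d + RatFunc.X * k 2) :=
      (RegularAtZero.C _).add (RegularAtZero.X.mul (hk 2))
    refine ⟨_, _, _, _, hx₁, hy₁, hm.add hd, hm.sub hd, ex, ey, ?_, ?_⟩
    · rw [ex, ey, e2]
      simp only [map_add, map_mul, map_pow, map_natCast, map_ofNat, map_one, map_zero]
      field_simp
      ring
    · rw [ex, ey, e2]
      simp only [map_add, map_mul, map_pow, map_natCast, map_ofNat, map_one, map_zero]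
      field_simp
      ring
  -- The rotated solution has the same pattern, with d replaced by -ζd, so uniqueness identifies it
  -- with f.
  have hp' : HasPolePattern (symm ζ f) (2 * (n + 1)) 0 0 := by
    obtain ⟨d, k, hk, e0, e1, e2⟩ := hp
    refine ⟨-(ζ * d), symm ζ k, fun c => ?_, ?_, ?_, ?_⟩
    · fin_cases c
      exacts [(RegularAtZero.C _).mul ((hk 0).dil _), ((RegularAtZero.C _).mul ((hk 1).dil _)).neg,
        (((RegularAtZero.C _).pow 2).mul ((hk 2).dil _)).neg]
    · change RatFunc.C (ζ : ℂ) * dil ζ (f 0) = _ + RatFunc.C (ζ : ℂ) * dil ζ (k 0)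
      rw [e0, map_add, map_div₀, dil_C, dil_X]
      field_simp
    · change -(RatFunc.C (ζ : ℂ) * dil ζ (f 1)) = _ + -(RatFunc.C (ζ : ℂ) * dil ζ (k 1))
      rw [e1]
      simp
    · change -(RatFunc.C (ζ : ℂ) ^ 2 * dil ζ (f 2)) = _ + -(RatFunc.C (ζ : ℂ) ^ 2 * dil ζ (k 2))
      rw [e2]
      simp only [map_zero, zero_div, zero_add, map_add, map_div₀, dil_C, dil_X, map_neg, map_mul]
      field_simp
      ring
  have hr' := riccatiSystem_symm hqs hqs' hr
  obtain ⟨hx, hy⟩ := (riccatiSystem_iff q q' f).1 hr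
  obtain ⟨hx', hy'⟩ := (riccatiSystem_iff q q' _).1 hr'
  obtain ⟨x₁, y₁, a₁, b₁, hx₁, hy₁, ha₁, hb₁, ex, ey, eA, eB⟩ := key hp
  obtain ⟨x₁', y₁', a₁', b₁', hx₁', hy₁', ha₁', hb₁', ex', ey', eA', eB'⟩ := key hp'
  have hc : (2 * (n + 1) ^ 2 : ℂ) ≠ 0 := by
    have : ((2 * (n + 1) ^ 2 : ℕ) : ℂ) ≠ 0 := by
      rw [Nat.cast_ne_zero]; positivity
    exact_mod_cast this
  obtain ⟨ux, uA⟩ := hx.unique hx' hq hq' hq₁ hq₁' hc ex hx₁ eA ha₁ ex' hx₁' eA' ha₁'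
  rw [add_comm q q'] at hy hy'
  obtain ⟨uy, uB⟩ := hy.unique hy' hq' hq hq₁' hq₁ hc ey hy₁ eB hb₁ ey' hy₁' eB' hb₁'
  rw [isSymmetric_iff]
  have h2 : (2 : Mer) ≠ 0 := two_ne_zero
  funext i
  apply mul_left_cancel₀ h2
  fin_cases i
  · simp only [Fin.zero_eta]; linear_combination -ux - uy
  · simp only [Fin.mk_one]; linear_combination -ux + uy
  · simp only [Fin.reduceFinMk]; linear_combination -uA + uB

/-- The existence of regular symmetric solutions, given rational solutions of the linearised
equations. -/
theorem exists_regular_symmetric_solution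
    (hqs : q = RatFunc.C (ζ : ℂ) * dil ζ q') (hqs' : q' = RatFunc.C (ζ : ℂ) * dil ζ q)
    (hq : q = RatFunc.C (-(n : ℂ)) / RatFunc.X + q₁)
    (hq' : q' = RatFunc.C (-(n : ℂ)) / RatFunc.X + q₁')
    (hq₁ : RegularAtZero q₁) (hq₁' : RegularAtZero q₁')
    (hζ : (ζ : ℂ) ^ (4 * (n + 1)) = 1) {φ r p₁ p₃ : Mer}
    (hφ0 : φ ≠ 0) (hφ : ratDeriv φ = q' * φ) (hr : ratDeriv r = 1 + q' * r)
    (hp₁ : ratDeriv p₁ = q * p₁) (hp₃ : ratDeriv p₃ = (q + q') * p₃ + r - p₁) :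
    ∃ f, RiccatiSystem q q' f ∧ f ≠ 0 ∧ (∀ c, RegularAtZero (f c)) ∧ IsSymmetric ζ f := by
  have hX0 : (RatFunc.X : Mer) ≠ 0 := RatFunc.X_ne_zero
  have hz : RatFunc.C (ζ : ℂ) ≠ 0 := by simp
  have hσ (f : Mer) : ratDeriv (dil ζ f) = RatFunc.C (ζ : ℂ) * dil ζ (ratDeriv f) := ratDeriv_dil ζ f
  -- the homogeneous solutions
  obtain ⟨m, g, hg, hg0, hm⟩ := exists_eq_zpow_mul hφ0
  -- The order of φ equals the residue of its logarithmic derivative q'.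
  obtain rfl : m = -n := by
    obtain ⟨v, hv, hv'⟩ := ratDeriv_zpow_mul_eq (n := m) hg hg0
    rw [← hm, hφ] at hv'
    have h1 := mul_right_cancel₀ hφ0 hv'
    have h2 : RatFunc.C (m + n : ℂ) / RatFunc.X = q₁' - v := by
      rw [hq'] at h1
      simp only [map_add, map_neg] at h1 ⊢
      linear_combination -h1
    have h3 := eq_zero_of_C_div_X_eq (hq₁'.sub hv) h2
    have : m + n = 0 := by exact_mod_cast h3
    omega
  rw [zpow_neg, zpow_natCast] at hm
  have hgne := ne_zero_of_ev_ne_zero hg0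
  have hσg : ev (dil ζ g) ≠ 0 := by rwa [ev_dil hg]
  obtain ⟨ψ, hψ_def⟩ : ∃ a, a = dil ζ φ := ⟨_, rfl⟩
  have hψ0 : ψ ≠ 0 := hψ_def ▸ dil_ne_zero ζ hφ0
  have hψ : ratDeriv ψ = q * ψ := by
    rw [hψ_def, hσ, hφ, map_mul, ← mul_assoc, ← hqs]
  have hψm : RatFunc.X ^ n * ψ = RatFunc.C ((ζ : ℂ)⁻¹ ^ n) * dil ζ g := by
    rw [hψ_def, hm, map_mul, map_inv₀, map_pow, dil_X]
    simp only [map_pow, map_inv₀]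
    rw [mul_pow]
    field_simp
    rw [one_div, inv_pow, mul_assoc, mul_comm (RatFunc.C (ζ : ℂ) ^ n), mul_assoc,
      inv_mul_cancel₀ (pow_ne_zero n hz), mul_one]
  have hφm : RatFunc.X ^ n * φ = g := by rw [hm]; field_simp
  -- constants of integration
  have const {a b p : Mer} (ha : ratDeriv a = p * a) (hb : ratDeriv b = p * b) (hb0 : b ≠ 0) :
      ∃ c, a = RatFunc.C c * b := by
    have : ratDeriv (a / b) = 0 := by rw [ratDeriv_div' _ _ hb0, ha, hb]; ring
    obtain ⟨c, hc⟩ := exists_eq_C_of_ratDeriv_eq_zero this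
    exact ⟨c, by rw [← hc]; field_simp⟩
  have hσψ' : ratDeriv (dil ζ ψ) = q' * dil ζ ψ := by
    rw [hσ, hψ, map_mul, ← mul_assoc, ← hqs']
  obtain ⟨c₀, hc₀⟩ := const hσψ' hφ hφ0
  -- The two sides are proportional, and the constant is read off from leading coefficients.
  have hσψ : RatFunc.C (ζ : ℂ) ^ (2 * n) * dil ζ ψ = φ := by
    have h1 := congrArg (dil ζ) hψm
    rw [map_mul, map_mul, map_pow, dil_X, dil_C, hc₀] at h1
    have h2 : RatFunc.C ((ζ : ℂ) ^ n * c₀) * g = RatFunc.C ((ζ : ℂ)⁻¹ ^ n) * dil ζ (dil ζ g) := by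
      rw [← h1]; simp only [map_mul, map_pow]; rw [← hφm]; ring
    have h3 := congrArg ev h2
    rw [ev_mul (RegularAtZero.C _) hg, ev_mul (RegularAtZero.C _) ((hg.dil _).dil _),
      ev_dil (hg.dil _), ev_dil hg, ev_C, ev_C] at h3
    have h4 := mul_right_cancel₀ hg0 h3
    have h5 : (ζ : ℂ) ^ (2 * n) * c₀ = 1 := by
      rw [two_mul, pow_add, mul_assoc, h4, ← mul_pow, mul_inv_cancel₀ ζ.ne_zero, one_pow]
    rw [hc₀, ← mul_assoc, ← map_pow, ← map_mul, h5, map_one, one_mul]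
  -- the solutions of the first inhomogeneous equation
  obtain ⟨c₁, w, hw, hrw⟩ : ∃ (c : ℂ) (w : Mer), RegularAtZero w ∧
      r / φ = RatFunc.C c + RatFunc.X ^ (n + 1) * w := by
    refine exists_eq_of_ratDeriv (hg.inv hg0) ?_
    rw [ratDeriv_div' _ _ hφ0, hr, hφ, hm]
    field_simp
    ring
  obtain ⟨r₀, hr₀_def⟩ : ∃ a, a = r - RatFunc.C c₁ * φ := ⟨_, rfl⟩
  have hr₀ : ratDeriv r₀ = 1 + q' * r₀ := by
    rw [hr₀_def, map_sub, ratDeriv_C_mul, hr, hφ]; ring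
  have hr₀X : r₀ = RatFunc.X * (w * g) := by
    rw [div_eq_iff hφ0] at hrw
    rw [hr₀_def, hrw, ← hφm]; ring
  obtain ⟨s₀, hs₀_def⟩ : ∃ a, a = RatFunc.C (ζ : ℂ)⁻¹ * dil ζ r₀ := ⟨_, rfl⟩
  have hσr₀ : dil ζ r₀ = RatFunc.C (ζ : ℂ) * s₀ := by
    rw [hs₀_def, map_inv₀]; field_simp
  have hs₀ : ratDeriv s₀ = 1 + q * s₀ := by
    rw [hs₀_def, ratDeriv_C_mul, hσ, hr₀, map_add, map_mul, map_one, hqs, map_inv₀]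
    field_simp
  have hs₀X : s₀ = RatFunc.X * dil ζ (w * g) := by
    rw [hs₀_def, hr₀X, map_mul (dil ζ) RatFunc.X, dil_X, map_inv₀]
    field_simp
  -- Vanishing at the origin characterises r₀, so the second rotation brings it back with no extra
  -- constant.
  have hσs₀ : dil ζ s₀ = RatFunc.C (ζ : ℂ) * r₀ := by
    have h1 : RatFunc.C (ζ : ℂ)⁻¹ * dil ζ s₀ - r₀ = 0 := by
      refine eq_zero_of_vanishing (p := q') (g := dil ζ (dil ζ (w * g)) - w * g) ?_ hq' hq₁' ?_ ?_
      · rw [map_sub, ratDeriv_C_mul, hσ, hs₀, hr₀, map_add, map_mul, map_one, hqs', map_inv₀]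
        field_simp
        ring
      · rw [hs₀X, hr₀X, map_mul (dil ζ) RatFunc.X, dil_X, map_inv₀]
        field_simp
      · exact (((hw.mul hg).dil _).dil _).sub (hw.mul hg)
    rw [map_inv₀] at h1
    rw [← sub_eq_zero.1 h1]; field_simp
  -- the solutions of the second inhomogeneous equation
  have hQ : q + q' = RatFunc.C (-((2 * n : ℕ) : ℂ)) / RatFunc.X + (q₁ + q₁') := by
    rw [hq, hq']; push_cast; simp only [map_mul, map_neg, map_ofNat]; ring
  have hQσ : RatFunc.C (ζ : ℂ) * dil ζ (q + q') = q + q' := by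
    rw [map_add, mul_add, ← hqs, ← hqs', add_comm]
  obtain ⟨c₂, hc₂⟩ := const hp₁ hψ hψ0
  -- Since (φs₀)' = (q + q')φs₀ + φ and (ψr₀)' = (q + q')ψr₀ + ψ, these corrections replace the
  -- source r - p₁ by r₀.
  obtain ⟨p, hp_def⟩ : ∃ a, a = p₃ - RatFunc.C c₁ * (φ * s₀) + RatFunc.C c₂ * (ψ * r₀) := ⟨_, rfl⟩
  have hp : ratDeriv p = (q + q') * p + r₀ := by
    rw [hp_def, map_add, map_sub, ratDeriv_C_mul, ratDeriv_C_mul, ratDeriv_mul, ratDeriv_mul, hp₃,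
      hφ, hψ, hs₀, hr₀, hc₂, hr₀_def]
    ring
  have hχ0 : φ * ψ ≠ 0 := mul_ne_zero hφ0 hψ0
  have hχ : ratDeriv (φ * ψ) = (q + q') * (φ * ψ) := by rw [ratDeriv_mul, hφ, hψ]; ring
  have hu : RegularAtZero (g * (RatFunc.C ((ζ : ℂ)⁻¹ ^ n) * dil ζ g)) :=
    hg.mul ((RegularAtZero.C _).mul (hg.dil _))
  have hu0 : ev (g * (RatFunc.C ((ζ : ℂ)⁻¹ ^ n) * dil ζ g)) ≠ 0 := by
    rw [ev_mul hg ((RegularAtZero.C _).mul (hg.dil _)), ev_mul (RegularAtZero.C _) (hg.dil _), ev_C]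
    exact mul_ne_zero hg0 (mul_ne_zero (pow_ne_zero _ (inv_ne_zero ζ.ne_zero)) hσg)
  have hχX : RatFunc.X ^ (2 * n) * (φ * ψ) = g * (RatFunc.C ((ζ : ℂ)⁻¹ ^ n) * dil ζ g) := by
    rw [← hψm, ← hφm]; ring
  obtain ⟨χ, hχ_def⟩ : ∃ a, a = φ * ψ := ⟨_, rfl⟩
  rw [← hχ_def] at hχ0 hχ hχX
  generalize g * (RatFunc.C ((ζ : ℂ)⁻¹ ^ n) * dil ζ g) = γ at hu hu0 hχX
  have hγ0 := ne_zero_of_ev_ne_zero hu0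
  -- The same variation of constants with χ = φψ, now yielding a solution P₀ that vanishes to second
  -- order.
  obtain ⟨c₃, v, hv, hpv⟩ : ∃ (c : ℂ) (w : Mer), RegularAtZero w ∧
      p / χ = RatFunc.C c + RatFunc.X ^ (2 * n + 1 + 1) * w := by
    refine exists_eq_of_ratDeriv ((hw.mul hg).mul (hu.inv hu0)) ?_
    rw [ratDeriv_div' _ _ hχ0, hp, hχ, ← hχX, hr₀X]
    field_simp
    ring
  obtain ⟨P₀, hP₀_def⟩ : ∃ a, a = p - RatFunc.C c₃ * χ := ⟨_, rfl⟩
  have hP₀ : ratDeriv P₀ = (q + q') * P₀ + r₀ := by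
    rw [hP₀_def, map_sub, ratDeriv_C_mul, hp, hχ]; ring
  have hP₀X : P₀ = RatFunc.X * (RatFunc.X * (v * γ)) := by
    rw [div_eq_iff hχ0] at hpv
    rw [hP₀_def, hpv, ← hχX]; ring
  obtain ⟨N₀, hN₀_def⟩ : ∃ a, a = RatFunc.C (ζ : ℂ)⁻¹ ^ 2 * dil ζ P₀ := ⟨_, rfl⟩
  have hσP₀ : dil ζ P₀ = RatFunc.C (ζ : ℂ) ^ 2 * N₀ := by
    rw [hN₀_def, map_inv₀]; field_simp
  have hN₀ : ratDeriv N₀ = (q + q') * N₀ + s₀ := by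
    rw [hN₀_def, ← map_pow, ratDeriv_C_mul, hσ, hP₀, map_add, map_mul, hσr₀, map_pow, map_inv₀]
    field_simp
    linear_combination dil ζ P₀ * hQσ
  -- Both sides satisfy z' = (q + q')z + r₀ + s₀ and vanish at the origin, where the homogeneous
  -- exponent is -2n.
  have hPN₀ : P₀ + N₀ = r₀ * s₀ := by
    have hN₀X : N₀ = RatFunc.X * (RatFunc.X * dil ζ (v * γ)) := by
      rw [hN₀_def, hP₀X, map_mul (dil ζ) RatFunc.X, map_mul (dil ζ) RatFunc.X, dil_X, map_inv₀]
      field_simp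
    rw [← sub_eq_zero]
    refine eq_zero_of_vanishing (n := 2 * n) (p := q + q')
      (g := RatFunc.X * (v * γ) + RatFunc.X * dil ζ (v * γ) - w * g * (RatFunc.X * dil ζ (w * g)))
      ?_ hQ (hq₁.add hq₁') ?_ ?_
    · rw [map_sub, map_add, ratDeriv_mul, hP₀, hN₀, hr₀, hs₀]; ring
    · rw [hP₀X, hN₀X, hr₀X, hs₀X]; ring
    · have h1 := hw.mul hg
      have h2 := hv.mul hu
      exact ((RegularAtZero.X.mul h2).add (RegularAtZero.X.mul (h2.dil _))).sub
        (h1.mul (RegularAtZero.X.mul (h1.dil _)))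
  have hσN₀ : dil ζ N₀ = RatFunc.C (ζ : ℂ) ^ 2 * P₀ := by
    have h1 := congrArg (dil ζ) hPN₀
    rw [map_add, map_mul, hσP₀, hσr₀, hσs₀] at h1
    linear_combination h1 - RatFunc.C (ζ : ℂ) ^ 2 * hPN₀
  -- the symmetric combination
  obtain ⟨c, e, d, k, hd0, hk0, hdk, hc, he, hd', hk'⟩ : ∃ c e d k : ℂ, d ≠ 0 ∧ k ≠ 0 ∧
      d + k = c * e ∧ (ζ : ℂ) ^ (2 * n + 1) * c = e ∧ e * ζ = c ∧
      (ζ : ℂ) ^ (2 * n + 2) * d = k ∧ (ζ : ℂ) ^ (2 * n + 2) * k = d := by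
    -- The congruence splits as ζ^{2n+2} = 1 or -1. The first four equations of the list make P + N
    -- = RS and match R with S and P with N under rotation on one side, the last does so on the
    -- other; d and k are kept non-zero to give P and N the full pole.
    have h1 : ((ζ : ℂ) ^ (2 * n + 2) - 1) * ((ζ : ℂ) ^ (2 * n + 2) + 1) = 0 := by
      rw [← sub_eq_zero] at hζ
      rw [← hζ]; ring
    rcases mul_eq_zero.1 h1 with h1 | h1
    · rw [sub_eq_zero] at h1
      refine ⟨1, (ζ : ℂ)⁻¹, (ζ : ℂ)⁻¹ / 2, (ζ : ℂ)⁻¹ / 2, by simp, by simp, by ring, ?_, by simp,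
        by rw [h1]; ring, by rw [h1]; ring⟩
      rw [mul_one]
      exact eq_inv_of_mul_eq_one_left (by rw [← h1]; ring)
    · have h2 : (ζ : ℂ) ^ (2 * n + 2) = -1 := by linear_combination h1
      exact ⟨0, 0, 1, -1, by simp, by simp, by ring, by simp, by simp, by rw [h2]; ring,
        by rw [h2]; ring⟩
  have kc : RatFunc.C (ζ : ℂ) ^ (2 * n + 1) * RatFunc.C c = RatFunc.C e := by
    rw [← hc, map_mul, map_pow]
  have ke : RatFunc.C e * RatFunc.C (ζ : ℂ) = RatFunc.C c := by rw [← map_mul, he]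
  have kd : RatFunc.C (ζ : ℂ) ^ (2 * n + 2) * RatFunc.C d = RatFunc.C k := by
    rw [← hd', map_mul, map_pow]
  have kk : RatFunc.C (ζ : ℂ) ^ (2 * n + 2) * RatFunc.C k = RatFunc.C d := by
    rw [← map_pow, ← map_mul, hk']
  have kdk : RatFunc.C d + RatFunc.C k = RatFunc.C c * RatFunc.C e := by
    rw [← map_add, hdk, map_mul]
  obtain ⟨R, hR⟩ : ∃ a, a = r₀ + RatFunc.C c * φ := ⟨_, rfl⟩
  obtain ⟨S, hS⟩ : ∃ a, a = s₀ + RatFunc.C e * ψ := ⟨_, rfl⟩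
  obtain ⟨P, hP⟩ : ∃ a, a = P₀ + RatFunc.C c * (φ * s₀) + RatFunc.C d * χ := ⟨_, rfl⟩
  obtain ⟨N, hN⟩ : ∃ a, a = N₀ + RatFunc.C e * (ψ * r₀) + RatFunc.C k * χ := ⟨_, rfl⟩
  have hσR : dil ζ R = RatFunc.C (ζ : ℂ) * S := by
    rw [hR, hS, map_add, map_mul, dil_C, hσr₀, ← hψ_def, ← ke]; ring
  have hσS : dil ζ S = RatFunc.C (ζ : ℂ) * R := by
    rw [hR, hS, map_add, map_mul, dil_C, hσs₀, ← kc, ← hσψ]; ring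
  have hσP : dil ζ P = RatFunc.C (ζ : ℂ) ^ 2 * N := by
    rw [hP, hN, map_add, map_add, map_mul, map_mul, map_mul, dil_C, dil_C, hσP₀, hσs₀, hχ_def,
      map_mul, ← hψ_def, ← kk, ← ke]
    linear_combination RatFunc.C (ζ : ℂ) ^ 2 * RatFunc.C k * ψ * hσψ
  have hσN : dil ζ N = RatFunc.C (ζ : ℂ) ^ 2 * P := by
    rw [hP, hN, map_add, map_add, map_mul, map_mul, map_mul, dil_C, dil_C, hσN₀, hσr₀, hχ_def,
      map_mul, ← hψ_def, ← kd, ← kc]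
    linear_combination (RatFunc.C (ζ : ℂ) ^ 2 * RatFunc.C c * s₀ +
      RatFunc.C (ζ : ℂ) ^ 2 * RatFunc.C d * ψ) * hσψ
  have hRS : P + N = R * S := by
    rw [hP, hN, hR, hS, hχ_def]
    linear_combination hPN₀ + φ * ψ * kdk
  have dR : ratDeriv R = 1 + q' * R := by rw [hR, map_add, ratDeriv_C_mul, hr₀, hφ]; ring
  have dS : ratDeriv S = 1 + q * S := by rw [hS, map_add, ratDeriv_C_mul, hs₀, hψ]; ring
  have dP : ratDeriv P = R + (q + q') * P := by
    rw [hP, hR, map_add, map_add, ratDeriv_C_mul, ratDeriv_C_mul, ratDeriv_mul, hP₀, hφ, hs₀, hχ]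
    ring
  have dN : ratDeriv N = S + (q + q') * N := by
    rw [hN, hS, map_add, map_add, ratDeriv_C_mul, ratDeriv_C_mul, ratDeriv_mul, hN₀, hψ, hr₀, hχ]
    ring
  -- regularity
  have unit {P R a b : Mer} {d : ℂ} (hd0 : d ≠ 0) (ha : RegularAtZero a) (hb : RegularAtZero b)
      (hP : RatFunc.X ^ (2 * n) * P = RatFunc.C d * γ + RatFunc.X * a)
      (hR : RatFunc.X ^ n * R = b) :
      P ≠ 0 ∧ RegularAtZero (1 / P) ∧ RegularAtZero (R / P) := by
    -- As d ≠ 0, P has a pole of order exactly 2n, which dominates the pole of R, of order at most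
    -- n.
    have h1 : RegularAtZero (RatFunc.C d * γ + RatFunc.X * a) :=
      ((RegularAtZero.C _).mul hu).add (RegularAtZero.X.mul ha)
    have h2 : ev (RatFunc.C d * γ + RatFunc.X * a) ≠ 0 := by
      rw [ev_add ((RegularAtZero.C _).mul hu) (RegularAtZero.X.mul ha),
        ev_mul (RegularAtZero.C _) hu, ev_mul RegularAtZero.X ha, ev_C, ev_X, zero_mul, add_zero]
      exact mul_ne_zero hd0 hu0
    have h3 := ne_zero_of_ev_ne_zero h2
    have h4 : P ≠ 0 := by
      rintro rfl
      rw [mul_zero] at hP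
      exact h3 hP.symm
    have h5 := h1.inv h2
    refine ⟨h4, ?_, ?_⟩
    · have : 1 / P = RatFunc.X ^ (2 * n) * (RatFunc.C d * γ + RatFunc.X * a)⁻¹ := by
        rw [← hP]; field_simp
      rw [this]
      exact (RegularAtZero.X.pow _).mul h5
    · have : R / P = RatFunc.X ^ n * b * (RatFunc.C d * γ + RatFunc.X * a)⁻¹ := by
        rw [← hP, ← hR]; field_simp; ring
      rw [this]
      exact ((RegularAtZero.X.pow _).mul hb).mul h5
  have hgζ : RegularAtZero (RatFunc.C ((ζ : ℂ)⁻¹ ^ n) * dil ζ g) :=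
    (RegularAtZero.C _).mul (hg.dil _)
  have hwg := hw.mul hg
  have hvγ := hv.mul hu
  obtain ⟨hP0, hA, hx⟩ := unit (P := P) (R := R) (d := d)
    (a := RatFunc.X ^ (2 * n) * (RatFunc.X * (v * γ)) +
      RatFunc.X ^ n * (RatFunc.C c * (g * dil ζ (w * g))))
    (b := RatFunc.X ^ n * (RatFunc.X * (w * g)) + RatFunc.C c * g) hd0
    (((RegularAtZero.X.pow _).mul (RegularAtZero.X.mul hvγ)).add
      ((RegularAtZero.X.pow _).mul ((RegularAtZero.C _).mul (hg.mul (hwg.dil _)))))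
    (((RegularAtZero.X.pow _).mul (RegularAtZero.X.mul hwg)).add ((RegularAtZero.C _).mul hg))
    (by rw [hP, hP₀X, ← hχX, hs₀X]
        linear_combination RatFunc.X ^ n * RatFunc.C c * RatFunc.X * dil ζ (w * g) * hφm)
    (by rw [hR, hr₀X]
        linear_combination RatFunc.C c * hφm)
  have hN₀X : N₀ = RatFunc.X * (RatFunc.X * dil ζ (v * γ)) := by
    rw [hN₀_def, hP₀X, map_mul (dil ζ) RatFunc.X, map_mul (dil ζ) RatFunc.X, dil_X, map_inv₀]
    field_simp
  obtain ⟨hN0, hB, hy⟩ := unit (P := N) (R := S) (d := k)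
    (a := RatFunc.X ^ (2 * n) * (RatFunc.X * dil ζ (v * γ)) +
      RatFunc.X ^ n * (RatFunc.C e * (RatFunc.C ((ζ : ℂ)⁻¹ ^ n) * dil ζ g * (w * g))))
    (b := RatFunc.X ^ n * (RatFunc.X * dil ζ (w * g)) +
      RatFunc.C e * (RatFunc.C ((ζ : ℂ)⁻¹ ^ n) * dil ζ g)) hk0
    (((RegularAtZero.X.pow _).mul (RegularAtZero.X.mul (hvγ.dil _))).add
      ((RegularAtZero.X.pow _).mul ((RegularAtZero.C _).mul (hgζ.mul hwg))))
    (((RegularAtZero.X.pow _).mul (RegularAtZero.X.mul (hwg.dil _))).add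
      ((RegularAtZero.C _).mul hgζ))
    (by rw [hN, hN₀X, ← hχX, hr₀X]
        linear_combination RatFunc.X ^ n * RatFunc.C e * RatFunc.X * (w * g) * hψm)
    (by rw [hS, hs₀X]
        linear_combination RatFunc.C e * hψm)
  -- the solution
  have t1 : R / P = RatFunc.C (ζ : ℂ) * dil ζ (S / N) := by
    rw [map_div₀, hσS, hσN]; field_simp
  have t2 : S / N = RatFunc.C (ζ : ℂ) * dil ζ (R / P) := by
    rw [map_div₀, hσR, hσP]; field_simp
  have t3 : 1 / P = RatFunc.C (ζ : ℂ) ^ 2 * dil ζ (1 / N) := by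
    rw [map_div₀, hσN, map_one]; field_simp
  have t4 : 1 / N = RatFunc.C (ζ : ℂ) ^ 2 * dil ζ (1 / P) := by
    rw [map_div₀, hσP, map_one]; field_simp
  have t5 : 1 / P + 1 / N = R / P * (S / N) := by
    field_simp
    linear_combination hRS
  have t6 : TriangularSystem q (q + q') (R / P) (1 / P) := by
    constructor
    · rw [ratDeriv_div' _ _ hP0, dR, dP]
      field_simp
      ring
    · rw [ratDeriv_div' _ _ hP0, dP, ratDeriv_one]
      field_simp
      ring
  have t7 : TriangularSystem q' (q + q') (S / N) (1 / N) := by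
    constructor
    · rw [ratDeriv_div' _ _ hN0, dS, dN]
      field_simp
      ring
    · rw [ratDeriv_div' _ _ hN0, dN, ratDeriv_one]
      field_simp
      ring
  have hA0 : 1 / P ≠ 0 := one_div_ne_zero hP0
  generalize R / P = x at *
  generalize S / N = y at *
  generalize 1 / P = A at *
  generalize 1 / N = B at *
  have f01 : ((x + y) / 2 + (x - y) / 2 : Mer) = x := by ring
  have f01' : ((x + y) / 2 - (x - y) / 2 : Mer) = y := by ring
  have f2 : (A - B) / 2 + x * y / 2 = A := by linear_combination t5 / -2
  have f2' : -((A - B) / 2) + x * y / 2 = B := by linear_combination t5 / -2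
  refine ⟨![(x + y) / 2, (x - y) / 2, (A - B) / 2], ?_, ?_, ?_, ?_⟩
  · rw [riccatiSystem_iff]
    simp only [Matrix.cons_val]
    rw [f01, f01', f2, f2']
    exact ⟨t6, t7⟩
  · intro h0
    have h1 := congrFun h0 0
    have h2 := congrFun h0 1
    have h3 := congrFun h0 2
    simp only [Matrix.cons_val, Pi.zero_apply] at h1 h2 h3
    rw [← f2, h3, ← f01, h1, h2] at hA0
    simp at hA0
  · intro c
    fin_cases c
    exacts [(hx.add hy).half, (hx.sub hy).half, (hA.sub hB).half]
  · refine ⟨?_, ?_, ?_⟩ <;> simp only [Matrix.cons_val, map_div₀, map_add, map_sub, map_ofNat]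
    · linear_combination t1 / 2 + t2 / 2
    · linear_combination t1 / 2 - t2 / 2
    · linear_combination t3 / 2 - t4 / 2

end SymmetricSolutions

/-! ### Exponentials of nilpotent inner derivations -/

section Exponential

/-- An element that is an eigenvector of some `ad ρ` with non-zero eigenvalue is ad-nilpotent. -/
theorem isNilpotent_ad_of_lie_eq_smul {K L : Type*} [Field K] [CharZero K] [LieRing L]
    [LieAlgebra K L] [FiniteDimensional K L] {ρ X : L} {c : K} (hc : c ≠ 0) (h : ⁅ρ, X⁆ = c • X) :
    IsNilpotent (LieAlgebra.ad K L X) := by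
  by_contra hn
  let D : Module.End K (Module.End K L) :=
    LinearMap.mulLeft K (LieAlgebra.ad K L ρ) - LinearMap.mulRight K (LieAlgebra.ad K L ρ)
  set a := LieAlgebra.ad K L X
  have h1 : LieAlgebra.ad K L ρ * a = a * LieAlgebra.ad K L ρ + c • a := by
    ext Z
    simp only [a, Module.End.mul_apply, LieAlgebra.ad_apply, LinearMap.add_apply,
      LinearMap.smul_apply]
    rw [leibniz_lie, h, smul_lie, add_comm]
  -- Were all powers of ad X non-zero, the commutator with ad ρ would have the infinitely many
  -- eigenvalues nc on a finite-dimensional space.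
  have hD (n : ℕ) : D (a ^ n) = (n * c) • a ^ n := by
    simp only [D, LinearMap.sub_apply, LinearMap.mulLeft_apply, LinearMap.mulRight_apply]
    induction n with
    | zero => simp
    | succ n ih =>
      have h2 : LieAlgebra.ad K L ρ * a ^ n = a ^ n * LieAlgebra.ad K L ρ + (n * c) • a ^ n := by
        rw [← ih]; abel
      rw [pow_succ, ← mul_assoc, h2, add_mul, mul_assoc, h1, mul_add, mul_assoc, Nat.cast_succ,
        smul_mul_assoc, mul_smul_comm, add_mul, one_mul, add_smul]
      abel
  have hinf : Set.Infinite (Set.range fun n : ℕ => (n : K) * c) :=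
    Set.infinite_range_of_injective fun m n hmn => by simpa [hc] using hmn
  apply hinf
  refine (Module.End.finite_hasEigenvalue D).subset ?_
  rintro _ ⟨n, rfl⟩
  refine Module.End.hasEigenvalue_of_hasEigenvector (x := a ^ n) ⟨?_, fun h => hn ⟨n, h⟩⟩
  exact Module.End.mem_eigenspace_iff.2 (hD n)

theorem exp_ad_lie {K L : Type*} [CommRing K] [LieRing L] [LieAlgebra K L] [Module ℚ L]
    {X : L} (h : IsNilpotent (LieAlgebra.ad K L X)) (Y Z : L) :
    IsNilpotent.exp (LieAlgebra.ad K L X) ⁅Y, Z⁆ =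
      ⁅IsNilpotent.exp (LieAlgebra.ad K L X) Y, IsNilpotent.exp (LieAlgebra.ad K L X) Z⁆ := by
  let _i := LieRing.toNonUnitalNonAssocRing L
  have : SMulCommClass K L L := LieAlgebra.smulCommClass K L
  have : IsScalarTower K L L := LieAlgebra.isScalarTower K L
  refine Module.End.exp_mul_of_derivation K L (LieAlgebra.ad K L X) (fun x y => ?_) h Y Z
  change ⁅X, ⁅x, y⁆⁆ = ⁅x, ⁅X, y⁆⁆ + ⁅⁅X, x⁆, y⁆
  rw [leibniz_lie, add_comm]

theorem exp_apply_eq_sum {K V : Type*} [CommRing K] [AddCommGroup V] [Module K V] [Module ℚ V]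
    {a : Module.End K V} (ha : IsNilpotent a) {k : ℕ} {v : V} (h : (a ^ k) v = 0) :
    IsNilpotent.exp a v = ∑ i ∈ Finset.range k, (i.factorial : ℚ)⁻¹ • (a ^ i) v := by
  have := IsNilpotent.exp_smul_eq_sum (a := a) (m := v) (k := k) h ha
  simpa using this

/-- Conjugation of a derivation-like operator `D` by the exponential of `a`, when the commutator
`b = [D, a]` satisfies `[a, [a, b]] = 0`. -/
theorem exp_apply_of_commutator {R K V : Type*} [CommRing R] [CommRing K] [AddCommGroup V]
    [Module R V] [Module K V] [Module ℚ V] {a b c : Module.End K V} {D : V →ₗ[R] V}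
    (ha : IsNilpotent a) (hb : ∀ v, a (D v) = D (a v) - b v) (hc : ∀ v, a (b v) = b (a v) + c v)
    (hac : ∀ v, a (c v) = c (a v)) (v : V) :
    IsNilpotent.exp a (D v) = D (IsNilpotent.exp a v) - b (IsNilpotent.exp a v) -
      (2 : ℚ)⁻¹ • c (IsNilpotent.exp a v) := by
  have hD (q : ℚ) (v : V) : D (q • v) = q • D v := map_rat_smul D.toAddMonoidHom q v
  have hb' (q : ℚ) (v : V) : b (q • v) = q • b v := map_rat_smul b.toAddMonoidHom q v
  have hc' (q : ℚ) (v : V) : c (q • v) = q • c v := map_rat_smul c.toAddMonoidHom q v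
  -- The Leibniz formula a^N D = D a^N - N b a^{N-1} - C(N,2) c a^{N-2} with N = n + 2. Division by
  -- N! and summation give the exponential identity.
  have key (n : ℕ) : (a ^ (n + 2)) (D v) = D ((a ^ (n + 2)) v) - (n + 2 : ℚ) • b ((a ^ (n + 1)) v) -
      ((n + 2) * (n + 1) / 2 : ℚ) • c ((a ^ n) v) := by
    have haq (q : ℚ) (v : V) : a (q • v) = q • a v := map_rat_smul a.toAddMonoidHom q v
    have hs (n : ℕ) (v : V) : (a ^ (n + 1)) v = a ((a ^ n) v) := by
      rw [pow_succ', Module.End.mul_apply]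
    induction n with
    | zero =>
      simp only [hs, pow_zero, Module.End.one_apply, hb, map_sub, hc]
      norm_num
      module
    | succ n ih =>
      rw [hs, ih, map_sub, map_sub, haq, haq, hb, hc, hac, ← hs, ← hs, ← hs]
      push_cast
      module
  obtain ⟨N, hN⟩ := ha
  have ex (v : V) (k : ℕ) (hk : N ≤ k) : IsNilpotent.exp a v =
      ∑ i ∈ Finset.range k, (i.factorial : ℚ)⁻¹ • (a ^ i) v :=
    exp_apply_eq_sum ⟨N, hN⟩ (by rw [pow_eq_zero_of_le hk hN]; rfl)
  have e1 : D (IsNilpotent.exp a v) = D v + D (a v) +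
      ∑ n ∈ Finset.range N, ((n + 2).factorial : ℚ)⁻¹ • D ((a ^ (n + 2)) v) := by
    rw [ex v (N + 2) (by omega), Finset.sum_range_succ', Finset.sum_range_succ', map_add, map_add,
      map_sum]
    simp [hD]
    abel
  have e2 : b (IsNilpotent.exp a v) = b v +
      ∑ n ∈ Finset.range N, ((n + 1).factorial : ℚ)⁻¹ • b ((a ^ (n + 1)) v) := by
    rw [ex v (N + 1) (by omega), Finset.sum_range_succ', map_add, map_sum]
    simp [hb']
    abel
  have e3 : c (IsNilpotent.exp a v) =
      ∑ n ∈ Finset.range N, (n.factorial : ℚ)⁻¹ • c ((a ^ n) v) := by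
    rw [ex v N le_rfl, map_sum]
    simp [hc']
  have e0 : IsNilpotent.exp a (D v) = D v + a (D v) +
      ∑ n ∈ Finset.range N, ((n + 2).factorial : ℚ)⁻¹ • (a ^ (n + 2)) (D v) := by
    rw [ex (D v) (N + 2) (by omega), Finset.sum_range_succ', Finset.sum_range_succ']
    simp
    abel
  rw [e0, e1, e2, e3, hb, Finset.smul_sum]
  have : ∑ n ∈ Finset.range N, ((n + 2).factorial : ℚ)⁻¹ • (a ^ (n + 2)) (D v) =
      ∑ n ∈ Finset.range N, ((n + 2).factorial : ℚ)⁻¹ • D ((a ^ (n + 2)) v) -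
      ∑ n ∈ Finset.range N, ((n + 1).factorial : ℚ)⁻¹ • b ((a ^ (n + 1)) v) -
      ∑ n ∈ Finset.range N, (2 : ℚ)⁻¹ • (n.factorial : ℚ)⁻¹ • c ((a ^ n) v) := by
    rw [← Finset.sum_sub_distrib, ← Finset.sum_sub_distrib]
    refine Finset.sum_congr rfl fun n _ => ?_
    rw [key, smul_sub, smul_sub]
    simp only [smul_smul]
    have h1 : (n.factorial : ℚ) ≠ 0 := by exact_mod_cast n.factorial_ne_zero
    have h2 : (n + 1 : ℚ) ≠ 0 := by exact_mod_cast n.succ_ne_zero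
    have h3 : (n + 2 : ℚ) ≠ 0 := by exact_mod_cast (n + 1).succ_ne_zero
    have h4 : ((n + 1).factorial : ℚ) = (n + 1) * n.factorial := by
      rw [Nat.factorial_succ]; push_cast; ring
    have h5 : ((n + 2).factorial : ℚ) = (n + 2) * ((n + 1) * n.factorial) := by
      rw [Nat.factorial_succ, Nat.cast_mul, h4]; push_cast; ring
    have h6 : ((n + 2).factorial : ℚ)⁻¹ * (n + 2) = ((n + 1).factorial : ℚ)⁻¹ := by
      rw [h4, h5]; field_simp
    have h7 : ((n + 2).factorial : ℚ)⁻¹ * ((n + 2) * (n + 1) / 2) =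
        2⁻¹ * (n.factorial : ℚ)⁻¹ := by
      rw [h5]; field_simp
    rw [h6, h7]
  rw [this]
  abel

end Exponential

/-! ### Functions with values in a Lie algebra -/

section LieValued

variable {V : Type*} [AddCommGroup V] [Module ℂ V]

@[simp] theorem vecDeriv_tmul (f : Mer) (x : V) :
    vecDeriv V (f ⊗ₜ[ℂ] x) = ratDeriv f ⊗ₜ[ℂ] x := rfl

@[simp] theorem hatAction_tmul (ω : ℂˣ) (σ : V →ₗ[ℂ] V) (f : Mer) (x : V) :
    hatAction ω σ (f ⊗ₜ[ℂ] x) = dil ω⁻¹ f ⊗ₜ[ℂ] σ x := rfl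

@[simp] theorem pair_tmul (φ : Module.Dual ℂ V) (f : Mer) (x : V) :
    pair φ (f ⊗ₜ[ℂ] x) = RatFunc.C (φ x) * f := by
  change TensorProduct.rid ℂ Mer (f ⊗ₜ φ x) = _
  rw [TensorProduct.rid_tmul, RatFunc.smul_eq_C_mul]

theorem pair_smul (φ : Module.Dual ℂ V) (m : Mer) (z : Mer ⊗[ℂ] V) :
    pair φ (m • z) = m * pair φ z := by
  induction z with
  | zero => simp
  | add x y hx hy => rw [smul_add, map_add, map_add, hx, hy, mul_add]
  | tmul f x => rw [TensorProduct.smul_tmul', pair_tmul, pair_tmul, smul_eq_mul]; ring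

theorem pair_vecDeriv (φ : Module.Dual ℂ V) (z : Mer ⊗[ℂ] V) :
    pair φ (vecDeriv V z) = ratDeriv (pair φ z) := by
  induction z with
  | zero => simp
  | add x y hx hy => rw [map_add, map_add, map_add, map_add, hx, hy]
  | tmul f x => rw [vecDeriv_tmul, pair_tmul, pair_tmul, ratDeriv_C_mul]

theorem vecDeriv_smul (m : Mer) (z : Mer ⊗[ℂ] V) :
    vecDeriv V (m • z) = ratDeriv m • z + m • vecDeriv V z := by
  induction z with
  | zero => simp
  | add x y hx hy => rw [smul_add, map_add, map_add, hx, hy, smul_add, smul_add]; abel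
  | tmul f x =>
    rw [TensorProduct.smul_tmul', vecDeriv_tmul, vecDeriv_tmul, TensorProduct.smul_tmul',
      TensorProduct.smul_tmul', smul_eq_mul, smul_eq_mul, smul_eq_mul, ratDeriv_mul,
      TensorProduct.add_tmul, add_comm, mul_comm f]

variable {𝔤 : Type*} [LieRing 𝔤] [LieAlgebra ℂ 𝔤]

theorem lie_tmul_tmul (f g : Mer) (x y : 𝔤) :
    ⁅f ⊗ₜ[ℂ] x, g ⊗ₜ[ℂ] y⁆ = (f * g) ⊗ₜ[ℂ] ⁅x, y⁆ :=
  LieAlgebra.ExtendScalars.bracket_tmul _ _ _ _ _ _ _ _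

theorem vecDeriv_lie (y z : Mer ⊗[ℂ] 𝔤) :
    vecDeriv 𝔤 ⁅y, z⁆ = ⁅vecDeriv 𝔤 y, z⁆ + ⁅y, vecDeriv 𝔤 z⁆ := by
  induction y with
  | zero => simp
  | add x y hx hy => rw [add_lie, map_add, hx, hy, map_add, add_lie, add_lie]; abel
  | tmul f x =>
    induction z with
    | zero => simp
    | add x y hx hy => rw [lie_add, map_add, hx, hy, map_add, lie_add, lie_add]; abel
    | tmul g y =>
      rw [lie_tmul_tmul, vecDeriv_tmul, vecDeriv_tmul, vecDeriv_tmul, lie_tmul_tmul, lie_tmul_tmul,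
        ← TensorProduct.add_tmul, ratDeriv_mul, add_comm, mul_comm g]

theorem hatAction_lie (ω : ℂˣ) (σ : 𝔤 ≃ₗ⁅ℂ⁆ 𝔤) (y z : Mer ⊗[ℂ] 𝔤) :
    hatAction ω (σ : 𝔤 →ₗ[ℂ] 𝔤) ⁅y, z⁆ =
      ⁅hatAction ω (σ : 𝔤 →ₗ[ℂ] 𝔤) y, hatAction ω (σ : 𝔤 →ₗ[ℂ] 𝔤) z⁆ := by
  induction y with
  | zero => simp
  | add x y hx hy => rw [add_lie, map_add, hx, hy, map_add, add_lie]
  | tmul f x =>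
    induction z with
    | zero => simp
    | add x y hx hy => rw [lie_add, map_add, hx, hy, map_add, lie_add]
    | tmul g y =>
      rw [lie_tmul_tmul, hatAction_tmul, hatAction_tmul, hatAction_tmul, lie_tmul_tmul, map_mul]
      congr 1
      exact σ.map_lie x y

/-- The gauge transformation by `exp X` when `X` and its derivative generate an algebra that is
nilpotent of class two. -/
theorem isGaugeTransform_exp {X A B : Mer ⊗[ℂ] 𝔤}
    (hX : IsNilpotent (LieAlgebra.ad Mer (Mer ⊗[ℂ] 𝔤) X))
    (h2 : ⁅X, ⁅X, vecDeriv 𝔤 X⁆⁆ = 0)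
    (hB : IsNilpotent.exp (LieAlgebra.ad Mer (Mer ⊗[ℂ] 𝔤) X) A =
      B + vecDeriv 𝔤 X + (2 : ℚ)⁻¹ • ⁅X, vecDeriv 𝔤 X⁆) :
    IsGaugeTransform (IsNilpotent.exp (LieAlgebra.ad Mer (Mer ⊗[ℂ] 𝔤) X)) A B := by
  intro Z
  have hq (q : ℚ) (y z : Mer ⊗[ℂ] 𝔤) : ⁅q • y, z⁆ = q • ⁅y, z⁆ := by
    rw [← lie_skew, ← lie_skew y]
    exact map_rat_smul (-LieAlgebra.ad Mer (Mer ⊗[ℂ] 𝔤) z).toAddMonoidHom q y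
  -- In class two, dg g⁻¹ for g = exp X is X' + [X, X']/2.
  have h1 := exp_apply_of_commutator (D := vecDeriv 𝔤) (b := LieAlgebra.ad Mer _ (vecDeriv 𝔤 X))
    (c := LieAlgebra.ad Mer _ ⁅X, vecDeriv 𝔤 X⁆) hX
    (fun v => by simp only [LieAlgebra.ad_apply, vecDeriv_lie]; abel)
    (fun v => by simp only [LieAlgebra.ad_apply]; rw [leibniz_lie, add_comm])
    (fun v => by simp only [LieAlgebra.ad_apply]; rw [leibniz_lie, h2, zero_lie, zero_add]) Z
  rw [map_add, h1, exp_ad_lie hX, hB, add_lie, add_lie, hq, LieAlgebra.ad_apply,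
    LieAlgebra.ad_apply]
  abel

theorem IsGaugeTransform.comp {g h : Module.End Mer (Mer ⊗[ℂ] 𝔤)} {A B C : Mer ⊗[ℂ] 𝔤}
    (hg : IsGaugeTransform g B C) (hh : IsGaugeTransform h A B) : IsGaugeTransform (g * h) A C := by
  intro X
  rw [Module.End.mul_apply, hh, hg, Module.End.mul_apply]

end LieValued

/-! ### Serre relations -/

section Serre

variable {ι : Type*} [Fintype ι] [DecidableEq ι] {𝔤 : Type*} [LieRing 𝔤] [LieAlgebra ℂ 𝔤]
  [FiniteDimensional ℂ 𝔤] {H : LieSubalgebra ℂ 𝔤} (b : LieAlgebra.Basis ι H)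

theorem A_diag (i : ι) : b.A i i = 2 := by
  have : IsAddTorsionFree 𝔤 := .of_isTorsionFree ℂ 𝔤
  exact b.A_diag_eq_two i

theorem lie_h_e (i j : ι) : ⁅b.h j, b.e i⁆ = (b.A i j : ℂ) • b.e i := by
  rw [b.lie_h_e, Int.cast_smul_eq_zsmul]

/-- The vector e_i is primitive for the j-th 𝔰𝔩₂-triple with e and f exchanged, since [f_j, e_i] =
0. Finite-dimensional 𝔰𝔩₂-theory then gives both the sign of the Cartan integer and the Serre
relation. -/
theorem exists_ad_pow_e_eq_zero {i j : ι} (hij : i ≠ j) : ∃ n : ℕ, b.A i j = -n ∧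
    (LieModule.toEnd ℂ 𝔤 𝔤 (b.e j) ^ (n + 1)) (b.e i) = 0 := by
  have P : (b.sl2 j).symm.HasPrimitiveVectorWith (b.e i) (-(b.A i j : ℂ)) :=
    { ne_zero := (b.sl2 i).e_ne_zero
      lie_h := by rw [neg_lie, lie_h_e, neg_smul]
      lie_e := by rw [← lie_skew, b.lie_e_f_ne i j hij, neg_zero] }
  obtain ⟨n, hn⟩ := P.exists_nat
  refine ⟨n, ?_, P.pow_toEnd_f_eq_zero_of_eq_nat hn⟩
  have : ((-b.A i j : ℤ) : ℂ) = ((n : ℤ) : ℂ) := by push_cast; exact hn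
  have := Int.cast_injective this
  omega

theorem A_nonpos {i j : ι} (hij : i ≠ j) : b.A i j ≤ 0 := by
  obtain ⟨n, hn, -⟩ := exists_ad_pow_e_eq_zero b hij
  omega

theorem lie_e_e_eq_zero {i j : ι} (h : b.A i j = 0) : ⁅b.e j, b.e i⁆ = 0 := by
  have hij : i ≠ j := by
    rintro rfl
    rw [A_diag] at h
    omega
  obtain ⟨n, hn, hn'⟩ := exists_ad_pow_e_eq_zero b hij
  obtain rfl : n = 0 := by omega
  simpa using hn'

theorem lie_e_lie_e_e_eq_zero {i j : ι} (hij : i ≠ j) (h : b.A i j = -1) :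
    ⁅b.e j, ⁅b.e j, b.e i⁆⁆ = 0 := by
  obtain ⟨n, hn, hn'⟩ := exists_ad_pow_e_eq_zero b hij
  obtain rfl : n = 1 := by omega
  simpa [pow_two] using hn'

/-- Apply ad f_i to [e_j, e_i] = 0: what remains is the opposite Cartan integer times e_j. -/
theorem A_eq_zero_symm {i j : ι} (h : b.A i j = 0) : b.A j i = 0 := by
  have hij : i ≠ j := by
    rintro rfl
    rw [A_diag] at h
    omega
  have h1 : ⁅b.f i, ⁅b.e j, b.e i⁆⁆ = 0 := by rw [lie_e_e_eq_zero b h, lie_zero]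
  have h2 : ⁅b.f i, b.e j⁆ = 0 := by rw [← lie_skew, b.lie_e_f_ne j i hij.symm, neg_zero]
  have h3 : ⁅b.f i, b.e i⁆ = -b.h i := by rw [← lie_skew, (b.sl2 i).lie_e_f]
  rw [leibniz_lie, h2, zero_lie, zero_add, h3, lie_neg, lie_skew, lie_h_e, smul_eq_zero,
    or_iff_left (b.sl2 j).e_ne_zero] at h1
  exact_mod_cast h1

end Serre

/-! ### Orbits of type `A₂` -/

section Orbits

variable {ι : Type*} [Fintype ι] [DecidableEq ι] {𝔤 : Type*} [LieRing 𝔤] [LieAlgebra ℂ 𝔤]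
  [FiniteDimensional ℂ 𝔤] {H : LieSubalgebra ℂ 𝔤} (b : LieAlgebra.Basis ι H)

/-- The combinatorial description of an orbit consisting of `L` commuting copies of `A₂`. -/
structure IsA2Orbit (ν : Equiv.Perm ι) (k : ι) (L : ℕ) : Prop where
  pos : 0 < L
  card : (orbit ν k).card = 2 * L
  period (m : ℕ) : (ν ^ (m + L + L)) k = (ν ^ m) k
  bar (m : ℕ) : bar ν ((ν ^ m) k) = (ν ^ (m + L)) k
  far {m n : ℕ} : ¬ m ≡ n [MOD L] → b.A ((ν ^ m) k) ((ν ^ n) k) = 0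
  near (m : ℕ) : b.A ((ν ^ m) k) ((ν ^ (m + L)) k) = -1

theorem IsA2Orbit.near' {b : LieAlgebra.Basis ι H} {ν : Equiv.Perm ι} {k : ι} {L : ℕ}
    (h : IsA2Orbit b ν k L) (m : ℕ) : b.A ((ν ^ (m + L)) k) ((ν ^ m) k) = -1 := by
  rw [← h.period m]; exact h.near (m + L)

theorem orbit_pow (ν : Equiv.Perm ι) (k : ι) (m : ℕ) : orbit ν ((ν ^ m) k) = orbit ν k := by
  ext i
  simp [orbit, Equiv.Perm.sameCycle_pow_left]

theorem orbit_eq_image (ν : Equiv.Perm ι) (k : ι) :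
    orbit ν k = (Finset.range (Function.minimalPeriod ν k)).image fun m => (ν ^ m) k := by
  ext i
  simp only [orbit, Finset.mem_filter, Finset.mem_univ, true_and, Finset.mem_image,
    Finset.mem_range]
  constructor
  · intro h
    obtain ⟨m, hm⟩ := h.exists_nat_pow_eq
    have hpos : 0 < Function.minimalPeriod ν k :=
      Function.minimalPeriod_pos_of_mem_periodicPts (ν.injective.mem_periodicPts k)
    refine ⟨m % Function.minimalPeriod ν k, Nat.mod_lt _ hpos, ?_⟩
    rw [← hm, ← Equiv.Perm.iterate_eq_pow, ← Equiv.Perm.iterate_eq_pow,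
      Function.iterate_mod_minimalPeriod_eq]
  · rintro ⟨m, -, rfl⟩
    exact ⟨m, by simp⟩

theorem pow_apply_injOn (ν : Equiv.Perm ι) (k : ι) :
    Set.InjOn (fun m => (ν ^ m) k) (Finset.range (Function.minimalPeriod ν k)) := by
  intro m hm n hn h
  simp only [Finset.coe_range, Set.mem_Iio] at hm hn
  simp only [← Equiv.Perm.iterate_eq_pow] at h
  exact Function.iterate_injOn_Iio_minimalPeriod hm hn h

theorem exists_isA2Orbit {ν : Equiv.Perm ι} (hν : ∀ i j, b.A (ν i) (ν j) = b.A i j) {k : ι}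
    (hk : ell b ν k = 2) : ∃ L, IsA2Orbit b ν k L := by
  set c := Function.minimalPeriod ν k with hc
  have hcpos : 0 < c :=
    Function.minimalPeriod_pos_of_mem_periodicPts (ν.injective.mem_periodicPts k)
  have hper : (ν ^ c) k = k := by
    rw [← Equiv.Perm.iterate_eq_pow]; exact Function.iterate_minimalPeriod
  have hνm (m : ℕ) (i j : ι) : b.A ((ν ^ m) i) ((ν ^ m) j) = b.A i j := by
    induction m generalizing i j with
    | zero => simp
    | succ m ih => rw [pow_succ', Equiv.Perm.mul_apply, Equiv.Perm.mul_apply, hν, ih]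
  have hcard : (orbit ν k).card = c := by
    rw [orbit_eq_image, Finset.card_image_of_injOn (pow_apply_injOn ν k), Finset.card_range]
  have hsum : ∑ m ∈ Finset.Ico 1 c, b.A k ((ν ^ m) k) = -1 := by
    have h1 : ∑ m ∈ Finset.range c, b.A k ((ν ^ m) k) = 1 := by
      rw [ell, orbit_eq_image, Finset.sum_image (pow_apply_injOn ν k)] at hk
      linarith
    rw [Finset.range_eq_Ico, Finset.sum_eq_sum_Ico_succ_bot hcpos, pow_zero,
      Equiv.Perm.one_apply, A_diag, zero_add] at h1
    linarith
  have hne {m : ℕ} (hm : m ∈ Finset.Ico 1 c) : k ≠ (ν ^ m) k := by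
    rw [Finset.mem_Ico] at hm
    intro h
    have := pow_apply_injOn ν k (show 0 ∈ _ by simpa using hcpos)
      (show m ∈ _ by simpa using hm.2) (by simpa using h)
    omega
  have hle {m : ℕ} (hm : m ∈ Finset.Ico 1 c) : b.A k ((ν ^ m) k) ≤ 0 := A_nonpos b (hne hm)
  -- Non-positive integers with sum -1: exactly one of them is -1 and all others vanish.
  obtain ⟨L, hL, hL0⟩ : ∃ L ∈ Finset.Ico 1 c, b.A k ((ν ^ L) k) ≠ 0 := by
    by_contra! h
    rw [Finset.sum_eq_zero h] at hsum
    omega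
  have hsplit := Finset.add_sum_erase (Finset.Ico 1 c) (fun m => b.A k ((ν ^ m) k)) hL
  have hrest : ∑ m ∈ (Finset.Ico 1 c).erase L, b.A k ((ν ^ m) k) ≤ 0 :=
    Finset.sum_nonpos fun m hm => hle (Finset.mem_of_mem_erase hm)
  have hLle := hle hL
  have hLneg : b.A k ((ν ^ L) k) = -1 := by omega
  have hzero {m : ℕ} (hm : m ∈ Finset.Ico 1 c) (hmL : m ≠ L) : b.A k ((ν ^ m) k) = 0 := by
    refine (Finset.sum_eq_zero_iff_of_nonpos fun m hm => hle (Finset.mem_of_mem_erase hm)).1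
      (by omega) m (Finset.mem_erase.2 ⟨hmL, hm⟩)
  -- Vanishing of Cartan integers is symmetric, so position c - L is also non-zero. By uniqueness c
  -- - L = L.
  have hcL : c = 2 * L := by
    have h1 : b.A k ((ν ^ (c - L)) k) ≠ 0 := by
      intro h
      apply hL0
      apply A_eq_zero_symm
      rw [Finset.mem_Ico] at hL
      rw [← hνm L, ← Equiv.Perm.mul_apply, ← pow_add, show L + (c - L) = c by omega, hper] at h
      exact h
    by_contra h2
    rw [Finset.mem_Ico] at hL
    exact h1 (hzero (by rw [Finset.mem_Ico]; omega) (by omega))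
  rw [Finset.mem_Ico] at hL
  have hadd (m n : ℕ) : (ν ^ (m + n)) k = (ν ^ m) ((ν ^ n) k) := by
    rw [pow_add, Equiv.Perm.mul_apply]
  have hfar {d : ℕ} (hd : ¬ L ∣ d) : b.A k ((ν ^ d) k) = 0 := by
    have h1 : (ν ^ d) k = (ν ^ (d % c)) k := by
      rw [← Equiv.Perm.iterate_eq_pow, ← Equiv.Perm.iterate_eq_pow, hc,
        Function.iterate_mod_minimalPeriod_eq]
    have h2 : ¬ L ∣ d % c := by
      rwa [Nat.dvd_mod_iff (by rw [hcL]; exact Dvd.intro_left 2 rfl)]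
    rw [h1]
    refine hzero (Finset.mem_Ico.2 ⟨?_, Nat.mod_lt _ hcpos⟩) ?_
    · rw [Nat.one_le_iff_ne_zero]
      intro h
      exact h2 (h ▸ dvd_zero L)
    · intro h
      exact h2 (h ▸ dvd_rfl)
  refine ⟨L, by omega, by omega, fun m => ?_, fun m => ?_, fun {m n} hmn => ?_, fun m => ?_⟩
  · rw [add_assoc, hadd, ← two_mul, ← hcL, hper]
  · rw [CyclotomicMiura.bar, orbit_pow, hcard, hcL, Nat.mul_div_cancel_left _ two_pos, add_comm,
      hadd]
  · rcases le_total m n with h | h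
    · obtain ⟨d, rfl⟩ := Nat.exists_eq_add_of_le h
      rw [hadd, hνm]
      apply hfar
      intro hd
      apply hmn
      exact (Nat.modEq_iff_dvd' h).2 (by simpa using hd)
    · obtain ⟨d, rfl⟩ := Nat.exists_eq_add_of_le h
      apply A_eq_zero_symm
      rw [hadd, hνm]
      apply hfar
      intro hd
      apply hmn
      exact ((Nat.modEq_iff_dvd' h).2 (by simpa using hd)).symm
  · rw [hadd, hνm, hLneg]

end Orbits

/-! ### The coweight `ρ` and Cartan-valued functions -/

section Cartan

variable {ι : Type*} [Fintype ι] [DecidableEq ι] {𝔤 : Type*} [LieRing 𝔤] [LieAlgebra ℂ 𝔤]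
  {H : LieSubalgebra ℂ 𝔤} (b : LieAlgebra.Basis ι H)

theorem baseSupp_rho (i : ι) : b.baseSupp i (rho b) = 1 := by
  have hdet : IsUnit (b.A.map (Int.cast : ℤ → ℂ)).det := by
    have : (b.A.map (Int.cast : ℤ → ℂ)).det = ((b.A.det : ℤ) : ℂ) := by
      exact ((Int.castRingHom ℂ).map_det b.A).symm
    rw [this, isUnit_iff_ne_zero, Int.cast_ne_zero]
    exact b.nondegen.det_ne_zero
  have h1 : (b.A.map (Int.cast : ℤ → ℂ)).mulVec ((b.A.map (Int.cast : ℤ → ℂ))⁻¹.mulVec 1) = 1 := by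
    rw [Matrix.mulVec_mulVec, Matrix.mul_nonsing_inv _ hdet, Matrix.one_mulVec]
  have h2 := congrFun h1 i
  rw [rho, map_sum]
  simp only [map_smul, b.baseSupp_apply_h', smul_eq_mul]
  rw [Pi.one_apply] at h2
  rw [← h2, Matrix.mulVec, dotProduct]
  exact Finset.sum_congr rfl fun j _ => mul_comm _ _

theorem lie_coe_e (h : H) (i : ι) : ⁅(h : 𝔤), b.e i⁆ = b.baseSupp i h • b.e i :=
  (b.baseSupp_apply_smul_e i h).symm

theorem lie_coe_f (h : H) (i : ι) : ⁅(h : 𝔤), b.f i⁆ = -(b.baseSupp i h • b.f i) := by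
  rw [b.baseSupp_apply_smul_f i h, neg_neg]; rfl

theorem lie_coe_coe (b : LieAlgebra.Basis ι H) (h h' : H) : ⁅(h : 𝔤), (h' : 𝔤)⁆ = 0 := by
  have := b.isLieAbelian_cartan
  rw [← LieSubalgebra.coe_bracket, trivial_lie_zero, ZeroMemClass.coe_zero]

@[simp] theorem cartanIncl_tmul (f : Mer) (h : H) :
    cartanIncl H (f ⊗ₜ[ℂ] h) = f ⊗ₜ[ℂ] (h : 𝔤) := rfl

theorem lie_cartanIncl_e (v : Mer ⊗[ℂ] H) (f : Mer) (i : ι) :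
    ⁅cartanIncl H v, f ⊗ₜ[ℂ] b.e i⁆ = (pair (b.baseSupp i) v * f) ⊗ₜ[ℂ] b.e i := by
  induction v with
  | zero => simp
  | add x y hx hy => rw [map_add, add_lie, hx, hy, map_add, add_mul, TensorProduct.add_tmul]
  | tmul g h =>
    rw [cartanIncl_tmul, lie_tmul_tmul, lie_coe_e, pair_tmul, ← TensorProduct.smul_tmul,
      RatFunc.smul_eq_C_mul, mul_assoc]

theorem lie_cartanIncl_lie_e_e (v : Mer ⊗[ℂ] H) (f : Mer) (i j : ι) :
    ⁅cartanIncl H v, f ⊗ₜ[ℂ] ⁅b.e i, b.e j⁆⁆ =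
      ((pair (b.baseSupp i) v + pair (b.baseSupp j) v) * f) ⊗ₜ[ℂ] ⁅b.e i, b.e j⁆ := by
  have h1 : f ⊗ₜ[ℂ] ⁅b.e i, b.e j⁆ = ⁅f ⊗ₜ[ℂ] b.e i, (1 : Mer) ⊗ₜ[ℂ] b.e j⁆ := by
    rw [lie_tmul_tmul, mul_one]
  rw [h1, leibniz_lie, lie_cartanIncl_e, lie_cartanIncl_e, lie_tmul_tmul, lie_tmul_tmul,
    ← TensorProduct.add_tmul]
  congr 1
  ring

theorem lie_e_sum_f (i : ι) : ⁅b.e i, ∑ j, b.f j⁆ = b.h i := by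
  rw [lie_sum, Finset.sum_eq_single i, (b.sl2 i).lie_e_f]
  · intro j _ hj
    exact b.lie_e_f_ne i j hj.symm
  · simp

theorem lie_e_pMinusOne (f : Mer) (i : ι) : ⁅f ⊗ₜ[ℂ] b.e i, pMinusOne b⁆ = f ⊗ₜ[ℂ] b.h i := by
  rw [pMinusOne, lie_tmul_tmul, lie_e_sum_f, mul_one]

end Cartan

/-! ### Gauge transformations attached to a single copy of `A₂` -/

section RankTwo

variable {ι : Type*} [Fintype ι] [DecidableEq ι] {𝔤 : Type*} [LieRing 𝔤] [LieAlgebra ℂ 𝔤]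
  [FiniteDimensional ℂ 𝔤] {H : LieSubalgebra ℂ 𝔤} (b : LieAlgebra.Basis ι H)

/-- The element `x E_i + y E_j + z [E_i, E_j]`. -/
noncomputable def upper (i j : ι) (x y z : Mer) : Mer ⊗[ℂ] 𝔤 :=
  x ⊗ₜ[ℂ] b.e i + y ⊗ₜ[ℂ] b.e j + z ⊗ₜ[ℂ] ⁅b.e i, b.e j⁆

/-- The element `r α̌_i + s α̌_j + x E_i + y E_j + z [E_i, E_j]`. -/
noncomputable def borel (i j : ι) (r s x y z : Mer) : Mer ⊗[ℂ] 𝔤 :=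
  r ⊗ₜ[ℂ] b.h i + s ⊗ₜ[ℂ] b.h j + upper b i j x y z

theorem gaugeExponent_eq (ν : Equiv.Perm ι) (i : ι) (f : Fin 3 → Mer) :
    gaugeExponent b ν i f = upper b i (bar ν i) (f 0 + f 1) (f 0 - f 1) (f 2) := by
  simp only [gaugeExponent, upper, TensorProduct.tmul_add, TensorProduct.tmul_sub,
    TensorProduct.add_tmul, TensorProduct.sub_tmul]
  abel

theorem borel_add (i j : ι) (r s x y z r' s' x' y' z' : Mer) :
    borel b i j r s x y z + borel b i j r' s' x' y' z' =
      borel b i j (r + r') (s + s') (x + x') (y + y') (z + z') := by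
  simp only [borel, upper, TensorProduct.add_tmul]
  abel

theorem smul_borel (i j : ι) (m r s x y z : Mer) :
    m • borel b i j r s x y z = borel b i j (m * r) (m * s) (m * x) (m * y) (m * z) := by
  simp only [borel, upper, smul_add, TensorProduct.smul_tmul', smul_eq_mul]

theorem upper_eq_borel (i j : ι) (x y z : Mer) : upper b i j x y z = borel b i j 0 0 x y z := by
  simp [borel]

theorem vecDeriv_upper (i j : ι) (x y z : Mer) :
    vecDeriv 𝔤 (upper b i j x y z) = upper b i j (ratDeriv x) (ratDeriv y) (ratDeriv z) := by
  simp only [upper, map_add, vecDeriv_tmul]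

theorem lie_cartanIncl_upper (v : Mer ⊗[ℂ] H) (i j : ι) (x y z : Mer) :
    ⁅cartanIncl H v, upper b i j x y z⁆ =
      upper b i j (pair (b.baseSupp i) v * x) (pair (b.baseSupp j) v * y)
        ((pair (b.baseSupp i) v + pair (b.baseSupp j) v) * z) := by
  rw [upper, lie_add, lie_add, lie_cartanIncl_e, lie_cartanIncl_e, lie_cartanIncl_lie_e_e]
  rfl

variable {i j : ι} (hij : b.A i j = -1) (hji : b.A j i = -1)

include hij in
theorem ne_of_A_eq_neg_one : i ≠ j := by
  rintro rfl
  rw [A_diag] at hij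
  omega

include hji in
theorem lie_e_lie_e_e_left : ⁅b.e i, ⁅b.e i, b.e j⁆⁆ = 0 :=
  lie_e_lie_e_e_eq_zero b (ne_of_A_eq_neg_one b hji) hji

include hij in
theorem lie_e_lie_e_e_right : ⁅b.e j, ⁅b.e i, b.e j⁆⁆ = 0 := by
  rw [← lie_skew (b.e i), lie_neg, lie_e_lie_e_e_eq_zero b (ne_of_A_eq_neg_one b hij) hij, neg_zero]

include hij hji in
-- By the Serre relations these brackets close on five coefficients, which turns all later iterated
-- brackets into scalar arithmetic.
theorem lie_upper_borel (x y z r s c d e : Mer) :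
    ⁅upper b i j x y z, borel b i j r s c d e⁆ =
      borel b i j 0 0 (-2 * x * r + x * s) (y * r - 2 * y * s)
        (-z * r - z * s + x * d - y * c) := by
  have h11 : ⁅b.e i, b.h i⁆ = -b.e i - b.e i := by
    rw [← lie_skew, lie_h_e, A_diag]; push_cast; module
  have h12 : ⁅b.e i, b.h j⁆ = b.e i := by
    rw [← lie_skew, lie_h_e, hij]; simp
  have h21 : ⁅b.e j, b.h i⁆ = b.e j := by
    rw [← lie_skew, lie_h_e, hji]; simp
  have h22 : ⁅b.e j, b.h j⁆ = -b.e j - b.e j := by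
    rw [← lie_skew, lie_h_e, A_diag]; push_cast; module
  have h31 : ⁅⁅b.e i, b.e j⁆, b.h i⁆ = -⁅b.e i, b.e j⁆ := by
    rw [lie_lie, h11, h21, lie_sub, lie_neg, ← lie_skew (b.e i) (b.e j)]; abel
  have h32 : ⁅⁅b.e i, b.e j⁆, b.h j⁆ = -⁅b.e i, b.e j⁆ := by
    rw [lie_lie, h12, h22, lie_sub, lie_neg, ← lie_skew (b.e i) (b.e j)]; abel
  have e13 := lie_e_lie_e_e_left b hji
  have e23 := lie_e_lie_e_e_right b hij
  have e31 : ⁅⁅b.e i, b.e j⁆, b.e i⁆ = 0 := by rw [← lie_skew, e13, neg_zero]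
  have e32 : ⁅⁅b.e i, b.e j⁆, b.e j⁆ = 0 := by rw [← lie_skew, e23, neg_zero]
  have e21 : ⁅b.e j, b.e i⁆ = -⁅b.e i, b.e j⁆ := by rw [← lie_skew]
  simp only [borel, upper, add_lie, lie_add, lie_tmul_tmul, h11, h12, h21, h22, h31, h32, e13, e23,
    e31, e32, e21, lie_self, TensorProduct.tmul_zero, TensorProduct.zero_tmul, add_zero, zero_add,
    TensorProduct.add_tmul, TensorProduct.sub_tmul, neg_mul, TensorProduct.neg_tmul,
    TensorProduct.tmul_neg, TensorProduct.tmul_sub, add_mul, two_mul]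
  abel

theorem lie_upper_pMinusOne (x y z : Mer) (hij : b.A i j = -1) (hji : b.A j i = -1) :
    ⁅upper b i j x y z, pMinusOne b⁆ = borel b i j x y z (-z) 0 := by
  have h1 : ⁅⁅b.e i, b.e j⁆, ∑ k, b.f k⁆ = b.e i - b.e j := by
    rw [lie_lie, lie_e_sum_f, lie_e_sum_f, ← lie_skew, ← lie_skew (b.e j), lie_h_e, lie_h_e, hij,
      hji]
    simp [sub_eq_add_neg]
  have h2 : ⁅z ⊗ₜ[ℂ] ⁅b.e i, b.e j⁆, pMinusOne b⁆ = z ⊗ₜ[ℂ] b.e i - z ⊗ₜ[ℂ] b.e j := by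
    rw [pMinusOne, lie_tmul_tmul, h1, mul_one, TensorProduct.tmul_sub]
  rw [upper, add_lie, add_lie, lie_e_pMinusOne, lie_e_pMinusOne, h2]
  simp only [borel, upper, TensorProduct.neg_tmul, TensorProduct.zero_tmul]
  abel

theorem commute_ad_of_lie_eq_zero {K L : Type*} [CommRing K] [LieRing L] [LieAlgebra K L] {X Y : L}
    (h : ⁅X, Y⁆ = 0) : Commute (LieAlgebra.ad K L X) (LieAlgebra.ad K L Y) :=
  LinearMap.ext fun Z => by
    simp only [Module.End.mul_apply, LieAlgebra.ad_apply]
    rw [leibniz_lie, h, zero_lie, zero_add]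

/-- The simple root part and the commutator part have ρ-degrees 1 and 2, so each is ad-nilpotent;
they commute, so their sum is too. -/
theorem isNilpotent_ad_upper (x y z : Mer) (hij : b.A i j = -1) (hji : b.A j i = -1) :
    IsNilpotent (LieAlgebra.ad Mer (Mer ⊗[ℂ] 𝔤) (upper b i j x y z)) := by
  have hr : cartanIncl H ((1 : Mer) ⊗ₜ[ℂ] rho b) = (1 : Mer) ⊗ₜ[ℂ] (rho b : 𝔤) := rfl
  have h1 : IsNilpotent (LieAlgebra.ad Mer (Mer ⊗[ℂ] 𝔤) (upper b i j x y 0)) := by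
    refine isNilpotent_ad_of_lie_eq_smul (ρ := (1 : Mer) ⊗ₜ[ℂ] (rho b : 𝔤)) (one_ne_zero' Mer) ?_
    rw [← hr, lie_cartanIncl_upper]
    simp [baseSupp_rho]
  have h2 : IsNilpotent (LieAlgebra.ad Mer (Mer ⊗[ℂ] 𝔤) (upper b i j 0 0 z)) := by
    refine isNilpotent_ad_of_lie_eq_smul (ρ := (1 : Mer) ⊗ₜ[ℂ] (rho b : 𝔤)) (two_ne_zero' Mer) ?_
    rw [← hr, lie_cartanIncl_upper]
    simp [baseSupp_rho, upper, TensorProduct.smul_tmul', one_add_one_eq_two]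
  have h3 : upper b i j x y z = upper b i j x y 0 + upper b i j 0 0 z := by
    simp [upper]
  rw [h3, map_add]
  refine Commute.isNilpotent_add ?_ h1 h2
  have h4 : ⁅upper b i j x y 0, upper b i j 0 0 z⁆ = 0 := by
    rw [upper_eq_borel b i j 0 0 z, lie_upper_borel b hij hji]
    simp [borel, upper]
  exact commute_ad_of_lie_eq_zero h4

theorem lie_upper_add (x y z : Mer) (hij : b.A i j = -1) (hji : b.A j i = -1) (u : Mer ⊗[ℂ] H) :
    ⁅upper b i j x y z, pMinusOne b + cartanIncl H u⁆ =
      borel b i j x y (z - pair (b.baseSupp i) u * x) (-z - pair (b.baseSupp j) u * y)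
        (-((pair (b.baseSupp i) u + pair (b.baseSupp j) u) * z)) := by
  have : ⁅upper b i j x y z, cartanIncl H u⁆ =
      borel b i j 0 0 (-(pair (b.baseSupp i) u * x)) (-(pair (b.baseSupp j) u * y))
        (-((pair (b.baseSupp i) u + pair (b.baseSupp j) u) * z)) := by
    rw [← lie_skew, lie_cartanIncl_upper, upper_eq_borel, ← neg_one_smul Mer, smul_borel]
    simp
  rw [lie_add, lie_upper_pMinusOne b x y z hij hji, this, borel_add]
  simp only [add_zero, zero_add, sub_eq_add_neg]

/-- The Riccati-type system expresses that `exp X` maps one Miura oper to another one. -/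
theorem isGaugeTransform_upper (hij : b.A i j = -1) (hji : b.A j i = -1) {u : Mer ⊗[ℂ] H}
    {f : Fin 3 → Mer} (hf : RiccatiSystem (pair (b.baseSupp i) u) (pair (b.baseSupp j) u) f) :
    IsGaugeTransform (IsNilpotent.exp (LieAlgebra.ad Mer (Mer ⊗[ℂ] 𝔤)
        (upper b i j (f 0 + f 1) (f 0 - f 1) (f 2))))
      (pMinusOne b + cartanIncl H u)
      (pMinusOne b + cartanIncl H (u + (f 0 + f 1) ⊗ₜ[ℂ] b.h' i + (f 0 - f 1) ⊗ₜ[ℂ] b.h' j)) := by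
  set q := pair (b.baseSupp i) u
  set q' := pair (b.baseSupp j) u
  set x := f 0 + f 1 with hx
  set y := f 0 - f 1 with hy
  set z := f 2 with hz
  set X := upper b i j x y z with hX
  set A := pMinusOne b + cartanIncl H u with hA
  have hnil := isNilpotent_ad_upper b x y z hij hji
  have d1 : ⁅X, A⁆ = borel b i j x y (z - q * x) (-z - q' * y) (-((q + q') * z)) :=
    lie_upper_add b x y z hij hji u
  have d2 : ⁅X, ⁅X, A⁆⁆ = borel b i j 0 0 (-2 * x * x + x * y) (y * x - 2 * y * y)
      (-2 * z * x - 2 * z * y + (q - q') * x * y) := by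
    rw [d1, lie_upper_borel b hij hji]
    congr 1
    ring
  have d3 : ⁅X, ⁅X, ⁅X, A⁆⁆⁆ = borel b i j 0 0 0 0 (3 * x * y * (x - y)) := by
    rw [d2, lie_upper_borel b hij hji]
    congr 1 <;> ring
  -- The exponential series on A stops after the cubic term.
  have d4 : ⁅X, ⁅X, ⁅X, ⁅X, A⁆⁆⁆⁆ = 0 := by
    rw [d3, lie_upper_borel b hij hji]
    simp [borel, upper]
  have d5 : ⁅X, vecDeriv 𝔤 X⁆ = borel b i j 0 0 0 0 (x * ratDeriv y - y * ratDeriv x) := by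
    rw [vecDeriv_upper, upper_eq_borel b i j (ratDeriv x), lie_upper_borel b hij hji]
    congr 1 <;> ring
  apply isGaugeTransform_exp hnil
  · rw [d5, lie_upper_borel b hij hji]
    simp [borel, upper]
  · obtain ⟨r1, r2, r3⟩ := hf
    rw [exp_apply_eq_sum (k := 4) hnil (by
      simp only [pow_succ', pow_zero, mul_one, Module.End.mul_apply, LieAlgebra.ad_apply]
      exact d4)]
    simp only [Finset.sum_range_succ, Finset.sum_range_zero, zero_add, pow_succ', pow_zero,
      mul_one, Module.End.mul_apply, LieAlgebra.ad_apply, Module.End.one_apply]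
    rw [← hX, d3, d2, d1, d5, vecDeriv_upper, upper_eq_borel]
    have hB : pMinusOne b + cartanIncl H (u + x ⊗ₜ[ℂ] b.h' i + y ⊗ₜ[ℂ] b.h' j) =
        A + borel b i j x y 0 0 0 := by
      rw [map_add, map_add, cartanIncl_tmul, cartanIncl_tmul, hA]
      have hh (l : ι) : ((b.h' l : H) : 𝔤) = b.h l := rfl
      simp only [borel, upper, TensorProduct.zero_tmul, add_zero, hh]
      abel
    rw [hB]
    have hq (r : ℚ) (v : Mer ⊗[ℂ] 𝔤) : r • v = (r : Mer) • v :=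
      (Rat.cast_smul_eq_qsmul Mer r v).symm
    simp only [hq, smul_borel]
    simp only [Nat.factorial_zero, Nat.factorial_one, Nat.factorial_two,
      show Nat.factorial 3 = 6 from rfl]
    push_cast
    clear_value A
    simp only [inv_one, one_smul, add_assoc A, borel_add]
    have hdx : ratDeriv x = ratDeriv (f 0) + ratDeriv (f 1) := map_add _ _ _
    have hdy : ratDeriv y = ratDeriv (f 0) - ratDeriv (f 1) := map_sub _ _ _
    rw [hdx, hdy]
    -- The two coroot coefficients agree identically. Those of E_i, E_j and [E_i, E_j] agree by
    -- combinations of the three Riccati equations.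
    congr 2
    · ring
    · ring
    · linear_combination (-1 / 2) * r1 - (1 / 2) * r2
    · linear_combination (-1 / 2) * r1 + (1 / 2) * r2
    · linear_combination (-1 / 2) * r3 - (f 1 / 2) * r1 + (f 0 / 2) * r2

end RankTwo

/-! ### Exponentials of sums of commuting elements -/

theorem exp_sum_of_lie_eq_zero {K L : Type*} [CommRing K] [LieRing L] [LieAlgebra K L]
    [Module ℚ (Module.End K L)] {X : ℕ → L} {N : ℕ}
    (hX : ∀ m, IsNilpotent (LieAlgebra.ad K L (X m)))
    (hc : ∀ m < N, ∀ n < N, ⁅X m, X n⁆ = 0) {n : ℕ} (hn : n ≤ N) :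
    IsNilpotent (LieAlgebra.ad K L (∑ m ∈ Finset.range n, X m)) ∧
      ((List.range n).map fun m => IsNilpotent.exp (LieAlgebra.ad K L (X m))).prod =
        IsNilpotent.exp (LieAlgebra.ad K L (∑ m ∈ Finset.range n, X m)) := by
  induction n with
  | zero => simp [IsNilpotent.exp_zero]
  | succ n ih =>
    obtain ⟨h1, h2⟩ := ih (by omega)
    have hcomm : Commute (LieAlgebra.ad K L (∑ m ∈ Finset.range n, X m))
        (LieAlgebra.ad K L (X n)) := by
      apply commute_ad_of_lie_eq_zero
      rw [sum_lie]
      exact Finset.sum_eq_zero fun m hm => hc m (by rw [Finset.mem_range] at hm; omega) n hn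
    rw [Finset.sum_range_succ, map_add]
    refine ⟨hcomm.isNilpotent_add h1 (hX n), ?_⟩
    rw [List.range_succ, List.map_append, List.prod_append, h2, List.map_singleton,
      List.prod_singleton, IsNilpotent.exp_add_of_commute hcomm h1 (hX n)]

/-! ### Equivariance -/

section Equivariance

variable {ι : Type*} [Fintype ι] [DecidableEq ι] {𝔤 : Type*} [LieRing 𝔤] [LieAlgebra ℂ 𝔤]
  [FiniteDimensional ℂ 𝔤] {H : LieSubalgebra ℂ 𝔤} (b : LieAlgebra.Basis ι H)
  {ν : Equiv.Perm ι} {ω : ℂˣ} {ς : 𝔤 ≃ₗ⁅ℂ⁆ 𝔤}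

theorem tmul_ne_zero {f : Mer} {v : 𝔤} (hf : f ≠ 0) (hv : v ≠ 0) : f ⊗ₜ[ℂ] v ≠ 0 := by
  intro h
  obtain ⟨φ, hφ⟩ : ∃ φ : Module.Dual ℂ 𝔤, φ v ≠ 0 := by
    by_contra! h'
    exact hv ((Module.forall_dual_apply_eq_zero_iff ℂ v).1 h')
  have := congrArg (pair φ) h
  rw [pair_tmul, map_zero] at this
  simp [hf, hφ] at this

theorem hatAction_e (hς : IsTwistedDiagramAut b ν ω ς) (f : Mer) (i : ι) :
    hatAction ω (ς : 𝔤 →ₗ[ℂ] 𝔤) (f ⊗ₜ[ℂ] b.e i) =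
      (RatFunc.C ((ω⁻¹ : ℂˣ) : ℂ) * dil ω⁻¹ f) ⊗ₜ[ℂ] b.e (ν i) := by
  rw [hatAction_tmul]
  change _ ⊗ₜ[ℂ] ς (b.e i) = _
  rw [(hς i).1, ← TensorProduct.smul_tmul, RatFunc.smul_eq_C_mul, Units.val_inv_eq_inv_val]

theorem hatAction_upper (hς : IsTwistedDiagramAut b ν ω ς) (i j : ι) (x y z : Mer) :
    hatAction ω (ς : 𝔤 →ₗ[ℂ] 𝔤) (upper b i j x y z) = upper b (ν i) (ν j)
      (RatFunc.C ((ω⁻¹ : ℂˣ) : ℂ) * dil ω⁻¹ x) (RatFunc.C ((ω⁻¹ : ℂˣ) : ℂ) * dil ω⁻¹ y)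
      (RatFunc.C ((ω⁻¹ : ℂˣ) : ℂ) ^ 2 * dil ω⁻¹ z) := by
  have h (f : Mer) (i j : ι) : f ⊗ₜ[ℂ] ⁅b.e i, b.e j⁆ = ⁅f ⊗ₜ[ℂ] b.e i, (1 : Mer) ⊗ₜ[ℂ] b.e j⁆ := by
    rw [lie_tmul_tmul, mul_one]
  rw [upper, map_add, map_add, h, hatAction_lie, hatAction_e b hς, hatAction_e b hς,
    hatAction_e b hς, hatAction_e b hς, lie_tmul_tmul, map_one, upper]
  congr 2
  ring

/-- Apply the action to [v, 1 ⊗ e_i] and compare coefficients of e_{ν i}. -/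
theorem pair_baseSupp_apply (hς : IsTwistedDiagramAut b ν ω ς) {v w : Mer ⊗[ℂ] H}
    (h : hatAction ω (ς : 𝔤 →ₗ[ℂ] 𝔤) (cartanIncl H v) = cartanIncl H w) (i : ι) :
    pair (b.baseSupp (ν i)) w = dil ω⁻¹ (pair (b.baseSupp i) v) := by
  have h1 := hatAction_lie ω ς (cartanIncl H v) ((1 : Mer) ⊗ₜ[ℂ] b.e i)
  rw [lie_cartanIncl_e, hatAction_e b hς, hatAction_e b hς, h, lie_cartanIncl_e, mul_one, map_one,
    mul_one, ← sub_eq_zero, ← TensorProduct.sub_tmul] at h1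
  by_contra h2
  refine tmul_ne_zero ?_ (b.sl2 (ν i)).e_ne_zero h1
  rw [mul_comm, ← sub_mul, mul_ne_zero_iff, sub_ne_zero]
  exact ⟨fun h => h2 h.symm, by simp⟩

theorem IsCyclotomic.pair_eq (hς : IsTwistedDiagramAut b ν ω ς) {u : Mer ⊗[ℂ] H}
    (hu : IsCyclotomic ω ς u) (i : ι) : pair (b.baseSupp (ν i)) u =
      RatFunc.C ((ω⁻¹ : ℂˣ) : ℂ) * dil ω⁻¹ (pair (b.baseSupp i) u) := by
  have h : hatAction ω (ς : 𝔤 →ₗ[ℂ] 𝔤) (cartanIncl H u) = cartanIncl H ((ω : ℂ) • u) := by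
    rw [map_smul]
    conv_rhs => rw [← hu]
    rw [smul_smul, mul_inv_cancel₀ ω.ne_zero, one_smul]
  rw [← pair_baseSupp_apply b hς h, map_smul, RatFunc.smul_eq_C_mul, ← mul_assoc, ← map_mul,
    Units.inv_mul, map_one, one_mul]

theorem baseSupp_of_map_eq (hς : IsTwistedDiagramAut b ν ω ς) {x : H} (hx : ς (x : 𝔤) = x)
    (i : ι) : b.baseSupp (ν i) x = b.baseSupp i x := by
  have h : hatAction ω (ς : 𝔤 →ₗ[ℂ] 𝔤) (cartanIncl H ((1 : Mer) ⊗ₜ[ℂ] x)) =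
      cartanIncl H ((1 : Mer) ⊗ₜ[ℂ] x) := by
    rw [cartanIncl_tmul, hatAction_tmul, map_one]
    exact congrArg _ hx
  have := pair_baseSupp_apply b hς h i
  rw [pair_tmul, pair_tmul, mul_one, mul_one, dil_C] at this
  exact RatFunc.C_injective this

/-- The image has the same coefficients on permuted coroots, and the Cartan matrix is invariant
under ν. This makes ρ usable as a test vector for invariance. -/
theorem exists_map_rho (hν : ∀ i j, b.A (ν i) (ν j) = b.A i j)
    (hς : IsTwistedDiagramAut b ν ω ς) :
    ∃ x : H, ς (rho b : 𝔤) = x ∧ ∀ i, b.baseSupp i x = 1 := by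
  refine ⟨∑ j, ((b.A.map (Int.cast : ℤ → ℂ))⁻¹.mulVec 1) j • b.h' (ν j), ?_, fun i => ?_⟩
  · rw [rho]
    simp only [AddSubmonoidClass.coe_finsetSum, map_sum, SetLike.val_smul, map_smul]
    exact Finset.sum_congr rfl fun j _ => congrArg _ (hς j).2.1
  · have h := baseSupp_rho b (ν⁻¹ i)
    rw [rho, map_sum] at h
    rw [map_sum, ← h]
    refine Finset.sum_congr rfl fun j _ => ?_
    rw [map_smul, map_smul, b.baseSupp_apply_h', b.baseSupp_apply_h', ← hν (ν⁻¹ i),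
      show ν (ν⁻¹ i) = i from ν.apply_symm_apply i]

/-- The system is equivariant under a rotation of the coordinate. -/
theorem RiccatiSystem.rotate (c : ℂˣ) {q q' : Mer} {f f' : Fin 3 → Mer} (h : RiccatiSystem q q' f)
    (h0 : f' 0 = RatFunc.C (c : ℂ) * dil c (f 0)) (h1 : f' 1 = RatFunc.C (c : ℂ) * dil c (f 1))
    (h2 : f' 2 = RatFunc.C (c : ℂ) ^ 2 * dil c (f 2)) :
    RiccatiSystem (RatFunc.C (c : ℂ) * dil c q) (RatFunc.C (c : ℂ) * dil c q') f' := by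
  have hC (i : ℕ) (g : Mer) : ratDeriv (RatFunc.C (c : ℂ) ^ i * g) =
      RatFunc.C (c : ℂ) ^ i * ratDeriv g := by rw [← map_pow, ratDeriv_C_mul]
  obtain ⟨r0, r1, r2⟩ := h
  have k0 := congrArg (dil c) r0
  have k1 := congrArg (dil c) r1
  have k2 := congrArg (dil c) r2
  simp only [map_add, map_sub, map_mul, map_pow, map_zero, map_ofNat] at k0 k1 k2
  rw [RiccatiSystem, h0, h1, h2]
  simp only [ratDeriv_C_mul, hC, ratDeriv_dil]
  refine ⟨?_, ?_, ?_⟩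
  · linear_combination RatFunc.C (c : ℂ) ^ 2 * k0
  · linear_combination RatFunc.C (c : ℂ) ^ 2 * k1
  · linear_combination RatFunc.C (c : ℂ) ^ 3 * k2

theorem propagate_succ (ω : ℂˣ) (f : Fin 3 → Mer) (m : ℕ) :
    propagate ω f (m + 1) 0 = RatFunc.C ((ω⁻¹ : ℂˣ) : ℂ) * dil ω⁻¹ (propagate ω f m 0) ∧
    propagate ω f (m + 1) 1 = RatFunc.C ((ω⁻¹ : ℂˣ) : ℂ) * dil ω⁻¹ (propagate ω f m 1) ∧
    propagate ω f (m + 1) 2 =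
      RatFunc.C ((ω⁻¹ : ℂˣ) : ℂ) ^ 2 * dil ω⁻¹ (propagate ω f m 2) := by
  rw [Units.val_inv_eq_inv_val, ← map_pow, inv_pow, ← RatFunc.smul_eq_C_mul,
    ← RatFunc.smul_eq_C_mul, ← RatFunc.smul_eq_C_mul]
  exact ⟨rfl, rfl, rfl⟩

theorem C_mul_dil_C_mul_dil (c d : ℂˣ) (f : Mer) :
    RatFunc.C (c : ℂ) * dil c (RatFunc.C (d : ℂ) * dil d f) =
      RatFunc.C ((c * d : ℂˣ) : ℂ) * dil (c * d) f := by
  rw [map_mul, dil_C, dil_dil, Units.val_mul, map_mul, mul_assoc]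

theorem propagate_eq (ω : ℂˣ) (f : Fin 3 → Mer) (m : ℕ) :
    propagate ω f m 0 = RatFunc.C ((ω⁻¹ ^ m : ℂˣ) : ℂ) * dil (ω⁻¹ ^ m) (f 0) ∧
    propagate ω f m 1 = RatFunc.C ((ω⁻¹ ^ m : ℂˣ) : ℂ) * dil (ω⁻¹ ^ m) (f 1) ∧
    propagate ω f m 2 = RatFunc.C ((ω⁻¹ ^ m : ℂˣ) : ℂ) ^ 2 * dil (ω⁻¹ ^ m) (f 2) := by
  induction m with
  | zero => simp [dil_one, propagate]
  | succ m ih =>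
    obtain ⟨h0, h1, h2⟩ := propagate_succ ω f m
    rw [h0, h1, h2, ih.1, ih.2.1, ih.2.2, C_mul_dil_C_mul_dil, C_mul_dil_C_mul_dil, ← pow_succ']
    refine ⟨rfl, rfl, ?_⟩
    rw [map_mul, map_pow, dil_C, dil_dil, ← mul_assoc, ← mul_pow, ← map_mul, ← Units.val_mul,
      ← pow_succ']

end Equivariance

/-! ### Gauge transformations attached to an orbit of copies of `A₂` -/

section Copies

variable {ι : Type*} [Fintype ι] [DecidableEq ι] {𝔤 : Type*} [LieRing 𝔤] [LieAlgebra ℂ 𝔤]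
  [FiniteDimensional ℂ 𝔤] {H : LieSubalgebra ℂ 𝔤} {b : LieAlgebra.Basis ι H}
  {ν : Equiv.Perm ι} {ω : ℂˣ} {ς : 𝔤 ≃ₗ⁅ℂ⁆ 𝔤} {k : ι} {L : ℕ}

theorem lie_upper_upper_eq_zero {i j i' j' : ι} (h1 : b.A i i' = 0) (h2 : b.A i j' = 0)
    (h3 : b.A j i' = 0) (h4 : b.A j j' = 0) (x y z x' y' z' : Mer) :
    ⁅upper b i j x y z, upper b i' j' x' y' z'⁆ = 0 := by
  have e1 := lie_e_e_eq_zero b (A_eq_zero_symm b h1)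
  have e2 := lie_e_e_eq_zero b (A_eq_zero_symm b h2)
  have e3 := lie_e_e_eq_zero b (A_eq_zero_symm b h3)
  have e4 := lie_e_e_eq_zero b (A_eq_zero_symm b h4)
  have e5 : ⁅b.e i, ⁅b.e i', b.e j'⁆⁆ = 0 := by
    rw [leibniz_lie, e1, e2, zero_lie, lie_zero, add_zero]
  have e6 : ⁅b.e j, ⁅b.e i', b.e j'⁆⁆ = 0 := by
    rw [leibniz_lie, e3, e4, zero_lie, lie_zero, add_zero]
  have e7 : ⁅⁅b.e i, b.e j⁆, b.e i'⁆ = 0 := by rw [lie_lie, e1, e3, lie_zero, lie_zero, sub_zero]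
  have e8 : ⁅⁅b.e i, b.e j⁆, b.e j'⁆ = 0 := by rw [lie_lie, e2, e4, lie_zero, lie_zero, sub_zero]
  have e9 : ⁅⁅b.e i, b.e j⁆, ⁅b.e i', b.e j'⁆⁆ = 0 := by
    rw [lie_lie, e5, e6, lie_zero, lie_zero, sub_zero]
  simp only [upper, add_lie, lie_add, lie_tmul_tmul, e1, e2, e3, e4, e5, e6, e7, e8, e9,
    TensorProduct.tmul_zero, add_zero]

/-- The exponent attached to the `m`-th copy of `A₂`, with its last coefficient scaled by `s`. -/
noncomputable def copy (b : LieAlgebra.Basis ι H) (ν : Equiv.Perm ι) (k : ι) (L : ℕ) (s : Mer)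
    (F : ℕ → Fin 3 → Mer) (m : ℕ) : Mer ⊗[ℂ] 𝔤 :=
  upper b ((ν ^ m) k) ((ν ^ (m + L)) k) (F m 0 + F m 1) (F m 0 - F m 1) (s * F m 2)

/-- The correction to the Cartan part of the connection contributed by the `m`-th copy of `A₂`. -/
noncomputable def shift (b : LieAlgebra.Basis ι H) (ν : Equiv.Perm ι) (k : ι) (L : ℕ)
    (F : ℕ → Fin 3 → Mer) (m : ℕ) : Mer ⊗[ℂ] H :=
  (F m 0 + F m 1) ⊗ₜ[ℂ] b.h' ((ν ^ m) k) + (F m 0 - F m 1) ⊗ₜ[ℂ] b.h' ((ν ^ (m + L)) k)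

theorem not_modEq_of_lt {m n : ℕ} (hm : m < L) (hn : n < L) (hmn : m ≠ n) : ¬ m ≡ n [MOD L] := by
  intro h
  rw [Nat.ModEq, Nat.mod_eq_of_lt hm, Nat.mod_eq_of_lt hn] at h
  exact hmn h

theorem IsA2Orbit.far_all (hO : IsA2Orbit b ν k L) {m n : ℕ} (hm : m < L) (hn : n < L)
    (hmn : m ≠ n) : b.A ((ν ^ m) k) ((ν ^ n) k) = 0 ∧ b.A ((ν ^ m) k) ((ν ^ (n + L)) k) = 0 ∧
      b.A ((ν ^ (m + L)) k) ((ν ^ n) k) = 0 ∧ b.A ((ν ^ (m + L)) k) ((ν ^ (n + L)) k) = 0 := by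
  have h := not_modEq_of_lt hm hn hmn
  refine ⟨hO.far h, hO.far ?_, hO.far ?_, hO.far ?_⟩ <;> simpa [Nat.ModEq] using h

/-- Distinct copies commute by orthogonality. Within one copy the two elements differ only in the
component along [E_i, E_j], which commutes with E_i and E_j. -/
theorem IsA2Orbit.lie_copy_copy (hO : IsA2Orbit b ν k L) (s s' : Mer) (F : ℕ → Fin 3 → Mer)
    {m n : ℕ} (hm : m < L) (hn : n < L) : ⁅copy b ν k L s F m, copy b ν k L s' F n⁆ = 0 := by
  rcases eq_or_ne m n with rfl | hmn
  · rw [copy, copy, upper_eq_borel _ _ _ _ _ (s' * _), lie_upper_borel b (hO.near m) (hO.near' m)]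
    simp [borel, upper, mul_comm (F m 0 - F m 1)]
  · obtain ⟨h1, h2, h3, h4⟩ := hO.far_all hm hn hmn
    exact lie_upper_upper_eq_zero h1 h2 h3 h4 _ _ _ _ _ _

theorem IsA2Orbit.card_half (hO : IsA2Orbit b ν k L) : (orbit ν k).card / 2 = L := by
  rw [hO.card, Nat.mul_div_cancel_left _ two_pos]

theorem IsA2Orbit.gaugeParam_eq_prod (hO : IsA2Orbit b ν k L) (f : Fin 3 → Mer) :
    gaugeParam b ν ω k f = ((List.range L).map fun m => IsNilpotent.exp
      (LieAlgebra.ad Mer (Mer ⊗[ℂ] 𝔤) (copy b ν k L 1 (propagate ω f) m))).prod := by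
  rw [gaugeParam, hO.card_half]
  congr 2
  funext m
  rw [gaugeExponent_eq, hO.bar, copy, one_mul]

theorem IsA2Orbit.isNilpotent_copy (hO : IsA2Orbit b ν k L) (s : Mer) (F : ℕ → Fin 3 → Mer)
    (m : ℕ) : IsNilpotent (LieAlgebra.ad Mer (Mer ⊗[ℂ] 𝔤) (copy b ν k L s F m)) :=
  isNilpotent_ad_upper b _ _ _ (hO.near m) (hO.near' m)

theorem IsA2Orbit.gaugeParam_eq_exp (hO : IsA2Orbit b ν k L) (f : Fin 3 → Mer) :
    IsNilpotent (LieAlgebra.ad Mer (Mer ⊗[ℂ] 𝔤)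
      (∑ m ∈ Finset.range L, copy b ν k L 1 (propagate ω f) m)) ∧
    gaugeParam b ν ω k f = IsNilpotent.exp (LieAlgebra.ad Mer (Mer ⊗[ℂ] 𝔤)
      (∑ m ∈ Finset.range L, copy b ν k L 1 (propagate ω f) m)) := by
  rw [hO.gaugeParam_eq_prod]
  exact exp_sum_of_lie_eq_zero (hO.isNilpotent_copy 1 _)
    (fun m hm n hn => hO.lie_copy_copy 1 1 _ hm hn) le_rfl

/-! #### The transformed connection -/

theorem pair_shift (i : ι) (F : ℕ → Fin 3 → Mer) (m : ℕ) :
    pair (b.baseSupp i) (shift b ν k L F m) =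
      (b.A i ((ν ^ m) k) : Mer) * (F m 0 + F m 1) +
        (b.A i ((ν ^ (m + L)) k) : Mer) * (F m 0 - F m 1) := by
  rw [shift, map_add, pair_tmul, pair_tmul, b.baseSupp_apply_h', b.baseSupp_apply_h', map_intCast,
    map_intCast]

theorem IsA2Orbit.isGaugeTransform_prod (hO : IsA2Orbit b ν k L) (F : ℕ → Fin 3 → Mer) {n : ℕ}
    (hn : n ≤ L) (u : Mer ⊗[ℂ] H)
    (hF : ∀ m < n, RiccatiSystem (pair (b.baseSupp ((ν ^ m) k)) u)
      (pair (b.baseSupp ((ν ^ (m + L)) k)) u) (F m)) :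
    IsGaugeTransform ((List.range n).map fun m => IsNilpotent.exp
        (LieAlgebra.ad Mer (Mer ⊗[ℂ] 𝔤) (copy b ν k L 1 F m))).prod
      (pMinusOne b + cartanIncl H u)
      (pMinusOne b + cartanIncl H (u + ∑ m ∈ Finset.range n, shift b ν k L F m)) := by
  induction n generalizing u with
  | zero => intro X; simp
  | succ n ih =>
    have h1 : IsGaugeTransform (IsNilpotent.exp
        (LieAlgebra.ad Mer (Mer ⊗[ℂ] 𝔤) (copy b ν k L 1 F n)))
        (pMinusOne b + cartanIncl H u) (pMinusOne b + cartanIncl H (u + shift b ν k L F n)) := by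
      have := isGaugeTransform_upper b (hO.near n) (hO.near' n) (hF n (Nat.lt_succ_self n))
      rw [copy, one_mul, shift, ← add_assoc]
      exact this
    -- By orthogonality the shift from one copy leaves q and q̄ of the others unchanged, so their
    -- Riccati systems still hold.
    have h2 := ih (by omega) (u + shift b ν k L F n) fun m hm => by
      obtain ⟨e1, e2, e3, e4⟩ := hO.far_all (show m < L by omega) (show n < L by omega) hm.ne
      rw [map_add, map_add, pair_shift, pair_shift, e1, e2, e3, e4]
      simpa using hF m (by omega)
    rw [List.range_succ, List.map_append, List.prod_append, List.map_singleton,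
      List.prod_singleton, Finset.sum_range_succ, add_comm (∑ m ∈ _, _), ← add_assoc]
    exact h2.comp h1

theorem IsA2Orbit.riccatiSystem_propagate (hO : IsA2Orbit b ν k L)
    (hς : IsTwistedDiagramAut b ν ω ς) {u : Mer ⊗[ℂ] H} (hu : IsCyclotomic ω ς u)
    {f : Fin 3 → Mer} (hf : SolvesRiccati b ν k u f) (m : ℕ) :
    RiccatiSystem (pair (b.baseSupp ((ν ^ m) k)) u) (pair (b.baseSupp ((ν ^ (m + L)) k)) u)
      (propagate ω f m) := by
  induction m with
  | zero =>
    have := hO.bar 0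
    rw [pow_zero, Equiv.Perm.one_apply] at this
    rw [SolvesRiccati, this] at hf
    exact hf
  | succ m ih =>
    obtain ⟨h0, h1, h2⟩ := propagate_succ ω f m
    rw [pow_succ', Equiv.Perm.mul_apply, Nat.succ_add, pow_succ', Equiv.Perm.mul_apply,
      hu.pair_eq b hς, hu.pair_eq b hς]
    exact ih.rotate _ h0 h1 h2

/-! #### Invariance -/

theorem copy_succ (hς : IsTwistedDiagramAut b ν ω ς) (s : ℕ) (f : Fin 3 → Mer) (m : ℕ) :
    hatAction ω (ς : 𝔤 →ₗ[ℂ] 𝔤) (copy b ν k L s (propagate ω f) m) =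
      copy b ν k L s (propagate ω f) (m + 1) := by
  obtain ⟨h0, h1, h2⟩ := propagate_succ ω f m
  rw [copy, copy, hatAction_upper b hς, h0, h1, h2, add_right_comm m 1, pow_succ' ν m, pow_succ' ν (m + L),
    Equiv.Perm.mul_apply, Equiv.Perm.mul_apply, map_add, map_sub, map_mul, map_natCast, mul_add,
    mul_sub, mul_left_comm (s : Mer)]

theorem lie_e_e_ne_zero {i j : ι} (hji : b.A j i = -1) :
    ⁅b.e i, b.e j⁆ ≠ 0 := by
  intro h
  have h1 : ⁅b.f i, ⁅b.e i, b.e j⁆⁆ = 0 := by rw [h, lie_zero]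
  have h2 : ⁅b.f i, b.e j⁆ = 0 := by
    rw [← lie_skew, b.lie_e_f_ne j i (ne_of_A_eq_neg_one b hji), neg_zero]
  have h3 : ⁅b.f i, b.e i⁆ = -b.h i := by rw [← lie_skew, (b.sl2 i).lie_e_f]
  rw [leibniz_lie, h2, h3, lie_zero, add_zero, neg_lie, lie_h_e, hji] at h1
  simp [(b.sl2 j).e_ne_zero] at h1

theorem upper_injective {i j : ι} (hij : b.A i j = -1) (hji : b.A j i = -1) {x y z : Mer}
    (h : upper b i j x y z = 0) : x = 0 ∧ y = 0 ∧ z = 0 := by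
  have step {x y z : Mer} (h : upper b i j x y z = 0) (r s : Mer) :
      upper b i j (-2 * x * r + x * s) (y * r - 2 * y * s) (-z * r - z * s) = 0 := by
    have := lie_upper_borel b hij hji x y z r s 0 0 0
    rw [h, zero_lie] at this
    simpa [borel] using this.symm
  have hz {v : 𝔤} (hv : v ≠ 0) {t : Mer} (ht : t ⊗ₜ[ℂ] v = 0) : t = 0 := by
    by_contra h
    exact tmul_ne_zero h hv ht
  -- Brackets with Cartan elements separate the three root spaces: the weights (1, -1), (1, 2) and
  -- (2, 1) kill z, x and y respectively.
  have h1 := step h 1 (-1)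
  have hy : y = 0 := by
    have h2 := step h1 1 2
    ring_nf at h2
    simp only [upper, TensorProduct.zero_tmul, zero_add, add_zero] at h2
    simpa using hz (b.sl2 j).e_ne_zero h2
  have hx : x = 0 := by
    have h2 := step h1 2 1
    ring_nf at h2
    simp only [upper, TensorProduct.zero_tmul, add_zero] at h2
    simpa using hz (b.sl2 i).e_ne_zero h2
  subst hx hy
  simp only [upper, TensorProduct.zero_tmul, zero_add] at h
  exact ⟨rfl, rfl, hz (lie_e_e_ne_zero hji) h⟩

theorem IsA2Orbit.copy_last_eq_iff (hO : IsA2Orbit b ν k L) {s : ℕ} (hs : s ≠ 0)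
    (f : Fin 3 → Mer) :
    copy b ν k L s (propagate ω f) L = copy b ν k L s (propagate ω f) 0 ↔
      IsSymmetric (ω⁻¹ ^ L) f := by
  obtain ⟨h0, h1, h2⟩ := propagate_eq ω f L
  have hs' : (s : Mer) ≠ 0 := by exact_mod_cast hs
  have hp : (ν ^ (L + L)) k = k := by simpa using hO.period 0
  have key (x y z x' y' z' : Mer) : upper b ((ν ^ L) k) k x y z = upper b k ((ν ^ L) k) x' y' z' ↔
      y = x' ∧ x = y' ∧ -z = z' := by
    have hn : b.A k ((ν ^ L) k) = -1 := by simpa using hO.near 0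
    have hn' : b.A ((ν ^ L) k) k = -1 := by simpa using hO.near' 0
    -- Half a turn of the orbit exchanges E_k and E_k̄ and so reverses their commutator; hence the
    -- signs in `IsSymmetric`.
    have hswap : upper b ((ν ^ L) k) k x y z = upper b k ((ν ^ L) k) y x (-z) := by
      rw [upper, upper, ← lie_skew, TensorProduct.tmul_neg, TensorProduct.neg_tmul,
        add_comm (x ⊗ₜ[ℂ] _)]
    rw [hswap]
    constructor
    · intro h
      have h3 : upper b k ((ν ^ L) k) (y - x') (x - y') (-z - z') = 0 := by
        rw [← sub_eq_zero] at h
        rw [← h]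
        simp only [upper, TensorProduct.sub_tmul]
        abel
      obtain ⟨e1, e2, e3⟩ := upper_injective hn hn' h3
      exact ⟨sub_eq_zero.1 e1, sub_eq_zero.1 e2, sub_eq_zero.1 e3⟩
    · rintro ⟨rfl, rfl, rfl⟩
      rfl
  rw [copy, copy, hp, zero_add, pow_zero, Equiv.Perm.one_apply, key, IsSymmetric, ← h0, ← h1, ← h2]
  simp only [propagate]
  have h2' : (2 : Mer) ≠ 0 := two_ne_zero
  constructor
  · rintro ⟨e1, e2, e3⟩
    refine ⟨mul_left_cancel₀ h2' ?_, mul_left_cancel₀ h2' ?_, mul_left_cancel₀ hs' ?_⟩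
    · linear_combination -e1 - e2
    · linear_combination -e1 + e2
    · linear_combination -e3
  · rintro ⟨e1, e2, e3⟩
    refine ⟨?_, ?_, ?_⟩
    · linear_combination -e1 - e2
    · linear_combination -e1 + e2
    · linear_combination -s * e3

/-- The action moves each summand to the next, so the sum telescopes and only the two ends have to
agree. -/
theorem IsA2Orbit.hatAction_sum_copy_iff (hO : IsA2Orbit b ν k L)
    (hς : IsTwistedDiagramAut b ν ω ς) {s : ℕ} (hs : s ≠ 0) (f : Fin 3 → Mer) :
    hatAction ω (ς : 𝔤 →ₗ[ℂ] 𝔤) (∑ m ∈ Finset.range L, copy b ν k L s (propagate ω f) m) =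
      ∑ m ∈ Finset.range L, copy b ν k L s (propagate ω f) m ↔ IsSymmetric (ω⁻¹ ^ L) f := by
  rw [← hO.copy_last_eq_iff hs f, map_sum]
  simp only [copy_succ hς]
  have h := Finset.sum_range_succ_comm (copy b ν k L s (propagate ω f)) L
  rw [Finset.sum_range_succ'] at h
  constructor
  · intro h'
    rw [h', add_comm] at h
    exact (add_right_cancel h).symm
  · intro h'
    rw [h'] at h
    rw [add_comm] at h
    exact add_left_cancel h

theorem hatAction_exp_ad {X : Mer ⊗[ℂ] 𝔤}
    (hX : IsNilpotent (LieAlgebra.ad Mer (Mer ⊗[ℂ] 𝔤) X))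
    (h : hatAction ω (ς : 𝔤 →ₗ[ℂ] 𝔤) X = X) (Z : Mer ⊗[ℂ] 𝔤) :
    IsNilpotent.exp (LieAlgebra.ad Mer (Mer ⊗[ℂ] 𝔤) X) (hatAction ω (ς : 𝔤 →ₗ[ℂ] 𝔤) Z) =
      hatAction ω (ς : 𝔤 →ₗ[ℂ] 𝔤) (IsNilpotent.exp (LieAlgebra.ad Mer (Mer ⊗[ℂ] 𝔤) X) Z) := by
  have hp (n : ℕ) (Z : Mer ⊗[ℂ] 𝔤) :
      (LieAlgebra.ad Mer (Mer ⊗[ℂ] 𝔤) X ^ n) (hatAction ω (ς : 𝔤 →ₗ[ℂ] 𝔤) Z) =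
        hatAction ω (ς : 𝔤 →ₗ[ℂ] 𝔤) ((LieAlgebra.ad Mer (Mer ⊗[ℂ] 𝔤) X ^ n) Z) := by
    induction n with
    | zero => simp
    | succ n ih =>
      rw [pow_succ', Module.End.mul_apply, Module.End.mul_apply, ih, LieAlgebra.ad_apply,
        LieAlgebra.ad_apply, hatAction_lie, h]
  obtain ⟨N, hN⟩ := hX
  have h0 (Z : Mer ⊗[ℂ] 𝔤) : (LieAlgebra.ad Mer (Mer ⊗[ℂ] 𝔤) X ^ N) Z = 0 := by rw [hN]; rfl
  rw [exp_apply_eq_sum ⟨N, hN⟩ (h0 _), exp_apply_eq_sum ⟨N, hN⟩ (h0 _), map_sum]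
  refine Finset.sum_congr rfl fun n _ => ?_
  rw [hp]
  exact (map_rat_smul (hatAction ω (ς : 𝔤 →ₗ[ℂ] 𝔤)).toAddMonoidHom _ _).symm

/-- Simple root vectors have degree 1 and their commutator degree 2, which is the source of the
scale 2. -/
theorem lie_copy_of_baseSupp_eq_one {x : H} (hx : ∀ i, b.baseSupp i x = 1) (F : ℕ → Fin 3 → Mer)
    (m : ℕ) : ⁅copy b ν k L 1 F m, (1 : Mer) ⊗ₜ[ℂ] (x : 𝔤)⁆ = -copy b ν k L 2 F m := by
  rw [← cartanIncl_tmul, ← lie_skew, copy, lie_cartanIncl_upper]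
  simp [hx, copy, one_add_one_eq_two]

/-- The series stops at first order because the bracket with x commutes with the exponent. Thus g
determines its exponent, and invariance of g can be tested on coefficients. -/
theorem IsA2Orbit.exp_apply_of_baseSupp_eq_one (hO : IsA2Orbit b ν k L) {x : H}
    (hx : ∀ i, b.baseSupp i x = 1) (f : Fin 3 → Mer) :
    gaugeParam b ν ω k f ((1 : Mer) ⊗ₜ[ℂ] (x : 𝔤)) =
      1 ⊗ₜ[ℂ] (x : 𝔤) - ∑ m ∈ Finset.range L, copy b ν k L 2 (propagate ω f) m := by
  obtain ⟨h1, h2⟩ := hO.gaugeParam_eq_exp (ω := ω) f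
  have h3 : ⁅∑ m ∈ Finset.range L, copy b ν k L 1 (propagate ω f) m, (1 : Mer) ⊗ₜ[ℂ] (x : 𝔤)⁆ =
      -∑ m ∈ Finset.range L, copy b ν k L 2 (propagate ω f) m := by
    rw [sum_lie, ← Finset.sum_neg_distrib]
    exact Finset.sum_congr rfl fun m _ => lie_copy_of_baseSupp_eq_one hx _ m
  have h4 : ⁅∑ m ∈ Finset.range L, copy b ν k L 1 (propagate ω f) m,
      ∑ m ∈ Finset.range L, copy b ν k L 2 (propagate ω f) m⁆ = 0 := by
    rw [sum_lie]
    refine Finset.sum_eq_zero fun m hm => ?_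
    rw [lie_sum]
    exact Finset.sum_eq_zero fun n hn =>
      hO.lie_copy_copy 1 2 _ (Finset.mem_range.1 hm) (Finset.mem_range.1 hn)
  have h5 : (LieAlgebra.ad Mer (Mer ⊗[ℂ] 𝔤)
      (∑ m ∈ Finset.range L, copy b ν k L 1 (propagate ω f) m) ^ 2) (1 ⊗ₜ[ℂ] (x : 𝔤)) = 0 := by
    rw [pow_two, Module.End.mul_apply, LieAlgebra.ad_apply, LieAlgebra.ad_apply, h3, lie_neg, h4,
      neg_zero]
  have one (v : Mer ⊗[ℂ] 𝔤) : (1 : ℚ) • v = v := one_smul ℚ v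
  rw [h2, exp_apply_eq_sum h1 h5]
  rw [Finset.sum_range_succ, Finset.sum_range_one, pow_zero, pow_one, Nat.factorial_zero,
    Nat.factorial_one, Nat.cast_one, inv_one, one, one, Module.End.one_apply,
    LieAlgebra.ad_apply, h3, sub_eq_add_neg]

theorem sum_copy_mem (s : Mer) (F : ℕ → Fin 3 → Mer) :
    ∑ m ∈ Finset.range L, copy b ν k L s F m ∈ (nilp b).toSubmodule.baseChange Mer := by
  have he (i : ι) : b.e i ∈ nilp b := LieSubalgebra.subset_lieSpan ⟨i, rfl⟩
  refine Submodule.sum_mem _ fun m _ => ?_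
  exact Submodule.add_mem _ (Submodule.add_mem _
    (Submodule.tmul_mem_baseChange_of_mem _ (he _)) (Submodule.tmul_mem_baseChange_of_mem _ (he _)))
    (Submodule.tmul_mem_baseChange_of_mem _ ((nilp b).lie_mem (he _) (he _)))

/-- The gauge parameter is invariant precisely when its coefficients are symmetric. -/
theorem IsA2Orbit.memUnipotentInvariants_iff (hO : IsA2Orbit b ν k L)
    (hν : ∀ i j, b.A (ν i) (ν j) = b.A i j) (hς : IsTwistedDiagramAut b ν ω ς)
    (f : Fin 3 → Mer) :
    MemUnipotentInvariants b ω ς (gaugeParam b ν ω k f) ↔ IsSymmetric (ω⁻¹ ^ L) f := by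
  obtain ⟨h1, h2⟩ := hO.gaugeParam_eq_exp (ω := ω) f
  constructor
  · rintro ⟨-, h⟩
    obtain ⟨x, hx, hx1⟩ := exists_map_rho b hν hς
    have h3 := h (1 ⊗ₜ[ℂ] (rho b : 𝔤))
    have h4 : hatAction ω (ς : 𝔤 →ₗ[ℂ] 𝔤) (1 ⊗ₜ[ℂ] (rho b : 𝔤)) = 1 ⊗ₜ[ℂ] (x : 𝔤) := by
      rw [hatAction_tmul, map_one, ← hx]; rfl
    rw [hO.exp_apply_of_baseSupp_eq_one (baseSupp_rho b), map_sub, h4,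
      hO.exp_apply_of_baseSupp_eq_one hx1] at h3
    have h5 := hO.hatAction_sum_copy_iff hς two_ne_zero f
    rw [Nat.cast_ofNat] at h5
    exact h5.1 (sub_right_injective h3).symm
  · intro h
    have h5 := hO.hatAction_sum_copy_iff hς one_ne_zero f
    rw [Nat.cast_one] at h5
    refine ⟨⟨_, sum_copy_mem 1 (propagate ω f), h2⟩, fun Z => ?_⟩
    rw [h2]
    exact hatAction_exp_ad h1 (h5.2 h) Z

end Copies

/-! ### Residues -/

section Residues

/-- The closure properties shared by the functions that are regular at the origin and the
functions that vanish to order two at infinity. -/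
structure IsResidueClass (P : Mer → Prop) : Prop where
  zero : P 0
  add {f g : Mer} : P f → P g → P (f + g)
  C_mul (c : ℂ) {f : Mer} : P f → P (RatFunc.C c * f)
  dil (c : ℂˣ) {f : Mer} : P f → P (dil c f)
  eq_zero {a : ℂ} : P (RatFunc.C a / RatFunc.X) → a = 0

theorem isResidueClass_regularAtZero : IsResidueClass RegularAtZero where
  zero := .zero
  add := .add
  C_mul c _ := (RegularAtZero.C c).mul
  dil c _ hf := hf.dil c
  eq_zero h := eq_zero_of_C_div_X_eq h rfl

theorem isResidueClass_vanishesToOrderTwoAtInfty : IsResidueClass VanishesToOrderTwoAtInfty where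
  zero := Or.inl rfl
  add hf hg := by
    rw [vanishesToOrderTwoAtInfty_iff] at *
    rw [map_add, add_div]
    exact hf.add hg
  C_mul c f hf := by
    rw [vanishesToOrderTwoAtInfty_iff] at *
    rw [map_mul, inversion_C, mul_div_assoc]
    exact (RegularAtZero.C c).mul hf
  dil c f hf := by
    rw [vanishesToOrderTwoAtInfty_iff] at *
    have h : inversion (CyclotomicMiura.dil c f) / RatFunc.X ^ 2 = RatFunc.C ((c⁻¹ : ℂˣ) : ℂ) ^ 2 *
        CyclotomicMiura.dil c⁻¹ (inversion f / RatFunc.X ^ 2) := by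
      have h0 : RatFunc.C ((c⁻¹ : ℂˣ) : ℂ) ≠ 0 := by simp
      rw [inversion_dil, map_div₀, map_pow, dil_X]
      field_simp [RatFunc.X_ne_zero]
    rw [h]
    exact ((RegularAtZero.C _).pow 2).mul (hf.dil _)
  eq_zero {a} h := by
    rw [vanishesToOrderTwoAtInfty_iff] at h
    refine eq_zero_of_C_div_X_eq h ?_
    rw [map_div₀, inversion_C, inversion_X]
    field_simp [RatFunc.X_ne_zero]

variable {V : Type*} [AddCommGroup V] [Module ℂ V]

/-- `v - μ / t` is of class `P`. -/
def HasRes (P : Mer → Prop) (v : Mer ⊗[ℂ] V) (μ : V) : Prop :=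
  ∀ φ : Module.Dual ℂ V, P (pair φ v - RatFunc.C (φ μ) / RatFunc.X)

theorem hasResZero_iff (v : Mer ⊗[ℂ] V) (μ : V) :
    HasResZero v μ ↔ HasRes RegularAtZero v μ := by
  simp only [HasResZero, HasRes, map_sub, pair_tmul, div_eq_mul_inv]

theorem hasResInfty_iff (v : Mer ⊗[ℂ] V) (μ : V) :
    HasResInfty v μ ↔ HasRes VanishesToOrderTwoAtInfty v (-μ) := by
  simp only [HasResInfty, HasRes, map_add, pair_tmul, div_eq_mul_inv, map_neg, neg_mul,
    sub_neg_eq_add]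

variable {P : Mer → Prop} (hP : IsResidueClass P)
include hP

theorem HasRes.add {v w : Mer ⊗[ℂ] V} {μ η : V} (hv : HasRes P v μ) (hw : HasRes P w η) :
    HasRes P (v + w) (μ + η) := by
  intro φ
  have := hP.add (hv φ) (hw φ)
  rw [map_add, map_add, map_add, add_div]
  convert this using 1
  ring

theorem HasRes.sum {n : ℕ} {v : ℕ → Mer ⊗[ℂ] V} {μ : ℕ → V} (h : ∀ m < n, HasRes P (v m) (μ m)) :
    HasRes P (∑ m ∈ Finset.range n, v m) (∑ m ∈ Finset.range n, μ m) := by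
  induction n with
  | zero => intro φ; simpa using hP.zero
  | succ n ih =>
    rw [Finset.sum_range_succ, Finset.sum_range_succ]
    exact HasRes.add hP (ih fun m hm => h m (by omega)) (h n (by omega))

theorem HasRes.tmul {f : Mer} {a : ℂ} (h : P (f - RatFunc.C a / RatFunc.X)) (x : V) :
    HasRes P (f ⊗ₜ[ℂ] x) (a • x) := by
  intro φ
  convert hP.C_mul (φ x) h using 1
  rw [pair_tmul, map_smul, smul_eq_mul, map_mul]
  ring

theorem IsResidueClass.rotate (c : ℂˣ) {f : Mer} {a : ℂ} (h : P (f - RatFunc.C a / RatFunc.X)) :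
    P (RatFunc.C (c : ℂ) * CyclotomicMiura.dil c f - RatFunc.C a / RatFunc.X) := by
  have h0 : RatFunc.C (c : ℂ) ≠ 0 := by simp
  convert hP.C_mul c (hP.dil c h) using 1
  rw [map_sub, map_div₀, dil_C, dil_X, mul_sub]
  field_simp [RatFunc.X_ne_zero]

theorem HasRes.pair_unique {f : Mer} {a c : ℂ} (h : P (f - RatFunc.C a / RatFunc.X))
    (h' : P (f - RatFunc.C c / RatFunc.X)) : a = c := by
  rw [← sub_eq_zero]
  apply hP.eq_zero
  convert hP.add h' (hP.C_mul (-1) h) using 1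
  rw [map_sub, map_neg, map_one]
  ring

end Residues

/-! ### Residues of the transformed connection and the dot action of the orbit reflection. -/

section Transformed

variable {ι : Type*} [Fintype ι] [DecidableEq ι] {𝔤 : Type*} [LieRing 𝔤] [LieAlgebra ℂ 𝔤]
  [FiniteDimensional ℂ 𝔤] {H : LieSubalgebra ℂ 𝔤} {b : LieAlgebra.Basis ι H}
  {ν : Equiv.Perm ι} {ω : ℂˣ} {ς : 𝔤 ≃ₗ⁅ℂ⁆ 𝔤} {k : ι} {L : ℕ}

/-- The sum of the simple coroots in the orbit. -/
noncomputable def corootSum (b : LieAlgebra.Basis ι H) (ν : Equiv.Perm ι) (k : ι) (L n : ℕ) : H :=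
  ∑ m ∈ Finset.range n, (b.h' ((ν ^ m) k) + b.h' ((ν ^ (m + L)) k))

theorem hasRes_sum_shift {P : Mer → Prop} (hP : IsResidueClass P) {f : Fin 3 → Mer} {a : ℂ}
    (hx : P (f 0 + f 1 - RatFunc.C a / RatFunc.X)) (hy : P (f 0 - f 1 - RatFunc.C a / RatFunc.X))
    {u : Mer ⊗[ℂ] H} {μ : H} (hu : HasRes P u μ) :
    HasRes P (u + ∑ m ∈ Finset.range L, shift b ν k L (propagate ω f) m)
      (μ + a • corootSum b ν k L L) := by
  apply HasRes.add hP hu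
  rw [corootSum, Finset.smul_sum]
  refine HasRes.sum hP fun m _ => ?_
  obtain ⟨h0, h1, -⟩ := propagate_eq ω f m
  rw [shift, smul_add, h0, h1, ← mul_add, ← mul_sub, ← map_add, ← map_sub]
  exact HasRes.add hP (HasRes.tmul hP (hP.rotate _ hx) _) (HasRes.tmul hP (hP.rotate _ hy) _)

/-- A class of functions sees the same residue along the orbit of a simple root. -/
theorem IsCyclotomic.baseSupp_eq_of_hasRes {P : Mer → Prop} (hP : IsResidueClass P)
    (hς : IsTwistedDiagramAut b ν ω ς) {u : Mer ⊗[ℂ] H} (hu : IsCyclotomic ω ς u) {μ : H}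
    (h : HasRes P u μ) (i : ι) : b.baseSupp (ν i) μ = b.baseSupp i μ := by
  have h1 := h (b.baseSupp (ν i))
  have h2 := hP.rotate ω⁻¹ (h (b.baseSupp i))
  rw [← hu.pair_eq b hς] at h2
  exact HasRes.pair_unique hP h1 h2

theorem baseSupp_pow {μ : H} (h : ∀ i, b.baseSupp (ν i) μ = b.baseSupp i μ) (m : ℕ) (i : ι) :
    b.baseSupp ((ν ^ m) i) μ = b.baseSupp i μ := by
  induction m with
  | zero => rfl
  | succ m ih => rw [pow_succ', Equiv.Perm.mul_apply, h, ih]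

theorem simpleReflection_apply (i : ι) (x : H) :
    simpleReflection b i x = x - b.baseSupp i x • b.h' i := rfl

/-- The product is the reflection in the highest root α_i + α_j of A₂. -/
theorem simpleReflection_triple {i j : ι} (hij : b.A i j = -1) (hji : b.A j i = -1) (x : H) :
    (simpleReflection b i * simpleReflection b j * simpleReflection b i) x =
      x - (b.baseSupp i x + b.baseSupp j x) • (b.h' i + b.h' j) := by
  simp only [Module.End.mul_apply, simpleReflection_apply, map_sub, map_smul, b.baseSupp_apply_h',
    A_diag, hij, hji]
  push_cast
  module

theorem IsA2Orbit.sOrbit_apply (hO : IsA2Orbit b ν k L) {c : ℂ} {x : H}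
    (hx : ∀ m, b.baseSupp ((ν ^ m) k) x = c) :
    sOrbit b ν k x = x - (2 * c) • corootSum b ν k L L := by
  have key (n : ℕ) (hn : n ≤ L) (x : H) (hx : ∀ m < n, b.baseSupp ((ν ^ m) k) x = c ∧
      b.baseSupp ((ν ^ (m + L)) k) x = c) :
      ((List.range n).map fun m => simpleReflection b ((ν ^ m) k) *
        simpleReflection b (CyclotomicMiura.bar ν ((ν ^ m) k)) * simpleReflection b ((ν ^ m) k)).prod x =
        x - (2 * c) • corootSum b ν k L n := by
    induction n generalizing x with
    | zero => simp [corootSum]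
    | succ n ih =>
      obtain ⟨h1, h2⟩ := hx n (by omega)
      rw [List.range_succ, List.map_append, List.prod_append, List.map_singleton,
        List.prod_singleton, Module.End.mul_apply, hO.bar n,
        simpleReflection_triple (hO.near n) (hO.near' n), h1, h2, ih (by omega)]
      · rw [corootSum, corootSum, Finset.sum_range_succ]
        module
      -- Copies are orthogonal, so reflecting in one does not change the pairings with the others.
      · intro m hm
        obtain ⟨e1, e2, e3, e4⟩ := hO.far_all (show m < L by omega) (show n < L by omega) hm.ne
        simp [e1, e2, e3, e4, hx m (by omega)]
  rw [sOrbit, hO.card_half]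
  exact key L le_rfl x fun m _ => ⟨hx m, hx (m + L)⟩

theorem IsA2Orbit.dot_sOrbit (hO : IsA2Orbit b ν k L) {c : ℂ} {x : H}
    (hx : ∀ m, b.baseSupp ((ν ^ m) k) (x + rho b) = c) :
    dot b (sOrbit b ν k) x = x - (2 * c) • corootSum b ν k L L := by
  rw [dot, hO.sOrbit_apply hx]
  abel

/-- The transformed connection is again cyclotomic. -/
theorem IsA2Orbit.isCyclotomic_add_sum_shift (hO : IsA2Orbit b ν k L)
    (hς : IsTwistedDiagramAut b ν ω ς) {u : Mer ⊗[ℂ] H} (hu : IsCyclotomic ω ς u)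
    {f : Fin 3 → Mer} (hf : IsSymmetric (ω⁻¹ ^ L) f) :
    IsCyclotomic ω ς (u + ∑ m ∈ Finset.range L, shift b ν k L (propagate ω f) m) := by
  have hh (g : Mer) (i : ι) : (ω : ℂ)⁻¹ • hatAction ω (ς : 𝔤 →ₗ[ℂ] 𝔤)
      (cartanIncl H (g ⊗ₜ[ℂ] b.h' i)) =
      cartanIncl H ((RatFunc.C ((ω⁻¹ : ℂˣ) : ℂ) * dil ω⁻¹ g) ⊗ₜ[ℂ] b.h' (ν i)) := by
    rw [cartanIncl_tmul, cartanIncl_tmul, hatAction_tmul, TensorProduct.smul_tmul',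
      RatFunc.smul_eq_C_mul, Units.val_inv_eq_inv_val]
    exact congrArg _ (hς i).2.1
  have hstep (m : ℕ) : (ω : ℂ)⁻¹ • hatAction ω (ς : 𝔤 →ₗ[ℂ] 𝔤)
      (cartanIncl H (shift b ν k L (propagate ω f) m)) =
      cartanIncl H (shift b ν k L (propagate ω f) (m + 1)) := by
    obtain ⟨h0, h1, -⟩ := propagate_succ ω f m
    rw [shift, map_add, map_add, smul_add, hh, hh, ← map_add, shift, h0, h1, map_add (dil _), map_sub (dil _),
      mul_add, mul_sub, add_right_comm m 1, pow_succ' ν m, pow_succ' ν (m + L),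
      Equiv.Perm.mul_apply, Equiv.Perm.mul_apply]
  -- After half a turn both the coefficients and the coroots are exchanged, so the cyclic sum closes
  -- up.
  have hlast : shift b ν k L (propagate ω f) L = shift b ν k L (propagate ω f) 0 := by
    obtain ⟨h0, h1, -⟩ := propagate_eq ω f L
    have hp : (ν ^ (L + L)) k = k := by simpa using hO.period 0
    have e0 : propagate ω f L 0 = f 0 := by rw [h0, ← hf.1]
    have e1 : propagate ω f L 1 = -f 1 := by rw [h1, hf.2.1, neg_neg, ← hf.2.1]
    rw [shift, shift, hp, zero_add, e0, e1, propagate, add_comm, sub_neg_eq_add, sub_eq_add_neg]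
    rfl
  have htel := Finset.sum_range_succ_comm (shift b ν k L (propagate ω f)) L
  rw [Finset.sum_range_succ', hlast, add_comm] at htel
  have htel' := add_left_cancel htel
  rw [IsCyclotomic, map_add, map_add, smul_add]
  congr 1
  rw [map_sum, map_sum, Finset.smul_sum]
  simp only [hstep]
  rw [← map_sum, ← map_sum, htel']

end Transformed

/-! ### Flat sections -/

section Flat

/-- A subspace that is stable under a connection with a basis of flat sections is spanned by flat
sections. -/
theorem exists_flat_of_stable {M κ : Type*} [AddCommGroup M] [Module Mer M] [Fintype κ]
    (B : Module.Basis κ Mer M) {D : M → M} (hD : ∀ z a, B.repr (D z) a = ratDeriv (B.repr z a))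
    {W : Submodule Mer M} (hW : ∀ z ∈ W, D z ∈ W) (l : M →ₗ[Mer] Mer) {w : M} (hw : w ∈ W)
    (hl : l w ≠ 0) : ∃ z ∈ W, D z = 0 ∧ l z ≠ 0 := by
  classical
  induction hn : (B.repr w).support.card using Nat.strong_induction_on generalizing w with
  | _ n ih =>
    subst hn
    obtain ⟨a, ha⟩ : ∃ a, B.repr w a ≠ 0 := by
      by_contra! h
      apply hl
      have : B.repr w = 0 := Finsupp.ext h
      rw [LinearEquiv.map_eq_zero_iff] at this
      rw [this, map_zero]
    -- With one coordinate normalised to 1, the derivative has a zero there, hence smaller support.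
    obtain ⟨w', hw'⟩ : ∃ w', w' = (B.repr w a)⁻¹ • w := ⟨_, rfl⟩
    have hw'W : w' ∈ W := hw' ▸ W.smul_mem _ hw
    have hlw' : l w' ≠ 0 := by
      rw [hw', map_smul, smul_eq_mul]
      exact mul_ne_zero (inv_ne_zero ha) hl
    have hrepr (c : κ) : B.repr w' c = (B.repr w a)⁻¹ * B.repr w c := by
      rw [hw', map_smul, Finsupp.smul_apply, smul_eq_mul]
    have hsupp {z : M} (c : κ) (h : ∀ d, B.repr w d = 0 → B.repr z d = 0) (hc : B.repr w c ≠ 0)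
        (hz : B.repr z c = 0) : (B.repr z).support.card < (B.repr w).support.card := by
      apply Finset.card_lt_card
      rw [Finset.ssubset_iff_of_subset]
      · exact ⟨c, Finsupp.mem_support_iff.2 hc, by simpa using hz⟩
      · intro d hd
        rw [Finsupp.mem_support_iff] at hd ⊢
        exact fun h' => hd (h d h')
    have hDw (d : κ) (hd : B.repr w d = 0) : B.repr (D w') d = 0 := by
      rw [hD, hrepr, hd, mul_zero, map_zero]
    by_cases h0 : D w' = 0
    · exact ⟨w', hw'W, h0, hlw'⟩
    by_cases h1 : l (D w') = 0
    -- If l kills D w', a multiple of D w' can be subtracted to remove a coordinate without changing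
    -- the value of l.
    · obtain ⟨c, hc⟩ : ∃ c, B.repr (D w') c ≠ 0 := by
        by_contra! h
        apply h0
        rw [← LinearEquiv.map_eq_zero_iff B.repr]
        exact Finsupp.ext h
      have hwc : B.repr w c ≠ 0 := fun h => hc (hDw c h)
      refine ih _ (hsupp (z := w' - (B.repr w' c / B.repr (D w') c) • D w') c (fun d hd => ?_) hwc ?_)
        (W.sub_mem hw'W (W.smul_mem _ (hW _ hw'W))) ?_ rfl
      · simp [hrepr, hd, hDw d hd]
      · rw [map_sub, map_smul B.repr, Finsupp.sub_apply, Finsupp.smul_apply, smul_eq_mul,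
          div_mul_cancel₀ _ hc, sub_self]
      · rwa [map_sub, map_smul l, h1, smul_zero, sub_zero]
    · refine ih _ (hsupp (z := D w') a hDw ha ?_) (hW _ hw'W) h1 rfl
      rw [hD, hrepr, inv_mul_cancel₀ ha, ratDeriv_one]

variable {𝔤 : Type*} [LieRing 𝔤] [LieAlgebra ℂ 𝔤] [FiniteDimensional ℂ 𝔤]

theorem MonodromyFree.exists_flat {A : Mer ⊗[ℂ] 𝔤} (h : MonodromyFree A)
    {W : Submodule Mer (Mer ⊗[ℂ] 𝔤)} (hW : ∀ z ∈ W, vecDeriv 𝔤 z + ⁅A, z⁆ ∈ W)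
    (φ : Module.Dual ℂ 𝔤) {w : Mer ⊗[ℂ] 𝔤} (hw : w ∈ W) (hφ : pair φ w ≠ 0) :
    ∃ z ∈ W, vecDeriv 𝔤 z + ⁅A, z⁆ = 0 ∧ pair φ z ≠ 0 := by
  obtain ⟨Y, hY⟩ := h
  let B := ((Module.finBasis ℂ 𝔤).baseChange Mer).map (Y : (Mer ⊗[ℂ] 𝔤) ≃ₗ[Mer] (Mer ⊗[ℂ] 𝔤))
  have hB (a) : vecDeriv 𝔤 (B a) + ⁅A, B a⁆ = 0 := by
    have : B a = Y (1 ⊗ₜ[ℂ] Module.finBasis ℂ 𝔤 a) := by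
      simp [B, Module.Basis.baseChange_apply]
    rw [this, hY]
  let l : (Mer ⊗[ℂ] 𝔤) →ₗ[Mer] Mer :=
    { toFun := pair φ, map_add' := map_add _, map_smul' := pair_smul φ }
  refine exists_flat_of_stable B (D := fun z => vecDeriv 𝔤 z + ⁅A, z⁆) (fun z a => ?_) hW l hw hφ
  have h1 : vecDeriv 𝔤 z + ⁅A, z⁆ = ∑ a, ratDeriv (B.repr z a) • B a := by
    conv_lhs => rw [← B.sum_repr z]
    rw [map_sum, lie_sum, ← Finset.sum_add_distrib]
    refine Finset.sum_congr rfl fun a _ => ?_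
    rw [vecDeriv_smul, lie_smul, add_assoc, ← smul_add, hB, smul_zero, add_zero]
  change B.repr (vecDeriv 𝔤 z + ⁅A, z⁆) a = _
  rw [h1, B.repr_sum_self]

end Flat

/-! ### The Killing form -/

section Killing

variable {ι : Type*} [Fintype ι] [DecidableEq ι] {𝔤 : Type*} [LieRing 𝔤] [LieAlgebra ℂ 𝔤]
  [FiniteDimensional ℂ 𝔤] {H : LieSubalgebra ℂ 𝔤} {b : LieAlgebra.Basis ι H}

theorem pair_add_left {V : Type*} [AddCommGroup V] [Module ℂ V] (φ ψ : Module.Dual ℂ V)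
    (Z : Mer ⊗[ℂ] V) : pair (φ + ψ) Z = pair φ Z + pair ψ Z := by
  induction Z with
  | zero => simp
  | add Z Z' h h' => rw [map_add, h, h', map_add, map_add]; ring
  | tmul f z => rw [pair_tmul, pair_tmul, pair_tmul, LinearMap.add_apply, map_add]; ring

theorem pair_smul_left {V : Type*} [AddCommGroup V] [Module ℂ V] (c : ℂ) (φ : Module.Dual ℂ V)
    (Z : Mer ⊗[ℂ] V) : pair (c • φ) Z = RatFunc.C c * pair φ Z := by
  induction Z with
  | zero => simp
  | add Z Z' h h' => rw [map_add, h, h', map_add]; ring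
  | tmul f z => rw [pair_tmul, pair_tmul, LinearMap.smul_apply, smul_eq_mul, map_mul]; ring

theorem pair_neg_left {V : Type*} [AddCommGroup V] [Module ℂ V] (φ : Module.Dual ℂ V)
    (Z : Mer ⊗[ℂ] V) : pair (-φ) Z = -pair φ Z := by
  rw [← neg_one_smul ℂ, pair_smul_left, map_neg, map_one, neg_one_mul]

theorem killingForm_lie (X y z : 𝔤) :
    killingForm ℂ 𝔤 X ⁅y, z⁆ = -killingForm ℂ 𝔤 ⁅y, X⁆ z := by
  rw [killingForm, ← LieModule.traceForm_apply_lie_apply, ← lie_skew, map_neg]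
  rfl

theorem pair_killingForm_lie (X y : 𝔤) (g : Mer) (Z : Mer ⊗[ℂ] 𝔤) :
    pair (killingForm ℂ 𝔤 X) ⁅g ⊗ₜ[ℂ] y, Z⁆ = -(g * pair (killingForm ℂ 𝔤 ⁅y, X⁆) Z) := by
  induction Z with
  | zero => simp
  | add Z Z' h h' => rw [lie_add, map_add, map_add, h, h']; ring
  | tmul f z => rw [lie_tmul_tmul, pair_tmul, pair_tmul, killingForm_lie, map_neg]; ring

theorem pair_killingForm_lie_cartanIncl {X : 𝔤} {χ : Module.Dual ℂ H}
    (hX : ∀ h : H, ⁅(h : 𝔤), X⁆ = χ h • X) (v : Mer ⊗[ℂ] H) (Z : Mer ⊗[ℂ] 𝔤) :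
    pair (killingForm ℂ 𝔤 X) ⁅cartanIncl H v, Z⁆ = -(pair χ v * pair (killingForm ℂ 𝔤 X) Z) := by
  induction v with
  | zero => simp
  | add v w h h' => rw [map_add, add_lie, map_add, h, h', map_add]; ring
  | tmul g h =>
    rw [cartanIncl_tmul, pair_killingForm_lie, hX, map_smul, pair_smul_left, pair_tmul]
    ring

theorem killingForm_eq_zero_of_weight {ρ X Y : 𝔤} {a c : ℂ} (hX : ⁅ρ, X⁆ = a • X)
    (hY : ⁅ρ, Y⁆ = c • Y) (h : a + c ≠ 0) : killingForm ℂ 𝔤 X Y = 0 := by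
  have := killingForm_lie X ρ Y
  rw [hX, hY, map_smul, map_smul, LinearMap.smul_apply, smul_eq_mul, smul_eq_mul] at this
  have h' : (a + c) * killingForm ℂ 𝔤 X Y = 0 := by linear_combination this
  exact (mul_eq_zero.1 h').resolve_left h

theorem killingForm_h (b : LieAlgebra.Basis ι H) (i : ι) (x : H) :
    killingForm ℂ 𝔤 (b.h i) x = b.baseSupp i x * killingForm ℂ 𝔤 (b.e i) (b.f i) := by
  have h1 : ⁅(x : 𝔤), b.f i⁆ = -(b.baseSupp i x • b.f i) := lie_coe_f b x i
  have h2 : killingForm ℂ 𝔤 (b.e i) ⁅b.f i, (x : 𝔤)⁆ = killingForm ℂ 𝔤 (b.h i) x := by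
    rw [killingForm_lie, ← lie_skew, map_neg, LinearMap.neg_apply, neg_neg, (b.sl2 i).lie_e_f]
  rw [← h2, ← lie_skew, h1, neg_neg, map_smul, smul_eq_mul]

/-- Otherwise the coroot h_i would be orthogonal to the Cartan subalgebra, on which the Killing form
is non-degenerate. -/
theorem killingForm_e_f_ne_zero [LieAlgebra.IsSemisimple ℂ 𝔤] (b : LieAlgebra.Basis ι H) (i : ι) :
    killingForm ℂ 𝔤 (b.e i) (b.f i) ≠ 0 := by
  intro h
  have : H.IsCartanSubalgebra := b.isCartanSubalgebra
  have hker := LieAlgebra.IsKilling.ker_restrict_eq_bot_of_isCartanSubalgebra ℂ 𝔤 H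
  have hmem : b.h' i ∈ LinearMap.ker ((killingForm ℂ 𝔤).restrict H) := by
    rw [LinearMap.mem_ker]
    ext x
    change killingForm ℂ 𝔤 (b.h i) x = 0
    rw [killingForm_h, h, mul_zero]
  rw [hker, Submodule.mem_bot] at hmem
  exact (b.sl2 i).h_ne_zero (congrArg Subtype.val hmem)

/-- The functions that are orthogonal to the lower nilpotent part and to `x`. -/
noncomputable def orthogonalLower (b : LieAlgebra.Basis ι H) (x : H) :
    Submodule Mer (Mer ⊗[ℂ] 𝔤) where
  carrier := {Z | (∀ (n : ℕ) (X : 𝔤), ⁅(rho b : 𝔤), X⁆ = -((n : ℂ) + 1) • X →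
    pair (killingForm ℂ 𝔤 X) Z = 0) ∧ pair (killingForm ℂ 𝔤 (x : 𝔤)) Z = 0}
  zero_mem' := ⟨fun _ _ _ => map_zero _, map_zero _⟩
  add_mem' := fun h h' => ⟨fun n X hX => by rw [map_add, h.1 n X hX, h'.1 n X hX, add_zero],
    by rw [map_add, h.2, h'.2, add_zero]⟩
  smul_mem' := fun m Z h => ⟨fun n X hX => by rw [pair_smul, h.1 n X hX, mul_zero],
    by rw [pair_smul, h.2, mul_zero]⟩

theorem lie_rho_f (b : LieAlgebra.Basis ι H) (i : ι) : ⁅(rho b : 𝔤), b.f i⁆ = -b.f i := by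
  rw [lie_coe_f, baseSupp_rho, one_smul]

theorem lie_rho_sum_f (b : LieAlgebra.Basis ι H) :
    ⁅(rho b : 𝔤), ∑ i, b.f i⁆ = -∑ i, b.f i := by
  rw [lie_sum, ← Finset.sum_neg_distrib]
  exact Finset.sum_congr rfl fun i _ => lie_rho_f b i

/-- Elements of `orthogonalLower` have no component of positive ρ-degree, while [p₋₁, x] has degree
-1 and the Cartan part commutes with x. Hence Cartan pairings of flat sections are constant. -/
theorem pair_killingForm_cartan {x x' : H} {Z : Mer ⊗[ℂ] 𝔤} (u : Mer ⊗[ℂ] H)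
    (hZ : Z ∈ orthogonalLower b x') :
    pair (killingForm ℂ 𝔤 (x : 𝔤)) ⁅pMinusOne b + cartanIncl H u, Z⁆ = 0 := by
  have h1 : ⁅(rho b : 𝔤), ⁅∑ i, b.f i, (x : 𝔤)⁆⁆ = -(((0 : ℕ) : ℂ) + 1) • ⁅∑ i, b.f i, (x : 𝔤)⁆ := by
    rw [leibniz_lie, lie_rho_sum_f, lie_coe_coe b, lie_zero, add_zero]
    simp
  rw [add_lie, map_add, pMinusOne, pair_killingForm_lie, hZ.1 _ _ h1,
    pair_killingForm_lie_cartanIncl (χ := 0) fun h => by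
      rw [lie_coe_coe b, LinearMap.zero_apply, zero_smul]]
  simp [pair]

/-- Bracketing with p₋₁ lowers the degree and the Cartan part preserves it, so the orthogonality
conditions are carried to one another. -/
theorem orthogonalLower_stable (u : Mer ⊗[ℂ] H) (x : H) (Z : Mer ⊗[ℂ] 𝔤)
    (hZ : Z ∈ orthogonalLower b x) :
    vecDeriv 𝔤 Z + ⁅pMinusOne b + cartanIncl H u, Z⁆ ∈ orthogonalLower b x := by
  refine ⟨fun n X hX => ?_, ?_⟩
  · have h1 : ⁅(rho b : 𝔤), ⁅∑ i, b.f i, X⁆⁆ = -(((n + 1 : ℕ) : ℂ) + 1) • ⁅∑ i, b.f i, X⁆ := by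
      rw [leibniz_lie, lie_rho_sum_f, hX, neg_lie, lie_smul]
      push_cast
      module
    have h2 : pair (killingForm ℂ 𝔤 X) ⁅cartanIncl H u, Z⁆ = 0 := by
      induction u with
      | zero => simp
      | add v w h h' => rw [map_add, add_lie, map_add, h, h', add_zero]
      | tmul g h =>
        rw [cartanIncl_tmul, pair_killingForm_lie, hZ.1 n, mul_zero, neg_zero]
        rw [leibniz_lie, lie_coe_coe b, zero_lie, zero_add, hX, lie_smul]
    rw [map_add, pair_vecDeriv, hZ.1 n X hX, map_zero, zero_add, add_lie, map_add, h2, pMinusOne,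
      pair_killingForm_lie, hZ.1 _ _ h1, mul_zero, neg_zero, add_zero]
  · rw [map_add, pair_vecDeriv, hZ.2, map_zero, zero_add, pair_killingForm_cartan u hZ]

theorem tmul_mem_orthogonalLower {x : H} {Y : 𝔤} {c : ℂ} (hY : ⁅(rho b : 𝔤), Y⁆ = c • Y)
    (hc : ∀ n : ℕ, c ≠ n + 1) (hx : killingForm ℂ 𝔤 x Y = 0) :
    (1 : Mer) ⊗ₜ[ℂ] Y ∈ orthogonalLower b x := by
  refine ⟨fun n X hX => ?_, ?_⟩
  · rw [pair_tmul, killingForm_eq_zero_of_weight hX hY, map_zero, zero_mul]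
    intro h
    exact hc n (by linear_combination h)
  · rw [pair_tmul, hx, map_zero, zero_mul]

/-- The scalar equations satisfied by the Killing pairings of a flat section. -/
theorem ratDeriv_pair_killingForm_e {u : Mer ⊗[ℂ] H} {Z : Mer ⊗[ℂ] 𝔤}
    (hZ : vecDeriv 𝔤 Z + ⁅pMinusOne b + cartanIncl H u, Z⁆ = 0) (i : ι) :
    ratDeriv (pair (killingForm ℂ 𝔤 (b.e i)) Z) =
      pair (b.baseSupp i) u * pair (killingForm ℂ 𝔤 (b.e i)) Z -
        pair (killingForm ℂ 𝔤 (b.h i)) Z := by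
  have h1 : ⁅∑ j, b.f j, b.e i⁆ = -b.h i := by rw [← lie_skew, lie_e_sum_f]
  rw [← pair_vecDeriv, eq_neg_of_add_eq_zero_left hZ, map_neg, add_lie, map_add, pMinusOne,
    pair_killingForm_lie, h1, map_neg, pair_neg_left,
    pair_killingForm_lie_cartanIncl (χ := b.baseSupp i) fun h => lie_coe_e b h i]
  ring

theorem ratDeriv_pair_killingForm_lie_e_e {u : Mer ⊗[ℂ] H} {Z : Mer ⊗[ℂ] 𝔤}
    (hZ : vecDeriv 𝔤 Z + ⁅pMinusOne b + cartanIncl H u, Z⁆ = 0) {i j : ι} (hij : b.A i j = -1)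
    (hji : b.A j i = -1) :
    ratDeriv (pair (killingForm ℂ 𝔤 ⁅b.e i, b.e j⁆) Z) =
      (pair (b.baseSupp i) u + pair (b.baseSupp j) u) * pair (killingForm ℂ 𝔤 ⁅b.e i, b.e j⁆) Z +
        pair (killingForm ℂ 𝔤 (b.e j)) Z - pair (killingForm ℂ 𝔤 (b.e i)) Z := by
  have h1 : ⁅∑ k, b.f k, ⁅b.e i, b.e j⁆⁆ = b.e j - b.e i := by
    have h2 (l : ι) : ⁅∑ k, b.f k, b.e l⁆ = -b.h l := by rw [← lie_skew, lie_e_sum_f]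
    rw [leibniz_lie, h2, h2, neg_lie, lie_neg, lie_skew (b.h j), lie_h_e, lie_h_e, hij, hji]
    simp [sub_eq_add_neg]
  have h2 (h : H) : ⁅(h : 𝔤), ⁅b.e i, b.e j⁆⁆ =
      (b.baseSupp i + b.baseSupp j) h • ⁅b.e i, b.e j⁆ := by
    rw [leibniz_lie, lie_coe_e, lie_coe_e, smul_lie, lie_smul, LinearMap.add_apply, add_smul]
  rw [← pair_vecDeriv, eq_neg_of_add_eq_zero_left hZ, map_neg, add_lie, map_add, pMinusOne,
    pair_killingForm_lie, h1, sub_eq_add_neg, map_add, map_neg, pair_add_left, pair_neg_left,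
    pair_killingForm_lie_cartanIncl h2, pair_add_left]
  ring

/-- The scalar differential equations that become solvable when the monodromy is trivial. -/
theorem MonodromyFree.exists_solutions [LieAlgebra.IsSemisimple ℂ 𝔤] {u : Mer ⊗[ℂ] H}
    (h : MonodromyFree (pMinusOne b + cartanIncl H u)) {i j : ι} (hij : b.A i j = -1)
    (hji : b.A j i = -1) : ∃ φ r p₁ p₃ : Mer, φ ≠ 0 ∧ ratDeriv φ = pair (b.baseSupp j) u * φ ∧
      ratDeriv r = 1 + pair (b.baseSupp j) u * r ∧ ratDeriv p₁ = pair (b.baseSupp i) u * p₁ ∧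
      ratDeriv p₃ = (pair (b.baseSupp i) u + pair (b.baseSupp j) u) * p₃ + r - p₁ := by
  have hrho (x : H) : ⁅(rho b : 𝔤), (x : 𝔤)⁆ = (0 : ℂ) • (x : 𝔤) := by
    rw [lie_coe_coe b, zero_smul]
  have hpos (n : ℕ) : (n : ℂ) + 1 ≠ 0 := by exact_mod_cast n.succ_ne_zero
  -- A flat section orthogonal to h_j, whose pairing with e_j solves the homogeneous equation. The
  -- vector f_j shows that this pairing is not identically zero on the subspace.
  obtain ⟨Z, hZ, hZ0, hZφ⟩ : ∃ Z ∈ orthogonalLower b (b.h' j),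
      vecDeriv 𝔤 Z + ⁅pMinusOne b + cartanIncl H u, Z⁆ = 0 ∧
        pair (killingForm ℂ 𝔤 (b.e j)) Z ≠ 0 := by
    refine h.exists_flat (orthogonalLower_stable u _) _ (w := 1 ⊗ₜ[ℂ] b.f j)
      (tmul_mem_orthogonalLower (c := -1) (by rw [lie_rho_f, neg_one_smul]) (fun n hn => ?_) ?_) ?_
    · have := hpos (n + 1)
      push_cast at this
      exact this (by linear_combination -hn)
    · refine killingForm_eq_zero_of_weight (hrho _) (c := -1) (by rw [lie_rho_f, neg_one_smul]) ?_
      simp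
    · rw [pair_tmul, mul_one]
      simpa using killingForm_e_f_ne_zero b j
  -- The vector h_i + 2h_j is killed by α_i (2 - 2 = 0), hence orthogonal to h_i, whereas α_j takes
  -- the value -1 + 4 = 3 on it.
  obtain ⟨Z', hZ', hZ'0, hZ'φ⟩ : ∃ Z ∈ orthogonalLower b (b.h' i),
      vecDeriv 𝔤 Z + ⁅pMinusOne b + cartanIncl H u, Z⁆ = 0 ∧
        pair (killingForm ℂ 𝔤 (b.h j)) Z ≠ 0 := by
    refine h.exists_flat (orthogonalLower_stable u _) _
      (w := 1 ⊗ₜ[ℂ] ((b.h' i + (2 : ℂ) • b.h' j : H) : 𝔤))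
      (tmul_mem_orthogonalLower (hrho _) (fun n hn => hpos n hn.symm) ?_) ?_
    · refine (killingForm_h b i _).trans ?_
      simp [A_diag, hij]
    · rw [pair_tmul, mul_one, killingForm_h]
      simp only [map_add, map_smul, b.baseSupp_apply_h', A_diag, hji, smul_eq_mul]
      have := killingForm_e_f_ne_zero b j
      norm_num
      exact this
  have hconst : ratDeriv (pair (killingForm ℂ 𝔤 (b.h j)) Z') = 0 := by
    rw [← pair_vecDeriv, eq_neg_of_add_eq_zero_left hZ'0, map_neg]
    exact neg_eq_zero.2 (pair_killingForm_cartan (x := b.h' j) u hZ')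
  obtain ⟨c, hc⟩ := exists_eq_C_of_ratDeriv_eq_zero hconst
  have hc0 : c ≠ 0 := by
    rintro rfl
    exact hZ'φ (by rw [hc, map_zero])
  have hCc : RatFunc.C (-c⁻¹) * RatFunc.C c = -1 := by
    rw [← map_mul, neg_mul, inv_mul_cancel₀ hc0, map_neg, map_one]
  have ej := ratDeriv_pair_killingForm_e hZ0 j
  have ei' := ratDeriv_pair_killingForm_e hZ'0 i
  have ej' := ratDeriv_pair_killingForm_e hZ'0 j
  have e3' := ratDeriv_pair_killingForm_lie_e_e hZ'0 hij hji
  have o1 : pair (killingForm ℂ 𝔤 (b.h j)) Z = 0 := hZ.2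
  have o2 : pair (killingForm ℂ 𝔤 (b.h i)) Z' = 0 := hZ'.2
  -- Scaling by -1/c turns the constant source -c in the equation of e_j into 1.
  refine ⟨_, RatFunc.C (-c⁻¹) * pair (killingForm ℂ 𝔤 (b.e j)) Z',
    RatFunc.C (-c⁻¹) * pair (killingForm ℂ 𝔤 (b.e i)) Z',
    RatFunc.C (-c⁻¹) * pair (killingForm ℂ 𝔤 ⁅b.e i, b.e j⁆) Z', hZφ, ?_, ?_, ?_, ?_⟩
  · rw [ej, o1, sub_zero]
  · rw [ratDeriv_C_mul, ej', hc]
    linear_combination -hCc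
  · rw [ratDeriv_C_mul, ei', o2]
    ring
  · rw [ratDeriv_C_mul, e3']
    ring

end Killing

/-! ### Congruences -/

theorem IsCyclotomic.pair_pow_eq {ι : Type*} [Fintype ι] [DecidableEq ι] {𝔤 : Type*} [LieRing 𝔤]
    [LieAlgebra ℂ 𝔤] [FiniteDimensional ℂ 𝔤] {H : LieSubalgebra ℂ 𝔤} {b : LieAlgebra.Basis ι H}
    {ν : Equiv.Perm ι} {ω : ℂˣ} {ς : 𝔤 ≃ₗ⁅ℂ⁆ 𝔤} (hς : IsTwistedDiagramAut b ν ω ς)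
    {u : Mer ⊗[ℂ] H} (hu : IsCyclotomic ω ς u) (m : ℕ) (i : ι) :
    pair (b.baseSupp ((ν ^ m) i)) u =
      RatFunc.C ((ω⁻¹ ^ m : ℂˣ) : ℂ) * dil (ω⁻¹ ^ m) (pair (b.baseSupp i) u) := by
  induction m with
  | zero => simp [dil_one]
  | succ m ih =>
    rw [pow_succ', Equiv.Perm.mul_apply, hu.pair_eq b hς, ih, C_mul_dil_C_mul_dil, ← pow_succ']

/-- Both sides say that T divides 4L(n + 1), the orbit having 2L elements. -/
theorem _root_.IsPrimitiveRoot.exists_int_iff {ω : ℂˣ} {T L : ℕ} (hω : IsPrimitiveRoot ω T)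
    (hL : 0 < L) (n : ℕ) :
    (∃ m : ℤ, (n : ℂ) + 1 + (n + 1) = m * ((T : ℂ) / ((2 * L : ℕ) : ℂ))) ↔
      ((ω⁻¹ ^ L : ℂˣ) : ℂ) ^ (4 * (n + 1)) = 1 := by
  have h1 : ((ω⁻¹ ^ L : ℂˣ) : ℂ) ^ (4 * (n + 1)) = 1 ↔ T ∣ L * (4 * (n + 1)) := by
    rw [← Units.val_pow_eq_pow_val, Units.val_eq_one, ← pow_mul, inv_pow, inv_eq_one,
      hω.pow_eq_one_iff_dvd]
  have hL0 : (L : ℂ) ≠ 0 := by exact_mod_cast hL.ne'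
  rw [h1]
  constructor
  · rintro ⟨m, hm⟩
    have h2 : ((L * (4 * (n + 1)) : ℕ) : ℂ) = ((T * m : ℤ) : ℂ) := by
      push_cast at hm ⊢
      field_simp at hm
      linear_combination hm
    have h3 : ((L * (4 * (n + 1)) : ℕ) : ℤ) = T * m := by exact_mod_cast h2
    exact Int.natCast_dvd_natCast.1 ⟨m, h3⟩
  · rintro ⟨m, hm⟩
    refine ⟨m, ?_⟩
    have h2 : ((L * (4 * (n + 1)) : ℕ) : ℂ) = ((T * m : ℕ) : ℂ) := congrArg _ hm
    push_cast at h2 ⊢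
    field_simp
    linear_combination h2

end CyclotomicMiura

/-! ### Assembly of the local analysis, the gauge computation and the residues. -/

theorem theorem4 {ι : Type*} [Fintype ι] [DecidableEq ι]
    {𝔤 : Type*} [LieRing 𝔤] [LieAlgebra ℂ 𝔤] [FiniteDimensional ℂ 𝔤] [LieAlgebra.IsSemisimple ℂ 𝔤]
    {H : LieSubalgebra ℂ 𝔤} (b : LieAlgebra.Basis ι H)
    -- the diagram automorphism, the root of unity and the automorphism `ς`
    (ν : Equiv.Perm ι) (hν : ∀ i j, b.A (ν i) (ν j) = b.A i j)
    (T : ℕ) (hT : 0 < T) (hνT : ν ^ T = 1)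
    (ω : ℂˣ) (hω : IsPrimitiveRoot ω T)
    (ς : 𝔤 ≃ₗ⁅ℂ⁆ 𝔤) (hς : IsTwistedDiagramAut b ν ω ς)
    -- the coweight `λ₀` is integral, dominant and invariant
    (lam : H) (hlam : ς (lam : 𝔤) = lam) (hdom : ∀ i, ∃ n : ℕ, b.baseSupp i lam = n)
    -- the cyclotomic Miura oper `d + (p₋₁ + u) dt`
    (u : Mer ⊗[ℂ] H) (hu : IsCyclotomic ω ς u) (hu0 : HasResZero u (-lam))
    -- an orbit of type `A₂^{×|I|/2}`
    (k : ι) (hk : ell b ν k = 2) :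
    -- regular solutions: the condition is necessary
    ((∃ f : Fin 3 → Mer, SolvesRiccati b ν k u f ∧ f ≠ 0 ∧ (∀ c, RegularAtZero (f c)) ∧
        MemUnipotentInvariants b ω ς (gaugeParam b ν ω k f)) →
      ∃ m : ℤ, b.baseSupp k (lam + rho b) + b.baseSupp (bar ν k) (lam + rho b) =
        m * ((T : ℂ) / (orbit ν k).card)) ∧
    -- regular solutions: the condition is sufficient
    (MonodromyFree (pMinusOne b + cartanIncl H u) →
      (∃ m : ℤ, b.baseSupp k (lam + rho b) + b.baseSupp (bar ν k) (lam + rho b) =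
        m * ((T : ℂ) / (orbit ν k).card)) →
      ∃ f : Fin 3 → Mer, SolvesRiccati b ν k u f ∧ f ≠ 0 ∧ (∀ c, RegularAtZero (f c)) ∧
        MemUnipotentInvariants b ω ς (gaugeParam b ν ω k f)) ∧
    -- singular solutions
    (∀ f : Fin 3 → Mer, SolvesRiccati b ν k u f → ¬ (∀ c, RegularAtZero (f c)) →
      (MemUnipotentInvariants b ω ς (gaugeParam b ν ω k f) ↔
        HasPolePattern f (2 * (b.baseSupp k lam + 1)) 0 0)) ∧
    -- the new Miura oper and its residues at the origin and at infinity
    (∀ f : Fin 3 → Mer, SolvesRiccati b ν k u f → f ≠ 0 →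
      MemUnipotentInvariants b ω ς (gaugeParam b ν ω k f) →
      ∃ v : Mer ⊗[ℂ] H, IsCyclotomic ω ς v ∧
        IsGaugeTransform (gaugeParam b ν ω k f)
          (pMinusOne b + cartanIncl H u) (pMinusOne b + cartanIncl H v) ∧
        ((∀ c, RegularAtZero (f c)) → HasResZero v (-lam)) ∧
        (¬ (∀ c, RegularAtZero (f c)) → HasResZero v (-dot b (sOrbit b ν k) lam)) ∧
        (∀ μ : H, HasResInfty u μ → (∃ κ : ℝ, 0 ≤ κ ∧ b.baseSupp k (μ + rho b) = κ) →
          HasResInfty v (dot b (sOrbit b ν k) μ))) := by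
  obtain ⟨L, hO⟩ := exists_isA2Orbit b hν hk
  obtain ⟨n, hn⟩ := hdom k
  have hbar : bar ν k = (ν ^ L) k := by simpa using hO.bar 0
  have hinv (f : Fin 3 → Mer) := hO.memUnipotentInvariants_iff (ω := ω) hν hς f
  have hlam := baseSupp_of_map_eq b hς hlam
  have hn' : b.baseSupp (bar ν k) lam = n := by rw [hbar, baseSupp_pow hlam, hn]
  have hu0 := (hasResZero_iff u (-lam)).1 hu0
  set q := pair (b.baseSupp k) u with hq
  set q' := pair (b.baseSupp (bar ν k)) u with hq'
  obtain ⟨q₁, hq₁, eq₁⟩ : ∃ q₁, RegularAtZero q₁ ∧ q = RatFunc.C (-(n : ℂ)) / RatFunc.X + q₁ :=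
    ⟨_, hu0 (b.baseSupp k), by rw [map_neg (b.baseSupp k), hn]; ring⟩
  obtain ⟨q₁', hq₁', eq₁'⟩ :
      ∃ q₁', RegularAtZero q₁' ∧ q' = RatFunc.C (-(n : ℂ)) / RatFunc.X + q₁' :=
    ⟨_, hu0 (b.baseSupp (bar ν k)), by rw [map_neg (b.baseSupp _), hn']; ring⟩
  have hqs' : q' = RatFunc.C ((ω⁻¹ ^ L : ℂˣ) : ℂ) * dil (ω⁻¹ ^ L) q := by
    rw [hq', hbar, hu.pair_pow_eq hς]
  -- A second half turn brings k̄ back to k.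
  have hqs : q = RatFunc.C ((ω⁻¹ ^ L : ℂˣ) : ℂ) * dil (ω⁻¹ ^ L) q' := by
    have hp : (ν ^ L) ((ν ^ L) k) = k := by
      rw [← Equiv.Perm.mul_apply, ← pow_add]
      simpa using hO.period 0
    rw [hq', hbar, ← hu.pair_pow_eq hς, hp]
  have hcong : (∃ m : ℤ, b.baseSupp k (lam + rho b) + b.baseSupp (bar ν k) (lam + rho b) =
      m * ((T : ℂ) / (orbit ν k).card)) ↔ ((ω⁻¹ ^ L : ℂˣ) : ℂ) ^ (4 * (n + 1)) = 1 := by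
    rw [map_add, map_add, hn, hn', baseSupp_rho, baseSupp_rho, hO.card]
    exact hω.exists_int_iff hO.pos n
  refine ⟨?_, ?_, ?_, ?_⟩
  · rintro ⟨f, hf, hf0, hfr, hg⟩
    obtain ⟨x₁, y₁, -, -, ⟨-, -, -, h⟩ | ⟨-, -, h, -⟩⟩ :=
      symmetric_dichotomy ((hinv f).1 hg) hf0 hf eq₁ eq₁' hq₁ hq₁'
    · exact hcong.2 h
    · exact absurd hfr h
  · intro hmon hc
    have hnear : b.A k (bar ν k) = -1 := by rw [hbar]; simpa using hO.near 0
    have hnear' : b.A (bar ν k) k = -1 := by rw [hbar]; simpa using hO.near' 0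
    obtain ⟨φ, r, p₁, p₃, hφ0, hφ, hr, hp₁, hp₃⟩ := hmon.exists_solutions hnear hnear'
    obtain ⟨f, hf, hf0, hfr, hs⟩ := exists_regular_symmetric_solution hqs hqs' eq₁ eq₁' hq₁ hq₁'
      (hcong.1 hc) hφ0 hφ hr hp₁ hp₃
    exact ⟨f, hf, hf0, hfr, (hinv f).2 hs⟩
  · intro f hf hfs
    have hf0 : f ≠ 0 := by
      rintro rfl
      exact hfs fun _ => RegularAtZero.zero
    rw [hinv, hn]
    constructor
    · intro hs
      obtain ⟨x₁, y₁, -, -, ⟨-, -, h, -⟩ | ⟨-, -, -, h⟩⟩ :=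
        symmetric_dichotomy hs hf0 hf eq₁ eq₁' hq₁ hq₁'
      · exact absurd h hfs
      · exact h
    · intro h
      exact isSymmetric_of_hasPolePattern hf h hqs hqs' eq₁ eq₁' hq₁ hq₁'
  · intro f hf hf0 hg
    have hs := (hinv f).1 hg
    refine ⟨u + ∑ m ∈ Finset.range L, shift b ν k L (propagate ω f) m,
      hO.isCyclotomic_add_sum_shift hς hu hs, ?_, fun hfr => ?_, fun hfs => ?_, fun μ hμ hκ => ?_⟩
    · rw [hO.gaugeParam_eq_prod]
      exact hO.isGaugeTransform_prod _ le_rfl u fun m _ => hO.riccatiSystem_propagate hς hu hf m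
    · rw [hasResZero_iff]
      have := hasRes_sum_shift (b := b) (ν := ν) (ω := ω) (k := k) (L := L) (f := f) (a := 0)
        isResidueClass_regularAtZero (by simpa using (hfr 0).add (hfr 1))
        (by simpa using (hfr 0).sub (hfr 1)) hu0
      simpa using this
    · obtain ⟨x₁, y₁, hx₁, hy₁, ⟨-, -, h, -⟩ | ⟨ex, ey, -, -⟩⟩ :=
        symmetric_dichotomy hs hf0 hf eq₁ eq₁' hq₁ hq₁'
      · exact absurd h hfs
      -- The reflection subtracts 2(n + 1) times the coroot sum from λ₀, matching the residue 2(n +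
      -- 1) of x and y.
      have hdot := hO.dot_sOrbit (c := n + 1) (x := lam) fun m => by
        rw [map_add, baseSupp_rho, baseSupp_pow hlam, hn]
      rw [hasResZero_iff, hdot, neg_sub, sub_eq_neg_add]
      exact hasRes_sum_shift isResidueClass_regularAtZero (by rwa [ex, add_sub_cancel_left])
        (by rwa [ey, add_sub_cancel_left]) hu0
    · obtain ⟨κ, hκ0, hκ⟩ := hκ
      have hV := isResidueClass_vanishesToOrderTwoAtInfty
      have hμ' := (hasResInfty_iff u μ).1 hμ
      -- Cyclotomy of u makes its residue at infinity ν-invariant, so the assumption at k extends to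
      -- the whole orbit.
      have hμν (i : ι) : b.baseSupp (ν i) μ = b.baseSupp i μ := by
        have := hu.baseSupp_eq_of_hasRes hV hς hμ' i
        rwa [map_neg, map_neg, neg_inj] at this
      have hκ' (m : ℕ) : b.baseSupp ((ν ^ m) k) (μ + rho b) = κ := by
        rw [map_add, baseSupp_rho, baseSupp_pow hμν, ← hκ, map_add, baseSupp_rho]
      have hres (m : ℕ) : VanishesToOrderTwoAtInfty
          (pair (b.baseSupp ((ν ^ m) k)) u + RatFunc.C (κ - 1 : ℂ) / RatFunc.X) := by
        have h1 := hμ' (b.baseSupp ((ν ^ m) k))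
        have h2 : b.baseSupp ((ν ^ m) k) μ = κ - 1 := by
          rw [← hκ' m, map_add, baseSupp_rho, add_sub_cancel_right]
        rw [map_neg, h2, map_neg] at h1
        convert h1 using 1
        ring
      obtain ⟨hx, hy⟩ := (riccatiSystem_iff q q' f).1 hf
      obtain ⟨vx, vy⟩ := exponents_at_infinity hκ0 (hs.left_ne_zero hf0) hx hy (by ring)
        hs.right_eq (hres 0) (by rw [hq', hbar]; exact hres L)
      have := hasRes_sum_shift (b := b) (ν := ν) (ω := ω) (k := k) (L := L) hV vx vy hμ'
      rw [hasResInfty_iff, hO.dot_sOrbit hκ', neg_sub, sub_eq_neg_add]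
      exact this
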